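/- Let $N\ge 2$, let $B$ and $S=\partial B$ be the open unit ball and the unit sphere of $\mathbb{R}^N$ centred at the origin, and let $B_+=\{x\in B: x_N>0\}$. Let $\Omega\subset B_+$ be a domain (a non-empty connected open set) whose boundary is $\partial\Omega=\overline{\Sigma}\cup T$, where $\Sigma=\partial\Omega\setminus\overline{T}$, $T=\partial\Omega\setminus\overline{\Sigma}$, and - $\Sigma\subset B$ (hence $\Sigma\subset\{x\in B: x_N\ge 0\}$; this includes the case $\Sigma\subset B_+$) is a smooth hypersurface of finite $(N-1)$-dimensional surface measure, and $\Omega$ lies locally on one side of it; - $T\subset S$ (the case $T=\varnothing$ is allowed); - $\Lambda=\overline{\Sigma}\cap\overline{T}$ is an embedded $(N-2)$-dimensional submanifold of $S$, of class $C^1$ at least (for $N=2$, a finite set). Let $\nu$ be the outward unit normal to $\partial\Omega$ on $\Sigma\cup T$ (so $\nu(x)=x$ on $T$), let $u_\nu=\langle\nabla u,\nu\rangle$, and let $dS_x$ be the surface measure. Let $u\in W^{1,\infty}(\Omega)\cap W^{2,2}(\Omega)$ be a classical solution, of class $C^\infty(\overline{\Omega}\setminus\Lambda)$, of the mixed problem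 $$\Delta u=N\ \text{ in }\Omega,\qquad u=0\ \text{ on }\Sigma,\qquad u_\nu=u\ \text{ on }T.$$ Let $X^q(x)=x_N\,x-\tfrac12(|x|^2+1)\,e_N$, where $e_N=(0,\dots,0,1)$, and let $|\nabla^2u|^2=\sum_{i,j}(\partial_{ij}u)^2$. Then, for every constant $c\in\mathbb{R}$, the integrals below converge absolutely and $$\int_\Omega x_N\,(-u)\left\{|\nabla^2u|^2-\frac{(\Delta u)^2}{N}\right\}dx=\frac12\int_\Sigma\left(u_\nu^2-c^2\right)\left[x_N\,u_\nu-\langle X^q,\nu\rangle\right]dS_x.$$ -/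

import Mathlib

open MeasureTheory Set
open scoped ENNReal ContDiff Topology

noncomputable section

namespace HalfBall

/-- The Euclidean space `ℝ^N` with `N = n + 1`. The last coordinate `x_N` is `x (Fin.last n)`. -/
abbrev E (n : ℕ) : Type := EuclideanSpace ℝ (Fin (n + 1))

/-- The `i`-th vector of the canonical basis. -/
def e {n : ℕ} (i : Fin (n + 1)) : E n := EuclideanSpace.single i (1 : ℝ)

/-- The open upper half of the unit ball, `B_+ = {x ∈ B : x_N > 0}`. -/
def halfBall (n : ℕ) : Set (E n) := {x | x ∈ Metric.ball (0 : E n) 1 ∧ 0 < x (Fin.last n)}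

/-! ### Smooth boundary points and the outward unit normal -/

/-- `φ` is a local defining function of `Ω` at the boundary point `x`: in a neighbourhood `U` of `x`
it is smooth, `Ω ∩ U = {φ < 0} ∩ U`, `φ x = 0`, and `∇φ(x) ≠ 0`. Hence `∂Ω` is near `x` the smooth
hypersurface `{φ = 0}` and `Ω` lies on one side of it. -/
def IsDefiningFunction {n : ℕ} (Ω : Set (E n)) (x : E n) (φ : E n → ℝ) : Prop :=
  φ x = 0 ∧ gradient φ x ≠ 0 ∧
    ∃ U : Set (E n), IsOpen U ∧ x ∈ U ∧ ContDiffOn ℝ ∞ φ U ∧ ∀ y ∈ U, (y ∈ Ω ↔ φ y < 0)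

/-- `∂Ω` is a smooth hypersurface near `x`, with `Ω` on one side of it. -/
def IsSmoothBoundaryPoint {n : ℕ} (Ω : Set (E n)) (x : E n) : Prop :=
  ∃ φ : E n → ℝ, IsDefiningFunction Ω x φ

open Classical in
/-- The outward unit normal `ν(x) = ∇φ(x) / |∇φ(x)|` to `∂Ω` at a smooth boundary point, where `φ` is
any local defining function (see `outerNormal_eq` for the independence of `φ`). -/
def outerNormal {n : ℕ} (Ω : Set (E n)) (x : E n) : E n :=
  if h : IsSmoothBoundaryPoint Ω x then ‖gradient h.choose x‖⁻¹ • gradient h.choose x else 0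

lemma IsDefiningFunction.hasGradientAt {n : ℕ} {Ω : Set (E n)} {x : E n} {φ : E n → ℝ}
    (h : IsDefiningFunction Ω x φ) : HasGradientAt φ (gradient φ x) x := by
  obtain ⟨-, -, U, hU, hx, hφ, -⟩ := h
  exact ((hφ.contDiffAt (hU.mem_nhds hx)).differentiableAt (by simp)).hasGradientAt

lemma IsDefiningFunction.inner_nonpos {n : ℕ} {Ω : Set (E n)} {x : E n} {φ ψ : E n → ℝ}
    (hφ : IsDefiningFunction Ω x φ) (hψ : IsDefiningFunction Ω x ψ) {v : E n}
    (hv : inner ℝ (gradient φ x) v < 0) : inner ℝ (gradient ψ x) v ≤ 0 := by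
  have key : ∀ {χ : E n → ℝ}, IsDefiningFunction Ω x χ →
      HasDerivAt (fun t : ℝ => χ (x + t • v)) (inner ℝ (gradient χ x) v) 0 := by
    intro χ hχ
    have h1 : HasFDerivAt χ (InnerProductSpace.toDual ℝ (E n) (gradient χ x)) (x + (0 : ℝ) • v) := by
      simpa using hχ.hasGradientAt.hasFDerivAt
    have h2 : HasDerivAt (fun t : ℝ => x + t • v) v 0 := by
      simpa using ((hasDerivAt_id (0 : ℝ)).smul_const v).const_add x
    have h3 := h1.comp_hasDerivAt (0 : ℝ) h2
    rw [InnerProductSpace.toDual_apply_apply] at h3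
    exact h3
  by_contra! hpos
  have hc : Filter.Tendsto (fun t : ℝ => x + t • v) (𝓝[>] 0) (𝓝 x) := by
    have : ContinuousAt (fun t : ℝ => x + t • v) 0 := by fun_prop
    have h := this.tendsto
    simp only [zero_smul, add_zero] at h
    exact h.mono_left nhdsWithin_le_nhds
  have s1 := (hasDerivAt_iff_tendsto_slope.1 (key hφ)).mono_left
    (nhdsWithin_mono (0 : ℝ) (s := Ioi 0) (t := {0}ᶜ) (fun t ht => (ne_of_gt ht)))
  have s2 := (hasDerivAt_iff_tendsto_slope.1 (key hψ)).mono_left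
    (nhdsWithin_mono (0 : ℝ) (s := Ioi 0) (t := {0}ᶜ) (fun t ht => (ne_of_gt ht)))
  obtain ⟨hφ0, -, U, hU, hxU, -, hUΩ⟩ := hφ
  obtain ⟨hψ0, -, V, hV, hxV, -, hVΩ⟩ := hψ
  obtain ⟨t, ht1, ht2, htU, htV, ht0⟩ := ((s1.eventually (gt_mem_nhds hv)).and
    ((s2.eventually (lt_mem_nhds hpos)).and ((hc.eventually (hU.mem_nhds hxU)).and
    ((hc.eventually (hV.mem_nhds hxV)).and self_mem_nhdsWithin)))).exists
  have ht0 : (0 : ℝ) < t := ht0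
  simp only [slope_def_field, zero_smul, add_zero, sub_zero, hφ0, hψ0] at ht1 ht2
  have a1 : φ (x + t • v) < 0 := by
    by_contra! hh
    exact absurd ht1 (not_lt.2 (div_nonneg hh ht0.le))
  have a2 : ψ (x + t • v) < 0 := (hVΩ _ htV).1 ((hUΩ _ htU).2 a1)
  exact absurd ht2 (not_lt.2 (div_nonpos_of_nonpos_of_nonneg a2.le ht0.le))

/-- The outward unit normal does not depend on the defining function. -/
lemma outerNormal_eq {n : ℕ} {Ω : Set (E n)} {x : E n} {φ : E n → ℝ}
    (h : IsDefiningFunction Ω x φ) : outerNormal Ω x = ‖gradient φ x‖⁻¹ • gradient φ x := by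
  have hs : IsSmoothBoundaryPoint Ω x := ⟨φ, h⟩
  rw [outerNormal, dif_pos hs]
  have hψ := hs.choose_spec
  set ψ := hs.choose
  set a := gradient φ x with ha
  set b := gradient ψ x with hb
  have a0 : 0 < ‖a‖ := norm_pos_iff.2 h.2.1
  have b0 : 0 < ‖b‖ := norm_pos_iff.2 hψ.2.1
  -- `⟪a, v⟫ ≤ 0` implies `⟪b, v⟫ ≤ 0`, by approximation with `v - ε a`
  have key : ∀ v : E n, inner ℝ a v ≤ 0 → inner ℝ b v ≤ 0 := by
    intro v hv
    have hlim : Filter.Tendsto (fun ε : ℝ => inner ℝ b (v - ε • a)) (𝓝[>] 0) (𝓝 (inner ℝ b v)) := by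
      have : ContinuousAt (fun ε : ℝ => (inner ℝ b (v - ε • a) : ℝ)) 0 := by fun_prop
      have h := this.tendsto
      simp only [zero_smul, sub_zero] at h
      exact h.mono_left nhdsWithin_le_nhds
    refine le_of_tendsto hlim ?_
    filter_upwards [self_mem_nhdsWithin] with ε hε
    have hε : (0 : ℝ) < ε := hε
    refine h.inner_nonpos hψ ?_
    rw [inner_sub_right, inner_smul_right, real_inner_self_eq_norm_sq]
    have : 0 < ε * ‖a‖ ^ 2 := by positivity
    linarith
  have h1 := key (‖a‖ • b - ‖b‖ • a) (by
    rw [inner_sub_right, inner_smul_right, inner_smul_right, real_inner_self_eq_norm_sq]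
    have := real_inner_le_norm a b
    nlinarith)
  rw [inner_sub_right, inner_smul_right, inner_smul_right, real_inner_self_eq_norm_sq] at h1
  have h2 : inner ℝ a b = ‖a‖ * ‖b‖ := by
    apply le_antisymm (real_inner_le_norm a b)
    rw [real_inner_comm]
    have : ‖b‖ * (‖a‖ * ‖b‖) ≤ ‖b‖ * inner ℝ b a := by nlinarith
    exact le_of_mul_le_mul_left this b0
  have h3 := inner_eq_norm_mul_iff_real.1 h2
  have h4 : b = (‖a‖⁻¹ * ‖b‖) • a := by
    rw [mul_smul, h3, smul_smul, inv_mul_cancel₀ a0.ne', one_smul]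
  calc ‖b‖⁻¹ • b = ‖b‖⁻¹ • ((‖a‖⁻¹ * ‖b‖) • a) := by rw [← h4]
    _ = ‖a‖⁻¹ • a := by
      rw [smul_smul]; congr 1; field_simp

/-! ### The domain -/

/-- `M` is an embedded submanifold of `ℝ^N` of class `C^1` and of codimension `k`: locally it is the
zero set of a `C^1` map to `ℝ^k` whose differential is onto. -/
def IsSubmanifoldOfCodim {n : ℕ} (k : ℕ) (M : Set (E n)) : Prop :=
  ∀ x ∈ M, ∃ (U : Set (E n)) (Φ : E n → EuclideanSpace ℝ (Fin k)),
    IsOpen U ∧ x ∈ U ∧ ContDiffOn ℝ 1 Φ U ∧ Function.Surjective (fderiv ℝ Φ x) ∧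
      ∀ y ∈ U, (y ∈ M ↔ Φ y = 0)

/-- The common boundary `Λ` of the two portions of `∂Ω`. -/
def corner {n : ℕ} (Sig T : Set (E n)) : Set (E n) := closure Sig ∩ closure T

/-- `Ω` is a domain in the half-ball whose boundary consists of the smooth hypersurface `Sig`
inside the unit ball, of `T`, which is contained in the unit sphere, and of their common boundary
`Λ`, a submanifold of dimension `N - 2` (necessarily contained in the sphere). -/
structure IsHalfBallDomain {n : ℕ} (Ω Sig T : Set (E n)) : Prop where
  isOpen : IsOpen Ω
  isConnected : IsConnected Ω
  subset_halfBall : Ω ⊆ halfBall n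
  sig_eq : Sig = frontier Ω \ closure T
  t_eq : T = frontier Ω \ closure Sig
  /-- Since `Ω` lies in `B_+`, this means that `Sig` is contained in `{x ∈ B : x_N ≥ 0}`. -/
  sig_subset : Sig ⊆ Metric.ball 0 1
  t_subset : T ⊆ Metric.sphere 0 1
  sig_smooth : ∀ x ∈ Sig, IsSmoothBoundaryPoint Ω x
  /-- The surface measure of `Sig` is finite. -/
  sig_area : μHE[n] Sig < ⊤
  corner_submanifold : IsSubmanifoldOfCodim 2 (corner Sig T)

/-! ### Sobolev spaces -/

/-- `g` is the weak partial derivative `∂_i f` in the open set `Ω`. -/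
def HasWeakPartialDeriv {n : ℕ} (Ω : Set (E n)) (i : Fin (n + 1)) (f g : E n → ℝ) : Prop :=
  LocallyIntegrableOn f Ω ∧ LocallyIntegrableOn g Ω ∧
    ∀ φ : E n → ℝ, ContDiff ℝ ∞ φ → HasCompactSupport φ → tsupport φ ⊆ Ω →
      ∫ x in Ω, f x * fderiv ℝ φ x (e i) = - ∫ x in Ω, g x * φ x

/-- The Sobolev space `W^{k,p}(Ω)`. -/
def MemSobolev {n : ℕ} (Ω : Set (E n)) : ℕ → ℝ≥0∞ → (E n → ℝ) → Prop
  | 0, p, f => MemLp f p (volume.restrict Ω)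
  | k + 1, p, f => MemLp f p (volume.restrict Ω) ∧
      ∀ i, ∃ g, HasWeakPartialDeriv Ω i f g ∧ MemSobolev Ω k p g

/-! ### The boundary value problem -/

/-- The outward normal derivative `u_ν(x)`, for `u` differentiable up to the boundary. -/
def normalDeriv {n : ℕ} (Ω : Set (E n)) (u : E n → ℝ) (x : E n) : ℝ :=
  fderivWithin ℝ u (closure Ω) x (outerNormal Ω x)

/-- `u` is a classical solution, of class `C^∞` on `Ω ∪ Sig ∪ T`, which is the closure of `Ω` without
`Λ`, of the mixed problem `Δu = N` in `Ω`, `u = 0` on `Sig`, `u_ν = u` on `T`. -/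
structure IsSolution {n : ℕ} (Ω Sig T : Set (E n)) (u : E n → ℝ) : Prop where
  smooth : ContDiffOn ℝ ∞ u (closure Ω \ corner Sig T)
  laplacian_eq : ∀ x ∈ Ω, Laplacian.laplacian u x = (n : ℝ) + 1
  dirichlet : ∀ x ∈ Sig, u x = 0
  steklov : ∀ x ∈ T, normalDeriv Ω u x = u x

/-- The squared Frobenius norm `|∇²u(x)|²` of the Hessian. -/
def hessianNormSq {n : ℕ} (u : E n → ℝ) (x : E n) : ℝ :=
  ∑ i, ∑ j, (iteratedFDeriv ℝ 2 u x ![e i, e j]) ^ 2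

/-- The conformal Killing field `X^q(x) = x_N x - (|x|² + 1) / 2 e_N`. -/
def killingField {n : ℕ} (x : E n) : E n :=
  x (Fin.last n) • x - ((1 / 2 : ℝ) * (‖x‖ ^ 2 + 1)) • e (Fin.last n)

end HalfBall

end

open HalfBall

noncomputable section

namespace HalfBall

variable {n : ℕ}

/-! ### The divergence -/

/-! Write w = x_N, V = ∇u, A = ∇²u, P = |V|²/2 − u and X = X^q. The identity is the divergence
theorem for one explicit field F (`mainVec`), polynomial in x, u, V and affine in A, such that div F
is the volume integrand, ⟨F, ν⟩ on Σ is half the boundary integrand, and F is tangent to the sphere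
along T. These are `divergence_mainVec`, `inner_mainVec_of_normal` and `inner_mainVec_of_robin`.

F is a sum of four kinds of terms. The P-function part P(wV + u e_N) − wu∇P, with ∇P = AV − V,
produces −wuΔP = −wu(|A|² − N), which is the integrand because Δu = N. The Pohozaev part −⟨X,V⟩V +
(|V|²/2 + Nu)X uses that X is conformal with factor w and tangent to the sphere. The part (c²/2)(X −
wV + u e_N) is divergence free, as div X = Nw = div(wV − u e_N), and tangent along T; this is why c
is arbitrary. The remaining terms all carry a factor u, hence vanish on Σ; some absorb the
divergence left over by the first two parts, the others form a divergence-free group containing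
wu²Ax. That last term removes the Hessian from the flux through T: differentiating u_ν = u along T
shows that x is an eigenvector of A there (`hess_apply_self_of_mem_t`), so the normal components of
−wuAV and wu²Ax cancel.

It remains to justify the divergence theorem (`IsHalfBallDomain.integral_divergence`). Since u and V
are bounded and A is square integrable, F is in L²; on Σ the Hessian enters only multiplied by u =
0, so the flux is bounded. The corner has codimension two and hence admits cutoffs with gradient
O(k) supported on sets of volume O(1/k²). For F in L² the error they cause tends to zero.

For fields vanishing near the corner the theorem is proved up to an error ε ∫_Σ |F| for every ε > 0
(`exists_local_divergence_theorem`). Near a point of Σ the boundary is a nearly flat graph.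
Inserting a step function of the defining function and integrating along lines gives the exact flux
as an integral over the tangent hyperplane. Lebesgue measure there is comparable to surface measure
up to a factor close to 1, because the projection is 1-Lipschitz and the graph map is (1 −
ε)⁻¹-Lipschitz. Near T the flux vanishes by tangency. A partition of unity adds up the local errors
to ε ∫_Σ |F|, and ε is arbitrary. -/

/-- The divergence of a vector field. -/
def divergence (F : E n → E n) (x : E n) : ℝ := ∑ i, fderiv ℝ F x (e i) i

lemma sum_smul_e (v : E n) : ∑ i, v i • (e i : E n) = v := by
  ext j
  simp [e, Finset.sum_apply, Pi.single_apply]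

lemma divergence_smul {f : E n → ℝ} {F : E n → E n} {x : E n} (hf : DifferentiableAt ℝ f x)
    (hF : DifferentiableAt ℝ F x) :
    divergence (fun y => f y • F y) x = fderiv ℝ f x (F x) + f x * divergence F x := by
  have h : fderiv ℝ (fun y => f y • F y) x =
      f x • fderiv ℝ F x + (fderiv ℝ f x).smulRight (F x) := fderiv_fun_smul hf hF
  have h1 : fderiv ℝ f x (F x) = ∑ i, F x i * fderiv ℝ f x (e i) := by
    conv_lhs => rw [← sum_smul_e (F x), map_sum]
    simp
  rw [h1]
  simp only [divergence, h, add_apply, smul_apply, ContinuousLinearMap.smulRight_apply,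
    PiLp.add_apply, PiLp.smul_apply, smul_eq_mul, Finset.sum_add_distrib, Finset.mul_sum]
  rw [add_comm]
  congr 1
  exact Finset.sum_congr rfl fun i _ => mul_comm _ _

lemma divergence_congr {F G : E n → E n} {x : E n} (h : F =ᶠ[𝓝 x] G) :
    divergence F x = divergence G x := by
  simp only [divergence, h.fderiv_eq]

lemma support_divergence_subset (F : E n → E n) : Function.support (divergence F) ⊆ tsupport F := by
  intro x hx
  by_contra h
  apply hx
  have : F =ᶠ[𝓝 x] 0 := notMem_tsupport_iff_eventuallyEq.1 h
  rw [divergence_congr this]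
  simp [divergence, show (0 : E n → E n) = fun _ => 0 from rfl]

lemma continuousOn_divergence {Ω : Set (E n)} (hΩ : IsOpen Ω) {F : E n → E n}
    (hF : ContDiffOn ℝ 1 F Ω) : ContinuousOn (divergence F) Ω := by
  have h := hF.continuousOn_fderiv_of_isOpen hΩ le_rfl
  unfold divergence
  refine continuousOn_finsetSum _ fun i _ => ?_
  have h2 : ContinuousOn (fun x => fderiv ℝ F x (e i)) Ω := h.clm_apply continuousOn_const
  exact (EuclideanSpace.proj (𝕜 := ℝ) i).continuous.comp_continuousOn h2

lemma integral_divergence_eq_zero {F : E n → E n} (hF : ContDiff ℝ 1 F) (hc : HasCompactSupport F) :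
    ∫ x, divergence F x = 0 := by
  have hcomp : ∀ i : Fin (n + 1), ContDiff ℝ 1 (fun x => F x i) := fun i =>
    (EuclideanSpace.proj (𝕜 := ℝ) i).contDiff.comp hF
  have hfd : ∀ (i : Fin (n + 1)) (x : E n), fderiv ℝ F x (e i) i =
      fderiv ℝ (fun x => F x i) x (e i) := by
    intro i x
    have h1 : HasFDerivAt (fun x => F x i)
        ((EuclideanSpace.proj (𝕜 := ℝ) i : E n →L[ℝ] ℝ).comp (fderiv ℝ F x)) x :=
      (EuclideanSpace.proj (𝕜 := ℝ) i : E n →L[ℝ] ℝ).hasFDerivAt.comp x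
        ((hF.differentiable one_ne_zero) x).hasFDerivAt
    rw [h1.fderiv]
    rfl
  have hcc : ∀ i : Fin (n + 1), HasCompactSupport (fun x => F x i) := fun i =>
    hc.comp_left (g := fun v : E n => v i) rfl
  have hint : ∀ i : Fin (n + 1), Integrable (fun x => fderiv ℝ (fun x => F x i) x (e i)) := by
    intro i
    refine Continuous.integrable_of_hasCompactSupport ?_ ((hcc i).fderiv_apply (𝕜 := ℝ) _)
    exact ((hcomp i).continuous_fderiv one_ne_zero).clm_apply continuous_const
  unfold divergence
  simp_rw [hfd]
  rw [integral_finsetSum _ fun i _ => hint i]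
  refine Finset.sum_eq_zero fun i _ => ?_
  -- Integration by parts against the constant function 1, whose derivative vanishes.
  have h := integral_mul_fderiv_eq_neg_fderiv_mul_of_integrable (μ := (volume : Measure (E n)))
    (f := fun _ : E n => (1 : ℝ)) (g := fun x => F x i) (v := e i) (by simp)
    (by simpa using hint i)
    (by simpa using (hcomp i).continuous.integrable_of_hasCompactSupport (hcc i))
    (by intro x _; fun_prop) (fun x _ => (hcomp i).differentiable one_ne_zero x)
  simpa using h

/-- Off its support F is locally zero, so regularity on Ω already makes it C¹ on the whole space. -/
lemma setIntegral_divergence_eq_zero {Ω : Set (E n)} (hΩ : IsOpen Ω) {F : E n → E n}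
    (hF : ContDiffOn ℝ 1 F Ω) (hc : HasCompactSupport F) (hs : tsupport F ⊆ Ω) :
    ∫ x in Ω, divergence F x = 0 := by
  rw [setIntegral_eq_integral_of_forall_compl_eq_zero]
  · refine integral_divergence_eq_zero ?_ hc
    refine contDiff_iff_contDiffAt.2 fun x => ?_
    by_cases hx : x ∈ tsupport F
    · exact hF.contDiffAt (hΩ.mem_nhds (hs hx))
    · exact contDiffAt_const.congr_of_eventuallyEq (notMem_tsupport_iff_eventuallyEq.1 hx)
  · intro x hx
    by_contra h
    exact hx (hs (support_divergence_subset F h))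

/-- Integration by parts against a cutoff `θ ∘ φ` that vanishes near the boundary `φ = 0`. -/
lemma integral_cutoff_mul_divergence {Ω U : Set (E n)} (hΩ : IsOpen Ω) (hU : IsOpen U)
    {F : E n → E n} (hF : ContDiffOn ℝ 1 F Ω) (hc : HasCompactSupport F) (hs : tsupport F ⊆ U)
    {φ : E n → ℝ} (hφ : ContDiffOn ℝ 1 φ U) (hΩU : ∀ y ∈ U, (y ∈ Ω ↔ φ y < 0))
    {θ : ℝ → ℝ} (hθ : ContDiff ℝ 1 θ) {c : ℝ} (hc0 : c < 0) (hθc : ∀ s, c < s → θ s = 0) :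
    ∫ x in Ω, θ (φ x) * divergence F x = ∫ x in Ω, -deriv θ (φ x) * fderiv ℝ φ x (F x) := by
  have hV : IsOpen (Ω ∩ U) := hΩ.inter hU
  have hFV := hF.mono (inter_subset_left (t := U))
  have hφV := hφ.mono (inter_subset_right (s := Ω))
  -- All integrands vanish off Z, a compact subset of Ω ∩ U because φ ≤ c < 0 on it. No regularity
  -- of F at the boundary is therefore needed.
  set Z : Set (E n) := {x | x ∈ tsupport F ∧ φ x ≤ c} with hZ
  have hZc : IsClosed Z := by
    have : ContinuousOn φ (tsupport F) := hφ.continuousOn.mono hs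
    exact this.preimage_isClosed_of_isClosed (isClosed_tsupport F) isClosed_Iic
  have hZV : Z ⊆ Ω ∩ U := fun x hx =>
    ⟨(hΩU x (hs hx.1)).2 (lt_of_le_of_lt hx.2 hc0), hs hx.1⟩
  have hdθ : ∀ s, c < s → deriv θ s = 0 := by
    intro s hs
    have : θ =ᶠ[𝓝 s] fun _ => 0 := by
      filter_upwards [lt_mem_nhds hs] with t ht using hθc t ht
    rw [this.deriv_eq]; simp
  have hZcomp : IsCompact Z := hc.isCompact.of_isClosed_subset hZc fun x hx => hx.1
  have key : ∀ (f : E n → ℝ), ContinuousOn f (Ω ∩ U) → (∀ x, x ∉ Z → f x = 0) →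
      Integrable f := by
    intro f hf hfZ
    have hsub : tsupport f ⊆ Z := closure_minimal (fun x hx => by
      by_contra h; exact hx (hfZ x h)) hZc
    refine Continuous.integrable_of_hasCompactSupport ?_
      (hZcomp.of_isClosed_subset (isClosed_tsupport f) hsub)
    exact hf.continuous_of_tsupport_subset hV (hsub.trans hZV)
  have hA : Integrable (fun x => θ (φ x) * divergence F x) := by
    apply key
    · exact (hθ.continuous.comp_continuousOn hφV.continuousOn).mul (continuousOn_divergence hV hFV)
    · intro x hx
      by_cases h1 : x ∈ tsupport F
      · rw [hθc _ (not_le.1 fun h2 => hx ⟨h1, h2⟩), zero_mul]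
      · have : divergence F x = 0 := by
          by_contra h; exact h1 (support_divergence_subset F h)
        rw [this, mul_zero]
  have hB : Integrable (fun x => -deriv θ (φ x) * fderiv ℝ φ x (F x)) := by
    apply key
    · exact (((hθ.continuous_deriv le_rfl).comp_continuousOn hφV.continuousOn).neg).mul
        ((hφV.continuousOn_fderiv_of_isOpen hV le_rfl).clm_apply hFV.continuousOn)
    · intro x hx
      by_cases h1 : x ∈ tsupport F
      · rw [hdθ _ (not_le.1 fun h2 => hx ⟨h1, h2⟩)]; simp
      · rw [image_eq_zero_of_notMem_tsupport h1]; simp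
  have hG : ContDiffOn ℝ 1 (fun x => θ (φ x) • F x) (Ω ∩ U) := (hθ.comp_contDiffOn hφV).smul hFV
  have hGs : tsupport (fun x => θ (φ x) • F x) ⊆ Z := by
    refine closure_minimal (fun x hx => ?_) hZc
    refine ⟨subset_tsupport F fun h => hx (by simp [h]), ?_⟩
    by_contra h
    exact hx (by simp [hθc _ (not_le.1 h)])
  have h0 := setIntegral_divergence_eq_zero hV hG
    (hZcomp.of_isClosed_subset (isClosed_tsupport _) hGs) (hGs.trans hZV)
  have hext : ∀ f : E n → ℝ, (∀ x, x ∉ Z → f x = 0) → ∫ x in Ω, f x = ∫ x in Ω ∩ U, f x := by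
    intro f hf
    rw [setIntegral_eq_integral_of_forall_compl_eq_zero fun x hx => hf x fun h => hx (hZV h).1,
      setIntegral_eq_integral_of_forall_compl_eq_zero fun x hx => hf x fun h => hx (hZV h)]
  rw [hext _ (fun x hx => ?_), hext _ (fun x hx => ?_), ← sub_eq_zero,
    ← integral_sub hA.integrableOn hB.integrableOn, ← h0]
  · refine setIntegral_congr_fun hV.measurableSet fun x hx => ?_
    have hφx : DifferentiableAt ℝ φ x :=
      (hφV.contDiffAt (hV.mem_nhds hx)).differentiableAt one_ne_zero
    have hθx : HasDerivAt θ (deriv θ (φ x)) (φ x) :=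
      (hθ.differentiable one_ne_zero _).hasDerivAt
    have hcomp := hθx.comp_hasFDerivAt x hφx.hasFDerivAt
    have hd : fderiv ℝ (fun y => θ (φ y)) x = deriv θ (φ x) • fderiv ℝ φ x := hcomp.fderiv
    rw [divergence_smul (f := fun y => θ (φ y)) hcomp.differentiableAt
      ((hFV.contDiffAt (hV.mem_nhds hx)).differentiableAt one_ne_zero), hd]
    simp only [smul_apply, smul_eq_mul]
    ring
  · by_cases h1 : x ∈ tsupport F
    · rw [hdθ _ (not_le.1 fun h2 => hx ⟨h1, h2⟩)]; simp
    · rw [image_eq_zero_of_notMem_tsupport h1]; simp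
  · by_cases h1 : x ∈ tsupport F
    · rw [hθc _ (not_le.1 fun h2 => hx ⟨h1, h2⟩), zero_mul]
    · have : divergence F x = 0 := by
        by_contra h; exact h1 (support_divergence_subset F h)
      rw [this, mul_zero]

/-! ### Step functions of a defining function -/

/-- A smooth nonincreasing step from `1` on `(-∞, -1/(k+1)]` to `0` on `[-1/(2(k+1)), ∞)`. -/
def stepDown (k : ℕ) (s : ℝ) : ℝ := Real.smoothTransition (-(2 * (k + 1) * s) - 1)

lemma contDiff_stepDown (k : ℕ) : ContDiff ℝ 1 (stepDown k) := by
  unfold stepDown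
  exact (Real.smoothTransition.contDiff (n := 1)).comp (by fun_prop)

lemma stepDown_nonneg (k : ℕ) (s : ℝ) : 0 ≤ stepDown k s := Real.smoothTransition.nonneg _

lemma stepDown_le_one (k : ℕ) (s : ℝ) : stepDown k s ≤ 1 := Real.smoothTransition.le_one _

lemma stepDown_eq_zero {k : ℕ} {s : ℝ} (hs : -(1 / (2 * (k + 1))) < s) : stepDown k s = 0 := by
  apply Real.smoothTransition.zero_of_nonpos
  have hk : (0 : ℝ) < 2 * (k + 1) := by positivity
  have : -1 < 2 * (k + 1) * s := by
    have h := mul_lt_mul_of_pos_left hs hk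
    have e1 : (2 * ((k : ℝ) + 1)) * -(1 / (2 * (k + 1))) = -1 := by field_simp
    linarith
  linarith

lemma stepDown_eq_one {k : ℕ} {s : ℝ} (hs : s ≤ -(1 / (k + 1))) : stepDown k s = 1 := by
  apply Real.smoothTransition.one_of_one_le
  have hk : (0 : ℝ) < k + 1 := by positivity
  have h := mul_le_mul_of_nonneg_left hs hk.le
  have e1 : ((k : ℝ) + 1) * -(1 / (k + 1)) = -1 := by field_simp
  linarith

lemma antitone_stepDown (k : ℕ) : Antitone (stepDown k) := by
  intro s t hst
  apply Real.smoothTransition.monotone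
  have : (0 : ℝ) ≤ 2 * (k + 1) := by positivity
  have := mul_le_mul_of_nonneg_left hst this
  linarith

lemma deriv_stepDown_nonpos (k : ℕ) (s : ℝ) : deriv (stepDown k) s ≤ 0 :=
  (antitone_stepDown k).deriv_nonpos

lemma deriv_stepDown_eq_zero {k : ℕ} {s : ℝ} (hs : s < -(1 / (k + 1))) :
    deriv (stepDown k) s = 0 := by
  have : stepDown k =ᶠ[𝓝 s] fun _ => 1 := by
    filter_upwards [gt_mem_nhds hs] with t ht using stepDown_eq_one (le_of_lt ht)
  rw [this.deriv_eq]; simp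

lemma tendsto_stepDown {s : ℝ} (hs : s < 0) :
    Filter.Tendsto (fun k : ℕ => stepDown k s) Filter.atTop (𝓝 1) := by
  have h1 : Filter.Tendsto (fun k : ℕ => -(1 / ((k : ℝ) + 1))) Filter.atTop (𝓝 0) := by
    simpa using (tendsto_one_div_add_atTop_nhds_zero_nat (𝕜 := ℝ)).neg
  refine tendsto_const_nhds.congr' ?_
  filter_upwards [h1.eventually (lt_mem_nhds hs)] with k hk
  exact (stepDown_eq_one (le_of_lt hk)).symm

/-- The derivative of the fixed transition function vanishes outside [0, 1], hence is bounded;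
rescaling multiplies it by 2(k + 1). -/
lemma exists_abs_deriv_stepDown_le :
    ∃ C : ℝ, 0 < C ∧ ∀ (k : ℕ) (s : ℝ), |deriv (stepDown k) s| ≤ C * (k + 1) := by
  have hcont : Continuous (deriv Real.smoothTransition) :=
    (Real.smoothTransition.contDiff (n := 1)).continuous_deriv le_rfl
  obtain ⟨C, hC⟩ := (isCompact_Icc (a := (0 : ℝ)) (b := 1)).exists_bound_of_continuousOn
    hcont.continuousOn
  have hC0 : 0 ≤ C := (norm_nonneg _).trans (hC 0 (by simp))
  have hall : ∀ t, |deriv Real.smoothTransition t| ≤ C := by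
    intro t
    rcases lt_or_ge t 0 with ht | ht
    · have : Real.smoothTransition =ᶠ[𝓝 t] fun _ => 0 := by
        filter_upwards [gt_mem_nhds ht] with s hs
          using Real.smoothTransition.zero_of_nonpos (le_of_lt hs)
      rw [this.deriv_eq]; simpa using hC0
    rcases lt_or_ge 1 t with ht1 | ht1
    · have : Real.smoothTransition =ᶠ[𝓝 t] fun _ => 1 := by
        filter_upwards [lt_mem_nhds ht1] with s hs
          using Real.smoothTransition.one_of_one_le (le_of_lt hs)
      rw [this.deriv_eq]; simpa using hC0
    · exact hC t ⟨ht, ht1⟩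
  -- The extra 1 only serves to make the constant positive.
  refine ⟨2 * C + 1, by positivity, fun k s => ?_⟩
  have h1 : HasDerivAt (fun s : ℝ => -(2 * ((k : ℝ) + 1) * s) - 1) (-(2 * (k + 1))) s := by
    have := (((hasDerivAt_id s).const_mul (2 * ((k : ℝ) + 1))).neg).sub_const 1
    simpa using this
  have h2 : HasDerivAt (stepDown k)
      (deriv Real.smoothTransition (-(2 * (k + 1) * s) - 1) * -(2 * (k + 1))) s := by
    have h3 : HasDerivAt Real.smoothTransition _ (-(2 * ((k : ℝ) + 1) * s) - 1) :=
      ((Real.smoothTransition.contDiff (n := 1)).differentiable one_ne_zero _).hasDerivAt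
    exact h3.comp s h1
  rw [h2.deriv, abs_mul, abs_neg, abs_of_pos (by positivity : (0 : ℝ) < 2 * (k + 1))]
  have := mul_le_mul_of_nonneg_right (hall (-(2 * (k + 1) * s) - 1))
    (by positivity : (0 : ℝ) ≤ 2 * ((k : ℝ) + 1))
  have hk : (0 : ℝ) ≤ k := by positivity
  nlinarith

/-! ### Concentration on the boundary -/

section Concentration

variable {r g : ℝ} {ψ ψ' : ℝ → ℝ}

/-- Here ψ stands for a defining function along a line, ψ' for its derivative and g for its zero.
The weight ψ' · (−`deriv (stepDown k)` ∘ ψ) will act as an approximate identity at g from the left.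
-/
lemma integrableOn_weight (hψ : ∀ t ∈ Icc (-r) r, HasDerivAt ψ (ψ' t) t)
    (hψc : ContinuousOn ψ' (Icc (-r) r)) (hg : g ∈ Ioo (-r) r) (k : ℕ) :
    IntegrableOn (fun t => ψ' t * -deriv (stepDown k) (ψ t)) (Ioo (-r) g) := by
  have hsub : Icc (-r) g ⊆ Icc (-r) r := Icc_subset_Icc_right hg.2.le
  have h : ContinuousOn (fun t => ψ' t * -deriv (stepDown k) (ψ t)) (Icc (-r) g) := by
    refine (hψc.mono hsub).mul (ContinuousOn.neg ?_)
    exact ((contDiff_stepDown k).continuous_deriv le_rfl).comp_continuousOn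
      fun t ht => (hψ t (hsub ht)).continuousAt.continuousWithinAt
  exact (h.integrableOn_Icc).mono_set Ioo_subset_Icc_self

/-- The weight is the derivative of −`stepDown k` ∘ ψ, so its mass is a difference of end values,
and the one at g is zero. -/
lemma integral_weight (hψ : ∀ t ∈ Icc (-r) r, HasDerivAt ψ (ψ' t) t)
    (hψc : ContinuousOn ψ' (Icc (-r) r)) (hg : g ∈ Ioo (-r) r) (hψg : ψ g = 0) (k : ℕ) :
    ∫ t in Ioo (-r) g, ψ' t * -deriv (stepDown k) (ψ t) = stepDown k (ψ (-r)) := by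
  have hsub : Icc (-r) g ⊆ Icc (-r) r := Icc_subset_Icc_right hg.2.le
  have hd : ∀ t ∈ uIcc (-r) g, HasDerivAt (fun t => -stepDown k (ψ t))
      (ψ' t * -deriv (stepDown k) (ψ t)) t := by
    intro t ht
    rw [uIcc_of_le hg.1.le] at ht
    have h1 : HasDerivAt (stepDown k) _ (ψ t) :=
      ((contDiff_stepDown k).differentiable one_ne_zero _).hasDerivAt
    convert! (h1.comp t (hψ t (hsub ht))).neg using 1
    ring
  have h := intervalIntegral.integral_eq_sub_of_hasDerivAt hd
    ((intervalIntegrable_iff_integrableOn_Ioo_of_le hg.1.le).2 (integrableOn_weight hψ hψc hg k))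
  rw [intervalIntegral.integral_of_le hg.1.le, integral_Ioc_eq_integral_Ioo] at h
  rw [h, hψg, stepDown_eq_zero (k := k) (s := 0) (by simp; positivity)]
  ring

lemma weight_nonneg (hpos : ∀ t ∈ Icc (-r) r, 0 < ψ' t) {t : ℝ} (ht : t ∈ Icc (-r) r) (k : ℕ) :
    0 ≤ ψ' t * -deriv (stepDown k) (ψ t) :=
  mul_nonneg (hpos t ht).le (by linarith [deriv_stepDown_nonpos k (ψ t)])

/-- The weight is nonnegative with mass at most 1. The bound is uniform in k, which provides
domination when integrating over all lines. -/
lemma abs_integral_mul_weight_le (hψ : ∀ t ∈ Icc (-r) r, HasDerivAt ψ (ψ' t) t)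
    (hψc : ContinuousOn ψ' (Icc (-r) r)) (hpos : ∀ t ∈ Icc (-r) r, 0 < ψ' t)
    (hg : g ∈ Ioo (-r) r) (hψg : ψ g = 0) {q : ℝ → ℝ} {M : ℝ} (hM : 0 ≤ M)
    (hq : ∀ t ∈ Ioo (-r) g, |q t| ≤ M) (k : ℕ) :
    |∫ t in Ioo (-r) g, q t * (ψ' t * -deriv (stepDown k) (ψ t))| ≤ M := by
  have hw := integrableOn_weight hψ hψc hg k
  calc |∫ t in Ioo (-r) g, q t * (ψ' t * -deriv (stepDown k) (ψ t))|
      ≤ ∫ t in Ioo (-r) g, M * (ψ' t * -deriv (stepDown k) (ψ t)) := by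
        rw [← Real.norm_eq_abs]
        refine norm_integral_le_of_norm_le (hw.const_mul M) ?_
        refine (ae_restrict_iff' measurableSet_Ioo).2 (Filter.Eventually.of_forall fun t ht => ?_)
        have h0 := weight_nonneg (ψ := ψ) hpos ⟨ht.1.le, ht.2.le.trans hg.2.le⟩ k
        rw [Real.norm_eq_abs, abs_mul, abs_of_nonneg h0]
        exact mul_le_mul_of_nonneg_right (hq t ht) h0
    _ = M * stepDown k (ψ (-r)) := by
        rw [integral_const_mul, integral_weight hψ hψc hg hψg]
    _ ≤ M := mul_le_of_le_one_right hM (stepDown_le_one _ _)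

/-- For large k the weight has mass exactly 1 and lives where ψ ≥ −1/(k + 1), a region that shrinks
to g because ψ is strictly increasing. -/
lemma tendsto_integral_mul_weight (hψ : ∀ t ∈ Icc (-r) r, HasDerivAt ψ (ψ' t) t)
    (hψc : ContinuousOn ψ' (Icc (-r) r)) (hpos : ∀ t ∈ Icc (-r) r, 0 < ψ' t)
    (hg : g ∈ Ioo (-r) r) (hψg : ψ g = 0) {q : ℝ → ℝ} (hqg : ContinuousWithinAt q (Iic g) g)
    (hq : ContinuousOn q (Ioo (-r) g)) :
    Filter.Tendsto (fun k => ∫ t in Ioo (-r) g, q t * (ψ' t * -deriv (stepDown k) (ψ t)))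
      Filter.atTop (𝓝 (q g)) := by
  have hmono : StrictMonoOn ψ (Icc (-r) r) := by
    refine strictMonoOn_of_deriv_pos (convex_Icc _ _)
      (fun t ht => (hψ t ht).continuousAt.continuousWithinAt) fun t ht => ?_
    rw [interior_Icc] at ht
    rw [(hψ t (Ioo_subset_Icc_self ht)).deriv]
    exact hpos t (Ioo_subset_Icc_self ht)
  have hgm : g ∈ Icc (-r) r := Ioo_subset_Icc_self hg
  have h1k : Filter.Tendsto (fun k : ℕ => -(1 / ((k : ℝ) + 1))) Filter.atTop (𝓝 0) := by
    simpa using (tendsto_one_div_add_atTop_nhds_zero_nat (𝕜 := ℝ)).neg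
  rw [Metric.tendsto_atTop']
  intro κ hκ
  obtain ⟨η, hη, hηq⟩ := Metric.continuousWithinAt_iff.1 hqg (κ / 2) (by positivity)
  -- Right of a the integrand is within κ/2 of its value at g; left of a the weight vanishes once
  -- −1/(k + 1) exceeds ψ a.
  obtain ⟨a, ha⟩ : ∃ a, a ∈ Ioo (-r) g ∧ g - η < a := by
    obtain ⟨a, ha⟩ := exists_between (max_lt hg.1 (by linarith : g - η < g))
    exact ⟨a, ⟨(le_max_left _ _).trans_lt ha.1, ha.2⟩, (le_max_right _ _).trans_lt ha.1⟩
  have ham : a ∈ Icc (-r) r := ⟨ha.1.1.le, ha.1.2.le.trans hgm.2⟩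
  have hψa : ψ a < 0 := hψg ▸ hmono ham hgm ha.1.2
  have hψr : ψ (-r) < ψ a := hmono ⟨le_rfl, by linarith [hg.1, hg.2]⟩ ham ha.1.1
  obtain ⟨k0, hk0⟩ := Filter.eventually_atTop.1 (h1k.eventually (lt_mem_nhds hψa))
  refine ⟨k0, fun k hk => ?_⟩
  have hka := hk0 k hk.le
  have hw := integrableOn_weight hψ hψc hg k
  have hw1 : ∫ t in Ioo (-r) g, ψ' t * -deriv (stepDown k) (ψ t) = 1 := by
    rw [integral_weight hψ hψc hg hψg, stepDown_eq_one (by linarith)]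
  have hbd : ∀ t ∈ Ioo (-r) g, |q t - q g| * (ψ' t * -deriv (stepDown k) (ψ t)) ≤
      κ / 2 * (ψ' t * -deriv (stepDown k) (ψ t)) := by
    intro t ht
    have htm : t ∈ Icc (-r) r := ⟨ht.1.le, ht.2.le.trans hgm.2⟩
    rcases le_or_gt t a with hta | hta
    · have : ψ t ≤ ψ a := hmono.monotoneOn htm ham hta
      rw [deriv_stepDown_eq_zero (by linarith)]; simp
    · refine mul_le_mul_of_nonneg_right ?_ (weight_nonneg hpos htm k)
      have := hηq (x := t) ht.2.le (by
        rw [Real.dist_eq, abs_sub_lt_iff]; constructor <;> linarith [ht.2, ha.2])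
      exact this.le
  have hq' : IntegrableOn (fun t => (q t - q g) * (ψ' t * -deriv (stepDown k) (ψ t)))
      (Ioo (-r) g) := by
    refine Integrable.mono' (hw.const_mul (κ / 2)) ?_ ?_
    · exact ((hq.sub continuousOn_const).aestronglyMeasurable measurableSet_Ioo).mul
        hw.aestronglyMeasurable
    · refine (ae_restrict_iff' measurableSet_Ioo).2 (Filter.Eventually.of_forall fun t ht => ?_)
      rw [Real.norm_eq_abs, abs_mul, abs_of_nonneg
        (weight_nonneg (ψ := ψ) hpos ⟨ht.1.le, ht.2.le.trans hgm.2⟩ k)]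
      exact hbd t ht
  have hsplit : ∫ t in Ioo (-r) g, q t * (ψ' t * -deriv (stepDown k) (ψ t)) =
      (∫ t in Ioo (-r) g, (q t - q g) * (ψ' t * -deriv (stepDown k) (ψ t))) + q g := by
    have : ∀ t, q t * (ψ' t * -deriv (stepDown k) (ψ t)) =
        (q t - q g) * (ψ' t * -deriv (stepDown k) (ψ t)) +
          q g * (ψ' t * -deriv (stepDown k) (ψ t)) := fun t => by ring
    simp_rw [this]
    rw [integral_add hq' (hw.const_mul _), integral_const_mul, hw1, mul_one]
  rw [hsplit, Real.dist_eq, add_sub_cancel_right]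
  calc |∫ t in Ioo (-r) g, (q t - q g) * (ψ' t * -deriv (stepDown k) (ψ t))|
      ≤ ∫ t in Ioo (-r) g, κ / 2 * (ψ' t * -deriv (stepDown k) (ψ t)) := by
        rw [← Real.norm_eq_abs]
        refine norm_integral_le_of_norm_le (hw.const_mul _) ?_
        refine (ae_restrict_iff' measurableSet_Ioo).2 (Filter.Eventually.of_forall fun t ht => ?_)
        rw [Real.norm_eq_abs, abs_mul, abs_of_nonneg
          (weight_nonneg (ψ := ψ) hpos ⟨ht.1.le, ht.2.le.trans hgm.2⟩ k)]
        exact hbd t ht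
    _ = κ / 2 := by rw [integral_const_mul, hw1, mul_one]
    _ < κ := by linarith

end Concentration

/-- Dominated convergence. The sign of φ is required only where f is nonzero, since a local defining
function means nothing elsewhere. -/
lemma tendsto_integral_cutoff_mul {α : Type*} [MeasurableSpace α] {μ : Measure α} {f φ : α → ℝ}
    (hf : Integrable f μ) (hφ : ∀ᵐ x ∂μ, f x ≠ 0 → φ x < 0)
    (hm : ∀ k, AEStronglyMeasurable (fun x => stepDown k (φ x) * f x) μ) :
    Filter.Tendsto (fun k => ∫ x, stepDown k (φ x) * f x ∂μ) Filter.atTop (𝓝 (∫ x, f x ∂μ)) := by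
  refine tendsto_integral_of_dominated_convergence (fun x => ‖f x‖) hm hf.norm ?_ ?_
  · refine fun k => Filter.Eventually.of_forall fun x => ?_
    rw [norm_mul]
    refine mul_le_of_le_one_left (norm_nonneg _) ?_
    rw [Real.norm_eq_abs, abs_of_nonneg (stepDown_nonneg _ _)]
    exact stepDown_le_one _ _
  · filter_upwards [hφ] with x hx
    by_cases h : f x = 0
    · simp [h]
    · simpa using (tendsto_stepDown (hx h)).mul_const (f x)

/-- If `μ ≤ ν ≤ (1 + κ) μ`, then integrals with respect to `μ` and `ν` differ by at most
`κ ∫ |f| dμ`. -/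
lemma abs_integral_sub_integral_le {α : Type*} [MeasurableSpace α] {μ ν : Measure α}
    [IsFiniteMeasure μ] {κ : ℝ} (hκ : 0 ≤ κ) (h1 : μ ≤ ν)
    (h2 : ν ≤ ENNReal.ofReal (1 + κ) • μ) {f : α → ℝ} (hf : Integrable f μ) :
    |∫ x, f x ∂ν - ∫ x, f x ∂μ| ≤ κ * ∫ x, |f x| ∂μ := by
  -- The difference of the integrals is the integral against the excess measure, which is dominated
  -- by κ μ.
  have hρ : ν - μ ≤ ENNReal.ofReal κ • μ := by
    refine Measure.sub_le_of_le_add ?_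
    refine h2.trans_eq ?_
    rw [ENNReal.ofReal_add zero_le_one hκ, add_smul, ENNReal.ofReal_one, one_smul, add_comm]
  have hν : ν = (ν - μ) + μ := (Measure.sub_add_cancel_of_le h1).symm
  have hfρ : Integrable f (ν - μ) := (hf.smul_measure ENNReal.ofReal_ne_top).mono_measure hρ
  have heq : ∫ x, f x ∂ν = ∫ x, f x ∂(ν - μ) + ∫ x, f x ∂μ := by
    conv_lhs => rw [hν]
    exact integral_add_measure hfρ hf
  rw [heq, add_sub_cancel_right]
  calc |∫ x, f x ∂(ν - μ)| ≤ ∫ x, |f x| ∂(ν - μ) := abs_integral_le_integral_abs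
    _ ≤ ∫ x, |f x| ∂(ENNReal.ofReal κ • μ) :=
        integral_mono_measure hρ (Filter.Eventually.of_forall fun x => abs_nonneg _)
          (hf.abs.smul_measure ENNReal.ofReal_ne_top)
    _ = κ * ∫ x, |f x| ∂μ := by
        rw [integral_smul_measure, ENNReal.toReal_ofReal hκ, smul_eq_mul]

/-! ### The spherical part of the boundary -/

/-- The layer lies outside the ball of radius √(1 − 2/(k + 1)), read as 0 for a negative radicand,
and Bernoulli's inequality bounds the volume between the two spheres. -/
lemma measureReal_sphere_layer_le : ∃ C : ℝ, 0 ≤ C ∧ ∀ k : ℕ,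
    volume.real {x : E n | ‖x‖ < 1 ∧ -(1 / ((k : ℝ) + 1)) ≤ (‖x‖ ^ 2 - 1) / 2} ≤
      C / (k + 1) := by
  set v := volume.real (Metric.ball (0 : E n) 1) with hv
  refine ⟨v * ((n + 1) * 2), by positivity, fun k => ?_⟩
  have hk : (0 : ℝ) < k + 1 := by positivity
  set r := Real.sqrt (1 - 2 / (k + 1)) with hr
  have hr0 : 0 ≤ r := Real.sqrt_nonneg _
  have hr1 : r ≤ 1 := by
    rw [hr, Real.sqrt_le_one]
    have : (0 : ℝ) ≤ 2 / (k + 1) := by positivity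
    linarith
  have hsub : {x : E n | ‖x‖ < 1 ∧ -(1 / ((k : ℝ) + 1)) ≤ (‖x‖ ^ 2 - 1) / 2} ⊆
      Metric.ball 0 1 \ Metric.ball 0 r := by
    rintro x ⟨hx1, hx2⟩
    refine ⟨by simpa using hx1, fun hx => ?_⟩
    have hxr : ‖x‖ < r := by simpa using hx
    have h3 : 1 - 2 / ((k : ℝ) + 1) ≤ ‖x‖ ^ 2 := by
      have : 2 / ((k : ℝ) + 1) = 2 * (1 / (k + 1)) := by ring
      linarith
    have h4 : r ≤ ‖x‖ := Real.sqrt_le_iff.2 ⟨norm_nonneg _, h3⟩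
    linarith
  calc volume.real {x : E n | ‖x‖ < 1 ∧ -(1 / ((k : ℝ) + 1)) ≤ (‖x‖ ^ 2 - 1) / 2}
      ≤ volume.real (Metric.ball (0 : E n) 1 \ Metric.ball 0 r) :=
        measureReal_mono hsub (ne_top_of_le_ne_top measure_ball_lt_top.ne
          (measure_mono sdiff_subset))
    _ = v - r ^ (n + 1) * v := by
        rw [measureReal_sdiff (Metric.ball_subset_ball hr1) measurableSet_ball
          measure_ball_lt_top.ne]
        congr 1
        rw [measureReal_def, Measure.addHaar_ball _ _ hr0]
        simp [hv, measureReal_def, ENNReal.toReal_mul, hr0, finrank_euclideanSpace]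
    _ = v * (1 - r ^ (n + 1)) := by ring
    _ ≤ v * (((n : ℝ) + 1) * 2 / (k + 1)) := by
        refine mul_le_mul_of_nonneg_left ?_ measureReal_nonneg
        have hb := one_add_mul_le_pow (a := r - 1) (by linarith) (n + 1)
        push_cast at hb
        rw [add_sub_cancel] at hb
        have h1 : 1 - r ≤ 2 / (k + 1) := by
          have hrr : 1 - 2 / ((k : ℝ) + 1) ≤ r ^ 2 := (Real.sqrt_le_left hr0).1 le_rfl
          nlinarith
        have h2 : ((n : ℝ) + 1) * (1 - r) ≤ (n + 1) * (2 / (k + 1)) :=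
          mul_le_mul_of_nonneg_left h1 (by positivity)
        rw [mul_div_assoc]
        linarith
    _ = v * ((n + 1) * 2) / (k + 1) := by ring

lemma hasFDerivAt_half_norm_sq_sub (x : E n) :
    HasFDerivAt (fun y : E n => (‖y‖ ^ 2 - 1) / 2) (innerSL ℝ x) x := by
  have h := ((hasStrictFDerivAt_norm_sq x).hasFDerivAt.sub_const 1).mul_const (1 / 2 : ℝ)
  have e1 : (fun y : E n => (‖y‖ ^ 2 - 1) / 2) = fun y => (‖y‖ ^ 2 - 1) * (1 / 2 : ℝ) := by
    ext y; ring
  rw [e1]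
  convert! h using 1
  ext v
  simp

/-- A field tangent to the sphere has no flux through the spherical part of the boundary. -/
lemma setIntegral_divergence_eq_zero_of_tangent {Ω U : Set (E n)} (hΩ : IsOpen Ω) (hU : IsOpen U)
    (hΩU : ∀ y ∈ U, (y ∈ Ω ↔ ‖y‖ < 1)) {F : E n → E n} (hF : ContDiffOn ℝ 1 F Ω)
    (hc : HasCompactSupport F) (hs : tsupport F ⊆ U) (hFc : ContinuousOn F (closure Ω ∩ U))
    (hdiv : IntegrableOn (divergence F) Ω)
    (htan : ∀ y ∈ U, ‖y‖ = 1 → inner ℝ y (F y) = 0) :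
    ∫ x in Ω, divergence F x = 0 := by
  set φ : E n → ℝ := fun y => (‖y‖ ^ 2 - 1) / 2 with hφdef
  have hφ : ContDiff ℝ 1 φ := ((contDiff_norm_sq ℝ).sub contDiff_const).div_const 2
  have hφΩ : ∀ y ∈ U, (y ∈ Ω ↔ φ y < 0) := by
    intro y hy
    rw [hΩU y hy, hφdef]
    constructor
    · intro h; simp only; nlinarith [norm_nonneg y]
    · intro h; simp only at h; nlinarith [norm_nonneg y]
  have hfd : ∀ x, fderiv ℝ φ x (F x) = inner ℝ x (F x) := by
    intro x
    rw [(hasFDerivAt_half_norm_sq_sub x).fderiv]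
    rfl
  have hlim1 : Filter.Tendsto (fun k => ∫ x in Ω, stepDown k (φ x) * divergence F x) Filter.atTop
      (𝓝 (∫ x in Ω, divergence F x)) := by
    refine tendsto_integral_cutoff_mul hdiv ?_ fun k => ?_
    · refine (ae_restrict_iff' hΩ.measurableSet).2 (Filter.Eventually.of_forall fun x hx hx0 => ?_)
      exact (hφΩ x (hs (support_divergence_subset F hx0))).1 hx
    · exact ((contDiff_stepDown k).continuous.comp hφ.continuous).aestronglyMeasurable.mul
        hdiv.aestronglyMeasurable
  have hcut : ∀ k : ℕ, ∫ x in Ω, stepDown k (φ x) * divergence F x =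
      ∫ x in Ω, -deriv (stepDown k) (φ x) * fderiv ℝ φ x (F x) := fun k =>
    integral_cutoff_mul_divergence hΩ hU hF hc hs hφ.contDiffOn hφΩ (contDiff_stepDown k)
      (c := -(1 / (2 * (k + 1)))) (neg_lt_zero.2 (by positivity)) fun s hs => stepDown_eq_zero hs
  refine tendsto_nhds_unique hlim1 ?_
  simp_rw [hcut, hfd]
  -- smallness of the normal component near the sphere
  have hcl : ∀ x ∈ U, ‖x‖ ≤ 1 → x ∈ closure Ω := by
    intro x hx hx1
    have h1 : Filter.Tendsto (fun t : ℝ => t • x) (𝓝[<] 1) (𝓝 x) := by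
      have : ContinuousAt (fun t : ℝ => t • x) 1 := by fun_prop
      have h := this.tendsto
      rw [one_smul] at h
      exact h.mono_left nhdsWithin_le_nhds
    refine mem_closure_of_tendsto h1 ?_
    have h2 : ∀ᶠ t : ℝ in 𝓝[<] 1, t ∈ Ioo (0 : ℝ) 1 := Ioo_mem_nhdsLT one_pos
    filter_upwards [h1.eventually (hU.mem_nhds hx), h2] with t ht ht2
    rw [hΩU _ ht, norm_smul, Real.norm_eq_abs, abs_of_pos ht2.1]
    nlinarith [ht2.2, ht2.1, norm_nonneg x]
  obtain ⟨C1, hC1, hlayer⟩ := measureReal_sphere_layer_le (n := n)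
  obtain ⟨C2, hC2, hder⟩ := exists_abs_deriv_stepDown_le
  -- The points of the support in the closed unit ball where the normal component is at least κ form
  -- a compact set. By tangency it misses the sphere, so φ has a negative maximum on it.
  have hsmall : ∀ κ > 0, ∃ δ > 0, ∀ x ∈ Ω, -δ < φ x → |inner ℝ x (F x)| ≤ κ := by
    intro κ hκ
    set Q : Set (E n) := tsupport F ∩ Metric.closedBall 0 1 with hQ
    have hQc : IsCompact Q := hc.isCompact.inter_right Metric.isClosed_closedBall
    have hQcont : ContinuousOn (fun x => |inner ℝ x (F x)|) Q := by
      refine (continuousOn_id.inner (𝕜 := ℝ) (hFc.mono fun x hx => ?_)).abs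
      exact ⟨hcl x (hs hx.1) (by simpa using hx.2), hs hx.1⟩
    set Q' : Set (E n) := {x ∈ Q | κ ≤ |inner ℝ x (F x)|} with hQ'
    have hQ'c : IsCompact Q' := hQc.of_isClosed_subset
      (hQcont.preimage_isClosed_of_isClosed hQc.isClosed isClosed_Ici) fun x hx => hx.1
    rcases Q'.eq_empty_or_nonempty with he | hne
    · refine ⟨1, one_pos, fun x hx _ => ?_⟩
      by_contra! h
      have hxF : x ∈ tsupport F := by
        by_contra h2
        rw [image_eq_zero_of_notMem_tsupport h2] at h
        simp at h
        linarith
      have : x ∈ Q' := ⟨⟨hxF, by simpa using ((hΩU x (hs hxF)).1 hx).le⟩, h.le⟩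
      simp [he] at this
    · obtain ⟨x0, hx0, hmax⟩ := hQ'c.exists_isMaxOn hne hφ.continuous.continuousOn
      have hx0n : ‖x0‖ < 1 := by
        have h1 : ‖x0‖ ≤ 1 := by simpa using hx0.1.2
        rcases h1.lt_or_eq with h | h
        · exact h
        · have := hx0.2
          rw [htan x0 (hs hx0.1.1) h, abs_zero] at this
          linarith
      have hφ0 : φ x0 < 0 := by simp only [hφdef]; nlinarith [norm_nonneg x0]
      refine ⟨-φ x0, by linarith, fun x hx hxφ => ?_⟩
      by_contra! h
      have hxF : x ∈ tsupport F := by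
        by_contra h2
        rw [image_eq_zero_of_notMem_tsupport h2] at h
        simp at h
        linarith
      have hm := hmax (show x ∈ Q' from ⟨⟨hxF, by simpa using ((hΩU x (hs hxF)).1 hx).le⟩, h.le⟩)
      simp only [mem_ofPred_eq] at hm
      linarith
  have h1k : Filter.Tendsto (fun k : ℕ => -(1 / ((k : ℝ) + 1))) Filter.atTop (𝓝 0) := by
    simpa using (tendsto_one_div_add_atTop_nhds_zero_nat (𝕜 := ℝ)).neg
  rw [Metric.tendsto_atTop']
  intro κ hκ
  -- The layer has volume at most C1/(k + 1) and the step function has slope at most C2(k + 1). The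
  -- product is C2 C1, and this choice brings the integral below κ.
  obtain ⟨δ, hδ, hδF⟩ := hsmall (κ / (2 * (C2 * C1 + 1))) (by positivity)
  obtain ⟨k0, hk0⟩ := Filter.eventually_atTop.1 (h1k.eventually (lt_mem_nhds (neg_lt_zero.2 hδ)))
  refine ⟨k0, fun k hk => ?_⟩
  have hkδ := hk0 k hk.le
  set L : Set (E n) := {x : E n | ‖x‖ < 1 ∧ -(1 / ((k : ℝ) + 1)) ≤ (‖x‖ ^ 2 - 1) / 2} with hL
  have hLm : MeasurableSet L := by
    apply MeasurableSet.inter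
    · exact (isOpen_lt continuous_norm continuous_const).measurableSet
    · exact (isClosed_le continuous_const hφ.continuous).measurableSet
  have hLfin : volume L < ⊤ := (measure_mono (t := Metric.ball (0 : E n) 1)
    fun x hx => by simpa using hx.1).trans_lt measure_ball_lt_top
  set M : ℝ := C2 * (k + 1) * (κ / (2 * (C2 * C1 + 1))) with hM
  have hM0 : 0 ≤ M := by positivity
  have hb : ∀ x ∈ Ω, ‖-deriv (stepDown k) (φ x) * inner ℝ x (F x)‖ ≤ L.indicator (fun _ => M) x := by
    intro x hx
    by_cases hxF : x ∈ tsupport F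
    swap
    · rw [image_eq_zero_of_notMem_tsupport hxF]
      simpa using indicator_nonneg (fun _ _ => hM0) x
    rcases lt_or_ge (φ x) (-(1 / ((k : ℝ) + 1))) with h | h
    · rw [deriv_stepDown_eq_zero h]
      simpa using indicator_nonneg (fun _ _ => hM0) x
    · rw [indicator_of_mem (show x ∈ L from ⟨(hΩU x (hs hxF)).1 hx, h⟩), norm_mul, norm_neg]
      exact mul_le_mul (hder k _) (hδF x hx (by linarith)) (norm_nonneg _) (by positivity)
  rw [dist_zero_right]
  calc ‖∫ x in Ω, -deriv (stepDown k) (φ x) * inner ℝ x (F x)‖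
      ≤ ∫ x in Ω, L.indicator (fun _ => M) x := by
        refine norm_integral_le_of_norm_le ?_
          ((ae_restrict_iff' hΩ.measurableSet).2 (Filter.Eventually.of_forall hb))
        exact ((integrable_indicator_iff hLm).2 (integrableOn_const hLfin.ne)).integrableOn
    _ ≤ ∫ x, L.indicator (fun _ => M) x := by
        refine setIntegral_le_integral ((integrable_indicator_iff hLm).2
          (integrableOn_const hLfin.ne)) (Filter.Eventually.of_forall fun x => ?_)
        exact indicator_nonneg (fun _ _ => hM0) x
    _ = volume.real L * M := by rw [integral_indicator_const _ hLm, smul_eq_mul]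
    _ ≤ C1 / (k + 1) * M := mul_le_mul_of_nonneg_right (hlayer k) hM0
    _ = κ * (C2 * C1 / (2 * (C2 * C1 + 1))) := by rw [hM]; field_simp
    _ < κ := by
        refine mul_lt_of_lt_one_right hκ ?_
        rw [div_lt_one (by positivity)]
        have : 0 ≤ C2 * C1 := by positivity
        linarith

/-! ### Coordinates along a direction and its orthogonal complement -/

/-- The hyperplane orthogonal to `v`. -/
abbrev Hyper (v : E n) : Submodule ℝ (E n) := (ℝ ∙ v)ᗮ

/-- The point with height `t` in the direction `v` over the point `y` of the hyperplane. -/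
def pointAt (x₀ v : E n) (t : ℝ) (y : Hyper v) : E n := x₀ + (t • v + (y : E n))

/-- The projection to the hyperplane. -/
def base (x₀ v : E n) (x : E n) : Hyper v := (Hyper v).orthogonalProjectionOnto (x - x₀)

lemma inner_hyper (v : E n) (y : Hyper v) : inner ℝ v (y : E n) = 0 :=
  Submodule.mem_orthogonal_singleton_iff_inner_right.1 y.2

lemma continuous_base (x₀ v : E n) : Continuous (base x₀ v) := by
  unfold base; fun_prop

lemma base_pointAt (x₀ v : E n) (t : ℝ) (y : Hyper v) : base x₀ v (pointAt x₀ v t y) = y := by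
  simp [base, pointAt, map_add, Submodule.orthogonalProjectionOnto_orthogonalComplement_singleton_eq_zero]

lemma inner_pointAt {x₀ v : E n} (hv : ‖v‖ = 1) (t : ℝ) (y : Hyper v) :
    inner ℝ v (pointAt x₀ v t y - x₀) = t := by
  simp [pointAt, inner_add_right, inner_smul_right, hv, inner_hyper v y]

lemma pointAt_base {x₀ v : E n} (hv : ‖v‖ = 1) (x : E n) :
    pointAt x₀ v (inner ℝ v (x - x₀)) (base x₀ v x) = x := by
  have h := Submodule.starProjection_add_starProjection_orthogonal (K := ℝ ∙ v) (x - x₀)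
  rw [Submodule.starProjection_singleton] at h
  simp only [hv] at h
  have h2 : ((base x₀ v x : Hyper v) : E n) = (ℝ ∙ v)ᗮ.starProjection (x - x₀) := rfl
  rw [pointAt, h2]
  simp only [one_pow, RCLike.ofReal_one, div_one] at h
  rw [h]
  abel

lemma finrank_hyper {v : E n} (hv : ‖v‖ = 1) : Module.finrank ℝ (Hyper v) = n := by
  have : Fact (Module.finrank ℝ (E n) = n + 1) := ⟨by simp⟩
  exact Submodule.finrank_orthogonal_span_singleton (by rintro rfl; simp at hv)

/-- Identifies the coordinates with the orthogonal splitting along the line ℝ ∙ v, from which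
measurability and preservation of volume are inherited. -/
lemma pointAt_eq_symm {v : E n} (hv : ‖v‖ = 1) (x₀ : E n) :
    (fun p : ℝ × Hyper v => pointAt x₀ v p.1 p.2) =
      ((ℝ ∙ v).measurableEquivProd x₀).symm ∘
        (MeasurableEquiv.prodCongr
          (LinearIsometryEquiv.toSpanUnitSingleton v hv).toHomeomorph.toMeasurableEquiv
          (MeasurableEquiv.refl (Hyper v))) := by
  ext1 p
  simp only [Function.comp_apply, Submodule.measurableEquivProd_symm_apply, pointAt]
  rw [vadd_eq_add, add_comm]
  rfl

lemma measurableEmbedding_pointAt {v : E n} (hv : ‖v‖ = 1) (x₀ : E n) :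
    MeasurableEmbedding (fun p : ℝ × Hyper v => pointAt x₀ v p.1 p.2) := by
  rw [pointAt_eq_symm hv]
  exact (MeasurableEquiv.measurableEmbedding _).comp (MeasurableEquiv.measurableEmbedding _)

lemma measurePreserving_pointAt {v : E n} (hv : ‖v‖ = 1) (x₀ : E n) :
    MeasurePreserving (fun p : ℝ × Hyper v => pointAt x₀ v p.1 p.2) (volume.prod volume)
      volume := by
  rw [pointAt_eq_symm hv]
  have h1 := (ℝ ∙ v).measurePreserving_measurableEquivProd x₀
  rw [InnerProductSpace.euclideanHausdorffMeasure_eq_volume] at h1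
  refine h1.symm.comp ?_
  exact (LinearIsometryEquiv.measurePreserving
    (LinearIsometryEquiv.toSpanUnitSingleton v hv)).prod (MeasurePreserving.id _)

lemma continuous_pointAt (x₀ v : E n) :
    Continuous (fun p : ℝ × Hyper v => pointAt x₀ v p.1 p.2) := by
  unfold pointAt; fun_prop

/-! ### Nearly flat boundary charts -/

/-- In the ball `B(x₀, ρ)` the differential of `φ` is `ε a`-close to `a ⟪v, ·⟫`. -/
structure FlatChart (x₀ v : E n) (a ε ρ : ℝ) (φ : E n → ℝ) : Prop where
  norm_eq : ‖v‖ = 1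
  a_pos : 0 < a
  ε_pos : 0 < ε
  ε_lt : ε < 1 / 2
  ρ_pos : 0 < ρ
  contDiffOn : ContDiffOn ℝ 1 φ (Metric.ball x₀ ρ)
  apply_eq_zero : φ x₀ = 0
  norm_fderiv_sub_le : ∀ x ∈ Metric.ball x₀ ρ, ‖fderiv ℝ φ x - a • innerSL ℝ v‖ ≤ ε * a

/-- The cylinder of radius and half-height `r` around `x₀` in the direction `v`. -/
def cylinder (x₀ v : E n) (r : ℝ) : Set (E n) :=
  {x | ‖base x₀ v x‖ < r ∧ |inner ℝ v (x - x₀)| < r}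

lemma isOpen_cylinder (x₀ v : E n) (r : ℝ) : IsOpen (cylinder x₀ v r) := by
  apply IsOpen.inter
  · exact isOpen_lt (continuous_base x₀ v).norm continuous_const
  · exact isOpen_lt (by fun_prop : Continuous fun x : E n => |inner ℝ v (x - x₀)|) continuous_const

lemma mem_cylinder_self (x₀ v : E n) {r : ℝ} (hr : 0 < r) : x₀ ∈ cylinder x₀ v r := by
  simp [cylinder, base, hr]

lemma pointAt_mem_cylinder {x₀ v : E n} (hv : ‖v‖ = 1) {r t : ℝ} {y : Hyper v} :
    pointAt x₀ v t y ∈ cylinder x₀ v r ↔ ‖y‖ < r ∧ |t| < r := by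
  simp only [cylinder, mem_ofPred_eq, base_pointAt, inner_pointAt hv]

/-! ### The zero set of a nearly affine function as a graph -/

namespace FlatChart

variable {x₀ v : E n} {a ε ρ : ℝ} {φ : E n → ℝ}

/-- The cylinder has radius ρ/3 so that height and base together stay below ρ, even at the closed
ends of its vertical segments. -/
lemma pointAt_mem_ball (h : FlatChart x₀ v a ε ρ φ) {t : ℝ} {y : Hyper v} (ht : |t| ≤ ρ / 3)
    (hy : ‖y‖ < ρ / 3) : pointAt x₀ v t y ∈ Metric.ball x₀ ρ := by
  rw [mem_ball_iff_norm]
  have h1 : ‖pointAt x₀ v t y - x₀‖ ≤ |t| + ‖y‖ := by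
    rw [pointAt, add_sub_cancel_left]
    refine (norm_add_le _ _).trans ?_
    rw [norm_smul, h.norm_eq, mul_one, Real.norm_eq_abs]
    rfl
  have := h.ρ_pos
  linarith

lemma cylinder_subset_ball (h : FlatChart x₀ v a ε ρ φ) :
    cylinder x₀ v (ρ / 3) ⊆ Metric.ball x₀ ρ := by
  intro x hx
  rw [← pointAt_base h.norm_eq (x₀ := x₀) x]
  exact h.pointAt_mem_ball hx.2.le hx.1

lemma differentiableAt (h : FlatChart x₀ v a ε ρ φ) {x : E n} (hx : x ∈ Metric.ball x₀ ρ) :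
    DifferentiableAt ℝ φ x :=
  (h.contDiffOn.contDiffAt (Metric.isOpen_ball.mem_nhds hx)).differentiableAt one_ne_zero

lemma continuousOn_fderiv (h : FlatChart x₀ v a ε ρ φ) :
    ContinuousOn (fderiv ℝ φ) (Metric.ball x₀ ρ) :=
  h.contDiffOn.continuousOn_fderiv_of_isOpen Metric.isOpen_ball le_rfl

lemma abs_fderiv_sub_le (h : FlatChart x₀ v a ε ρ φ) {x : E n} (hx : x ∈ Metric.ball x₀ ρ)
    (w : E n) : |fderiv ℝ φ x w - a * inner ℝ v w| ≤ ε * a * ‖w‖ := by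
  have h1 := (fderiv ℝ φ x - a • innerSL ℝ v).le_of_opNorm_le (h.norm_fderiv_sub_le x hx) w
  simpa using h1

lemma le_fderiv (h : FlatChart x₀ v a ε ρ φ) {x : E n} (hx : x ∈ Metric.ball x₀ ρ) :
    a * (1 - ε) ≤ fderiv ℝ φ x v := by
  have h1 := h.abs_fderiv_sub_le hx v
  rw [real_inner_self_eq_norm_sq, h.norm_eq] at h1
  have := (abs_le.1 h1).1
  linarith

lemma fderiv_pos (h : FlatChart x₀ v a ε ρ φ) {x : E n} (hx : x ∈ Metric.ball x₀ ρ) :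
    0 < fderiv ℝ φ x v :=
  lt_of_lt_of_le (mul_pos h.a_pos (by linarith [h.ε_lt])) (h.le_fderiv hx)

lemma norm_fderiv_le (h : FlatChart x₀ v a ε ρ φ) {x : E n} (hx : x ∈ Metric.ball x₀ ρ) :
    ‖fderiv ℝ φ x‖ ≤ a * (1 + ε) := by
  refine ContinuousLinearMap.opNorm_le_bound _ (mul_nonneg h.a_pos.le (by linarith [h.ε_pos]))
    fun w => ?_
  have h1 := h.abs_fderiv_sub_le hx w
  have h2 := real_inner_le_norm v w
  have h3 := neg_le_of_abs_le (abs_real_inner_le_norm v w)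
  rw [h.norm_eq, one_mul] at h2 h3
  have ha := h.a_pos
  rw [Real.norm_eq_abs, abs_le]
  have h4 := abs_le.1 h1
  constructor <;> nlinarith

lemma fderiv_le_norm (h : FlatChart x₀ v a ε ρ φ) (x : E n) :
    fderiv ℝ φ x v ≤ ‖fderiv ℝ φ x‖ := by
  have := (le_abs_self _).trans ((fderiv ℝ φ x).le_opNorm v)
  rwa [h.norm_eq, mul_one] at this

/-- Mean value inequality for φ − a⟨v, ·⟩ on the convex ball. -/
lemma abs_sub_sub_le (h : FlatChart x₀ v a ε ρ φ) {x y : E n} (hx : x ∈ Metric.ball x₀ ρ)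
    (hy : y ∈ Metric.ball x₀ ρ) :
    |φ y - φ x - a * inner ℝ v (y - x)| ≤ ε * a * ‖y - x‖ := by
  have h1 := (convex_ball x₀ ρ).norm_image_sub_le_of_norm_fderiv_le' (𝕜 := ℝ)
    (fun z hz => h.differentiableAt hz) h.norm_fderiv_sub_le hx hy
  simpa using h1

lemma hasDerivAt (h : FlatChart x₀ v a ε ρ φ) {t : ℝ} {y : Hyper v} (ht : |t| ≤ ρ / 3)
    (hy : ‖y‖ < ρ / 3) :
    HasDerivAt (fun t => φ (pointAt x₀ v t y)) (fderiv ℝ φ (pointAt x₀ v t y) v) t := by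
  have h1 : HasDerivAt (fun t => pointAt x₀ v t y) v t := by
    have := (((hasDerivAt_id t).smul_const v).add_const (y : E n)).const_add x₀
    simpa [pointAt] using this
  exact (h.differentiableAt (h.pointAt_mem_ball ht hy)).hasFDerivAt.comp_hasDerivAt t h1

lemma strictMonoOn (h : FlatChart x₀ v a ε ρ φ) {y : Hyper v} (hy : ‖y‖ < ρ / 3) :
    StrictMonoOn (fun t => φ (pointAt x₀ v t y)) (Icc (-(ρ / 3)) (ρ / 3)) := by
  refine strictMonoOn_of_deriv_pos (convex_Icc _ _)
    (fun t ht => (h.hasDerivAt (abs_le.2 ht) hy).continuousAt.continuousWithinAt) fun t ht => ?_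
  rw [interior_Icc] at ht
  have ht' : |t| ≤ ρ / 3 := abs_le.2 (Ioo_subset_Icc_self ht)
  rw [(h.hasDerivAt ht' hy).deriv]
  exact h.fderiv_pos (h.pointAt_mem_ball ht' hy)

/-- At the ends t = ±ρ/3 the linear term a t has size aρ/3, while the deviation is below εa · 2ρ/3,
which is smaller because ε < 1/2. So φ changes sign on the segment. -/
lemma exists_height (h : FlatChart x₀ v a ε ρ φ) {y : Hyper v} (hy : ‖y‖ < ρ / 3) :
    ∃ g ∈ Ioo (-(ρ / 3)) (ρ / 3), φ (pointAt x₀ v g y) = 0 := by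
  have hρ := h.ρ_pos
  have hb : x₀ ∈ Metric.ball x₀ ρ := Metric.mem_ball_self hρ
  have hest : ∀ t : ℝ, |t| ≤ ρ / 3 →
      |φ (pointAt x₀ v t y) - a * t| ≤ ε * a * (|t| + ‖y‖) := by
    intro t ht
    have h1 := h.abs_sub_sub_le hb (h.pointAt_mem_ball ht hy)
    rw [h.apply_eq_zero, sub_zero, inner_pointAt h.norm_eq] at h1
    refine h1.trans (mul_le_mul_of_nonneg_left ?_ (mul_nonneg h.ε_pos.le h.a_pos.le))
    rw [pointAt, add_sub_cancel_left]
    refine (norm_add_le _ _).trans ?_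
    rw [norm_smul, h.norm_eq, mul_one, Real.norm_eq_abs]
    rfl
  have hr : |ρ / 3| = ρ / 3 := abs_of_pos (by positivity)
  have e1 := hest (ρ / 3) hr.le
  have e2 := hest (-(ρ / 3)) (by rw [abs_neg, hr])
  rw [abs_neg] at e2
  rw [hr] at e1 e2
  have hea : 0 < ε * a := mul_pos h.ε_pos h.a_pos
  have hlt : ε * a * (ρ / 3 + ‖y‖) < a * (ρ / 3) := by
    have h1 : ε * a * (ρ / 3 + ‖y‖) < ε * a * (ρ / 3 + ρ / 3) :=
      mul_lt_mul_of_pos_left (by linarith) hea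
    have h2 : a * ρ * ε < a * ρ * (1 / 2) :=
      mul_lt_mul_of_pos_left h.ε_lt (mul_pos h.a_pos hρ)
    linarith
  have p1 : 0 < φ (pointAt x₀ v (ρ / 3) y) := by linarith [(abs_le.1 e1).1]
  have p2 : φ (pointAt x₀ v (-(ρ / 3)) y) < 0 := by linarith [(abs_le.1 e2).2]
  have hcont : ContinuousOn (fun t => φ (pointAt x₀ v t y)) (Icc (-(ρ / 3)) (ρ / 3)) :=
    fun t ht => (h.hasDerivAt (abs_le.2 ht) hy).continuousAt.continuousWithinAt
  obtain ⟨g, hg, hg0⟩ := intermediate_value_Ioo (by linarith) hcont ⟨p2, p1⟩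
  exact ⟨g, hg, hg0⟩

open Classical in
/-- The height of the hypersurface `φ = 0` over the point `y`. -/
def height (h : FlatChart x₀ v a ε ρ φ) (y : Hyper v) : ℝ :=
  if hy : ‖y‖ < ρ / 3 then (h.exists_height hy).choose else 0

lemma height_mem (h : FlatChart x₀ v a ε ρ φ) {y : Hyper v} (hy : ‖y‖ < ρ / 3) :
    h.height y ∈ Ioo (-(ρ / 3)) (ρ / 3) := by
  rw [height, dif_pos hy]; exact (h.exists_height hy).choose_spec.1

lemma apply_height (h : FlatChart x₀ v a ε ρ φ) {y : Hyper v} (hy : ‖y‖ < ρ / 3) :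
    φ (pointAt x₀ v (h.height y) y) = 0 := by
  rw [height, dif_pos hy]; exact (h.exists_height hy).choose_spec.2

lemma apply_neg_iff (h : FlatChart x₀ v a ε ρ φ) {t : ℝ} {y : Hyper v} (hy : ‖y‖ < ρ / 3)
    (ht : |t| ≤ ρ / 3) : φ (pointAt x₀ v t y) < 0 ↔ t < h.height y := by
  rw [← h.apply_height hy]
  exact (h.strictMonoOn hy).lt_iff_lt (abs_le.1 ht) (Ioo_subset_Icc_self (h.height_mem hy))

lemma apply_nonpos_iff (h : FlatChart x₀ v a ε ρ φ) {t : ℝ} {y : Hyper v} (hy : ‖y‖ < ρ / 3)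
    (ht : |t| ≤ ρ / 3) : φ (pointAt x₀ v t y) ≤ 0 ↔ t ≤ h.height y := by
  rw [← h.apply_height hy]
  exact (h.strictMonoOn hy).le_iff_le (abs_le.1 ht) (Ioo_subset_Icc_self (h.height_mem hy))

lemma eq_height (h : FlatChart x₀ v a ε ρ φ) {x : E n} (hx : x ∈ cylinder x₀ v (ρ / 3))
    (hx0 : φ x = 0) : pointAt x₀ v (h.height (base x₀ v x)) (base x₀ v x) = x := by
  have h1 : h.height (base x₀ v x) = inner ℝ v (x - x₀) := by
    refine (h.strictMonoOn hx.1).injOn (Ioo_subset_Icc_self (h.height_mem hx.1))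
      (abs_le.1 hx.2.le) ?_
    rw [h.apply_height hx.1, pointAt_base h.norm_eq, hx0]
  rw [h1, pointAt_base h.norm_eq]

/-- The graph map. -/
def graph (h : FlatChart x₀ v a ε ρ φ) (y : Hyper v) : E n := pointAt x₀ v (h.height y) y

lemma graph_mem (h : FlatChart x₀ v a ε ρ φ) {y : Hyper v} (hy : ‖y‖ < ρ / 3) :
    h.graph y ∈ cylinder x₀ v (ρ / 3) :=
  (pointAt_mem_cylinder h.norm_eq).2 ⟨hy, abs_lt.2 (h.height_mem hy)⟩

/-- As φ vanishes at both points, their height difference is at most ε times their distance; the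
rest of the distance is horizontal. Absorbing the first part gives the factor (1 − ε)⁻¹. -/
lemma norm_graph_sub_le (h : FlatChart x₀ v a ε ρ φ) {y z : Hyper v} (hy : ‖y‖ < ρ / 3)
    (hz : ‖z‖ < ρ / 3) : ‖h.graph y - h.graph z‖ ≤ (1 - ε)⁻¹ * ‖y - z‖ := by
  have hε : 0 < 1 - ε := by linarith [h.ε_lt]
  have h1 := h.abs_sub_sub_le (h.cylinder_subset_ball (h.graph_mem hz))
    (h.cylinder_subset_ball (h.graph_mem hy))
  have e1 : φ (h.graph y) = 0 := h.apply_height hy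
  have e2 : φ (h.graph z) = 0 := h.apply_height hz
  set w := h.graph y - h.graph z with hw
  have hw2 : w = (h.height y - h.height z) • v + ((y - z : Hyper v) : E n) := by
    rw [hw, graph, graph, pointAt, pointAt, sub_smul]
    push_cast
    abel
  have hin : inner ℝ v w = h.height y - h.height z := by
    rw [hw2, inner_add_right, inner_smul_right, inner_hyper, real_inner_self_eq_norm_sq, h.norm_eq]
    ring
  rw [e1, e2, hin, sub_zero, zero_sub, abs_neg, abs_mul, abs_of_pos h.a_pos] at h1
  have h2 : |h.height y - h.height z| ≤ ε * ‖w‖ := by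
    have : a * |h.height y - h.height z| ≤ a * (ε * ‖w‖) := by linarith
    exact le_of_mul_le_mul_left this h.a_pos
  have h3 : ‖w‖ ≤ |h.height y - h.height z| + ‖y - z‖ := by
    conv_lhs => rw [hw2]
    refine (norm_add_le _ _).trans ?_
    rw [norm_smul, h.norm_eq, mul_one, Real.norm_eq_abs]
    rfl
  rw [inv_mul_eq_div, le_div_iff₀ hε]
  linarith

lemma lipschitzOnWith_graph (h : FlatChart x₀ v a ε ρ φ) :
    LipschitzOnWith (Real.toNNReal (1 - ε)⁻¹) h.graph (Metric.ball 0 (ρ / 3)) := by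
  refine LipschitzOnWith.of_dist_le_mul fun y hy z hz => ?_
  rw [dist_eq_norm, dist_eq_norm, Real.coe_toNNReal _ (inv_nonneg.2 (by linarith [h.ε_lt]))]
  exact h.norm_graph_sub_le (by simpa using hy) (by simpa using hz)

lemma isOpen_neg (h : FlatChart x₀ v a ε ρ φ) :
    IsOpen {x ∈ cylinder x₀ v (ρ / 3) | φ x < 0} :=
  (h.contDiffOn.continuousOn.mono h.cylinder_subset_ball).isOpen_inter_preimage
    (isOpen_cylinder _ _ _) isOpen_Iio

/-- Fubini in the region below the graph. -/
lemma setIntegral_eq (h : FlatChart x₀ v a ε ρ φ) {f : E n → ℝ}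
    (hf : IntegrableOn f {x ∈ cylinder x₀ v (ρ / 3) | φ x < 0}) :
    AEStronglyMeasurable (fun y => ∫ t in Ioo (-(ρ / 3)) (h.height y), f (pointAt x₀ v t y))
      (volume.restrict (Metric.ball (0 : Hyper v) (ρ / 3))) ∧
    ∫ x in {x ∈ cylinder x₀ v (ρ / 3) | φ x < 0}, f x =
      ∫ y in Metric.ball (0 : Hyper v) (ρ / 3),
        ∫ t in Ioo (-(ρ / 3)) (h.height y), f (pointAt x₀ v t y) := by
  set A := {x ∈ cylinder x₀ v (ρ / 3) | φ x < 0} with hA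
  have hAm : MeasurableSet A := h.isOpen_neg.measurableSet
  have hmp := measurePreserving_pointAt h.norm_eq x₀
  have hme := measurableEmbedding_pointAt h.norm_eq x₀
  set P := fun p : ℝ × Hyper v => pointAt x₀ v p.1 p.2 with hP
  have hint : Integrable (fun p => A.indicator f (P p)) (volume.prod volume) :=
    (hmp.integrable_comp_emb hme).2 ((integrable_indicator_iff hAm).2 hf)
  have hin : ∀ y : Hyper v, ∫ t, A.indicator f (P (t, y)) =
      (Metric.ball (0 : Hyper v) (ρ / 3)).indicator
        (fun y => ∫ t in Ioo (-(ρ / 3)) (h.height y), f (pointAt x₀ v t y)) y := by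
    intro y
    by_cases hy : y ∈ Metric.ball (0 : Hyper v) (ρ / 3)
    · rw [indicator_of_mem hy, ← integral_indicator measurableSet_Ioo]
      have hy' : ‖y‖ < ρ / 3 := by simpa using hy
      congr 1
      ext t
      have : P (t, y) ∈ A ↔ t ∈ Ioo (-(ρ / 3)) (h.height y) := by
        rw [hA, mem_ofPred_eq, hP, pointAt_mem_cylinder h.norm_eq]
        constructor
        · rintro ⟨⟨-, ht⟩, ht2⟩
          exact ⟨(abs_lt.1 ht).1, (h.apply_neg_iff hy' ht.le).1 ht2⟩
        · rintro ⟨ht1, ht2⟩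
          have ht : |t| < ρ / 3 := abs_lt.2 ⟨ht1, ht2.trans (h.height_mem hy').2⟩
          exact ⟨⟨hy', ht⟩, (h.apply_neg_iff hy' ht.le).2 ht2⟩
      by_cases ht : t ∈ Ioo (-(ρ / 3)) (h.height y)
      · rw [indicator_of_mem ht, indicator_of_mem (this.2 ht)]
      · rw [indicator_of_notMem ht, indicator_of_notMem fun hh => ht (this.1 hh)]
    · rw [indicator_of_notMem hy]
      have : ∀ t, A.indicator f (P (t, y)) = 0 := by
        intro t
        refine indicator_of_notMem (fun hh => hy ?_) _
        have := ((pointAt_mem_cylinder h.norm_eq).1 hh.1).1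
        simpa using this
      simp [this]
  constructor
  · have h1 := hint.integral_prod_right.aestronglyMeasurable
    simp_rw [hin] at h1
    exact (aestronglyMeasurable_indicator_iff measurableSet_ball).1 h1
  · rw [← integral_indicator hAm, ← hmp.integral_comp hme, integral_prod_symm _ hint]
    simp_rw [hin]
    rw [integral_indicator measurableSet_ball]

/-- The flux through the level sets of `φ` converges to the flux through the graph. -/
lemma tendsto_flux (h : FlatChart x₀ v a ε ρ φ) {q : E n → ℝ} {M : ℝ}
    (hq : ContinuousOn q {x ∈ cylinder x₀ v (ρ / 3) | φ x ≤ 0})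
    (hM : ∀ x ∈ cylinder x₀ v (ρ / 3), φ x ≤ 0 → |q x| ≤ M) :
    Filter.Tendsto (fun k => ∫ x in {x ∈ cylinder x₀ v (ρ / 3) | φ x < 0},
        q x * (fderiv ℝ φ x v * -deriv (stepDown k) (φ x))) Filter.atTop
      (𝓝 (∫ y in Metric.ball (0 : Hyper v) (ρ / 3), q (h.graph y))) := by
  set A := {x ∈ cylinder x₀ v (ρ / 3) | φ x < 0} with hA
  have hρ := h.ρ_pos
  have hM0 : 0 ≤ M := (abs_nonneg _).trans
    (hM x₀ (mem_cylinder_self _ _ (by positivity)) h.apply_eq_zero.le)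
  have hAB : A ⊆ Metric.ball x₀ ρ := fun x hx => h.cylinder_subset_ball hx.1
  have hint : ∀ k, IntegrableOn (fun x => q x * (fderiv ℝ φ x v * -deriv (stepDown k) (φ x))) A := by
    intro k
    obtain ⟨C, hC, hder⟩ := exists_abs_deriv_stepDown_le
    have hAfin : volume A ≠ ⊤ :=
      ne_top_of_le_ne_top measure_ball_lt_top.ne (measure_mono hAB)
    refine Integrable.mono' (integrableOn_const (C := M * (a * (1 + ε) * (C * (k + 1)))) hAfin)
      ?_ ?_
    · refine ContinuousOn.aestronglyMeasurable ?_ h.isOpen_neg.measurableSet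
      refine (hq.mono fun x hx => ⟨hx.1, le_of_lt hx.2⟩).mul (ContinuousOn.mul ?_ ?_)
      · exact (h.continuousOn_fderiv.mono hAB).clm_apply continuousOn_const
      · exact (((contDiff_stepDown k).continuous_deriv le_rfl).comp_continuousOn
          (h.contDiffOn.continuousOn.mono hAB)).neg
    · refine (ae_restrict_iff' h.isOpen_neg.measurableSet).2 (Filter.Eventually.of_forall
        fun x hx => ?_)
      rw [norm_mul, norm_mul, norm_neg]
      refine mul_le_mul (hM x hx.1 (le_of_lt hx.2)) (mul_le_mul ?_ (hder k _) (norm_nonneg _) ?_)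
        (by positivity) hM0
      · rw [Real.norm_eq_abs, abs_of_pos (h.fderiv_pos (hAB hx))]
        exact (h.fderiv_le_norm x).trans (h.norm_fderiv_le (hAB hx))
      · exact mul_nonneg h.a_pos.le (by linarith [h.ε_pos])
  have hsub : ∀ y : Hyper v, ‖y‖ < ρ / 3 → ∀ t ∈ Icc (-(ρ / 3)) (ρ / 3),
      HasDerivAt (fun t => φ (pointAt x₀ v t y)) (fderiv ℝ φ (pointAt x₀ v t y) v) t :=
    fun y hy t ht => h.hasDerivAt (abs_le.2 ht) hy
  have hline : ∀ y : Hyper v, Continuous fun t => pointAt x₀ v t y := fun y =>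
    (continuous_pointAt x₀ v).comp (by fun_prop : Continuous fun t : ℝ => (t, y))
  have hcont : ∀ y : Hyper v, ‖y‖ < ρ / 3 →
      ContinuousOn (fun t => fderiv ℝ φ (pointAt x₀ v t y) v) (Icc (-(ρ / 3)) (ρ / 3)) := by
    intro y hy
    refine ContinuousOn.clm_apply ?_ continuousOn_const
    exact h.continuousOn_fderiv.comp (hline y).continuousOn
      fun t ht => h.pointAt_mem_ball (abs_le.2 ht) hy
  have hpos : ∀ y : Hyper v, ‖y‖ < ρ / 3 → ∀ t ∈ Icc (-(ρ / 3)) (ρ / 3),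
      0 < fderiv ℝ φ (pointAt x₀ v t y) v := fun y hy t ht =>
    h.fderiv_pos (h.pointAt_mem_ball (abs_le.2 ht) hy)
  have hmem : ∀ y : Hyper v, ‖y‖ < ρ / 3 → ∀ t ∈ Ioc (-(ρ / 3)) (h.height y),
      pointAt x₀ v t y ∈ {x ∈ cylinder x₀ v (ρ / 3) | φ x ≤ 0} := by
    intro y hy t ht
    have ht' : |t| < ρ / 3 := abs_lt.2 ⟨ht.1, ht.2.trans_lt (h.height_mem hy).2⟩
    exact ⟨(pointAt_mem_cylinder h.norm_eq).2 ⟨hy, ht'⟩, (h.apply_nonpos_iff hy ht'.le).2 ht.2⟩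
  -- After Fubini, `fderiv ℝ φ · v` is the derivative of φ along each vertical line, so the
  -- one-dimensional concentration applies line by line.
  refine Filter.Tendsto.congr (fun k => ((h.setIntegral_eq (hint k)).2).symm) ?_
  refine tendsto_integral_of_dominated_convergence (fun _ => M)
    (fun k => (h.setIntegral_eq (hint k)).1) (integrableOn_const measure_ball_lt_top.ne) ?_ ?_
  · refine fun k => (ae_restrict_iff' measurableSet_ball).2 (Filter.Eventually.of_forall
      fun y hy => ?_)
    have hy' : ‖y‖ < ρ / 3 := by simpa using hy
    refine abs_integral_mul_weight_le (hsub y hy') (hcont y hy') (hpos y hy') (h.height_mem hy')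
      (h.apply_height hy') hM0 (fun t ht => ?_) k
    have := hmem y hy' t (Ioo_subset_Ioc_self ht)
    exact hM _ this.1 this.2
  · refine (ae_restrict_iff' measurableSet_ball).2 (Filter.Eventually.of_forall fun y hy => ?_)
    have hy' : ‖y‖ < ρ / 3 := by simpa using hy
    have hqc : ContinuousOn (fun t => q (pointAt x₀ v t y)) (Ioc (-(ρ / 3)) (h.height y)) :=
      hq.comp (hline y).continuousOn (hmem y hy')
    refine tendsto_integral_mul_weight (q := fun t => q (pointAt x₀ v t y)) (hsub y hy')
      (hcont y hy') (hpos y hy') (h.height_mem hy') (h.apply_height hy') ?_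
      (hqc.mono Ioo_subset_Ioc_self)
    refine (hqc _ ⟨(h.height_mem hy').1, le_rfl⟩).mono_of_mem_nhdsWithin ?_
    exact Ioc_mem_nhdsLE (h.height_mem hy').1

end FlatChart

/-- The normalising factor of `μHE[d]` depends on d alone, so the bound for the unnormalised
Hausdorff measure carries over. -/
lemma _root_.LipschitzOnWith.euclideanHausdorffMeasure_image_le {X Y : Type*} [EMetricSpace X]
    [EMetricSpace Y] [MeasurableSpace X] [BorelSpace X] [MeasurableSpace Y] [BorelSpace Y]
    {K : NNReal} {f : X → Y} {s : Set X} (h : LipschitzOnWith K f s) (d : ℕ) :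
    μHE[d] (f '' s) ≤ (K : ℝ≥0∞) ^ d * μHE[d] s := by
  have h1 := h.hausdorffMeasure_image_le (d := d) (by positivity)
  rw [ENNReal.rpow_natCast] at h1
  simp only [Measure.euclideanHausdorffMeasure_def, Measure.smul_apply, ENNReal.smul_def,
    smul_eq_mul]
  calc _ ≤ _ := mul_le_mul_right h1 _
    _ = _ := by ring

/-! ### Surface measure of the graph and the approximate flux formula -/

namespace FlatChart

variable {x₀ v : E n} {a ε ρ : ℝ} {φ : E n → ℝ}

/-- The graph piece of the hypersurface `φ = 0`. -/
def piece (_ : FlatChart x₀ v a ε ρ φ) : Set (E n) := {x ∈ cylinder x₀ v (ρ / 3) | φ x = 0}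

lemma measurableSet_piece (h : FlatChart x₀ v a ε ρ φ) : MeasurableSet h.piece := by
  have h1 : h.piece = {x ∈ cylinder x₀ v (ρ / 3) | φ x ≤ 0} ∩
      {x ∈ cylinder x₀ v (ρ / 3) | φ x < 0}ᶜ := by
    ext x
    simp only [piece, mem_ofPred_eq, mem_inter_iff, mem_compl_iff, not_and, not_lt]
    constructor
    · rintro ⟨h1, h2⟩; exact ⟨⟨h1, h2.le⟩, fun _ => h2.ge⟩
    · rintro ⟨⟨h1, h2⟩, h3⟩; exact ⟨h1, le_antisymm h2 (h3 h1)⟩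
  have h2 : {x ∈ cylinder x₀ v (ρ / 3) | φ x ≤ 0} = cylinder x₀ v (ρ / 3) ∩
      {x ∈ cylinder x₀ v (ρ / 3) | 0 < φ x}ᶜ := by
    ext x
    simp only [mem_ofPred_eq, mem_inter_iff, mem_compl_iff, not_and, not_lt]
    tauto
  have h3 : IsOpen {x ∈ cylinder x₀ v (ρ / 3) | 0 < φ x} :=
    (h.contDiffOn.continuousOn.mono h.cylinder_subset_ball).isOpen_inter_preimage
      (isOpen_cylinder _ _ _) isOpen_Ioi
  rw [h1, h2]
  exact ((isOpen_cylinder _ _ _).measurableSet.inter h3.measurableSet.compl).inter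
    h.isOpen_neg.measurableSet.compl

/-- The surface measure of the graph, transported to the hyperplane. -/
def shadow (h : FlatChart x₀ v a ε ρ φ) : Measure (Hyper v) :=
  Measure.map (base x₀ v) ((μHE[n] : Measure (E n)).restrict h.piece)

lemma graph_image (h : FlatChart x₀ v a ε ρ φ) (s : Set (Hyper v)) :
    h.graph '' (s ∩ Metric.ball 0 (ρ / 3)) = base x₀ v ⁻¹' s ∩ h.piece := by
  ext x
  constructor
  · rintro ⟨y, ⟨hy, hyb⟩, rfl⟩
    have hy' : ‖y‖ < ρ / 3 := by simpa using hyb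
    refine ⟨?_, h.graph_mem hy', h.apply_height hy'⟩
    rw [mem_preimage, graph, base_pointAt]; exact hy
  · rintro ⟨hx, hxp⟩
    exact ⟨base x₀ v x, ⟨hx, by simpa using hxp.1.1⟩, h.eq_height hxp.1 hxp.2⟩

lemma hausdorff_hyper (h : FlatChart x₀ v a ε ρ φ) :
    (μHE[n] : Measure (Hyper v)) = volume := by
  have h1 := InnerProductSpace.euclideanHausdorffMeasure_eq_volume (V := Hyper v)
  rwa [finrank_hyper h.norm_eq] at h1

/-- The orthogonal projection is 1-Lipschitz and maps the piece onto the ball. With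
`shadow_le_volume` this takes the place of the area formula. -/
lemma volume_le_shadow (h : FlatChart x₀ v a ε ρ φ) :
    volume.restrict (Metric.ball (0 : Hyper v) (ρ / 3)) ≤ h.shadow := by
  refine Measure.le_iff.2 fun s hs => ?_
  rw [shadow, Measure.map_apply (continuous_base _ _).measurable hs,
    Measure.restrict_apply ((continuous_base _ _).measurable hs), Measure.restrict_apply hs,
    ← h.hausdorff_hyper]
  have h1 : s ∩ Metric.ball 0 (ρ / 3) = base x₀ v '' (base x₀ v ⁻¹' s ∩ h.piece) := by
    rw [← h.graph_image, image_image]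
    simp [graph, base_pointAt]
  have h2 : LipschitzOnWith 1 (base x₀ v) (base x₀ v ⁻¹' s ∩ h.piece) := by
    refine LipschitzWith.lipschitzOnWith (LipschitzWith.of_dist_le_mul fun x y => ?_)
    rw [dist_eq_norm, dist_eq_norm, base, base, ← map_sub, NNReal.coe_one, one_mul]
    refine (Submodule.norm_orthogonalProjectionOnto_apply_le _ _).trans_eq ?_
    congr 1; abel
  rw [h1]
  simpa using h2.euclideanHausdorffMeasure_image_le n

/-- The piece is the image of the ball under the (1 − ε)⁻¹-Lipschitz graph map, and n-dimensional
measure grows by at most the n-th power. -/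
lemma shadow_le_volume (h : FlatChart x₀ v a ε ρ φ) :
    h.shadow ≤ ENNReal.ofReal ((1 - ε)⁻¹ ^ n) •
      volume.restrict (Metric.ball (0 : Hyper v) (ρ / 3)) := by
  refine Measure.le_iff.2 fun s hs => ?_
  rw [shadow, Measure.map_apply (continuous_base _ _).measurable hs,
    Measure.restrict_apply ((continuous_base _ _).measurable hs), Measure.smul_apply,
    Measure.restrict_apply hs, ← h.graph_image, ← h.hausdorff_hyper, smul_eq_mul,
    ENNReal.ofReal_pow (inv_nonneg.2 (by linarith [h.ε_lt]))]
  exact (h.lipschitzOnWith_graph.mono inter_subset_right).euclideanHausdorffMeasure_image_le n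

lemma isFiniteMeasure_piece (h : FlatChart x₀ v a ε ρ φ) :
    IsFiniteMeasure ((μHE[n] : Measure (E n)).restrict h.piece) := by
  have h1 : h.shadow univ < ⊤ := by
    refine (h.shadow_le_volume univ).trans_lt ?_
    rw [Measure.smul_apply, smul_eq_mul, Measure.restrict_apply_univ]
    exact ENNReal.mul_lt_top ENNReal.ofReal_lt_top measure_ball_lt_top
  rw [shadow, Measure.map_apply (continuous_base _ _).measurable MeasurableSet.univ,
    preimage_univ] at h1
  exact ⟨h1⟩

lemma integral_shadow (h : FlatChart x₀ v a ε ρ φ) {q : E n → ℝ} (hq : ContinuousOn q h.piece) :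
    ∫ y, q (h.graph y) ∂h.shadow = ∫ x in h.piece, q x ∂μHE[n] := by
  have hc : ContinuousOn (fun y => q (h.graph y)) (Metric.ball 0 (ρ / 3)) := by
    refine hq.comp h.lipschitzOnWith_graph.continuousOn fun y hy => ?_
    have hy' : ‖y‖ < ρ / 3 := by simpa using hy
    exact ⟨h.graph_mem hy', h.apply_height hy'⟩
  have hac : h.shadow ≪ volume.restrict (Metric.ball (0 : Hyper v) (ρ / 3)) :=
    (Measure.absolutelyContinuous_of_le h.shadow_le_volume).trans Measure.smul_absolutelyContinuous
  have hm : AEStronglyMeasurable (fun y => q (h.graph y)) h.shadow :=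
    (hc.aestronglyMeasurable measurableSet_ball).mono_ac hac
  rw [shadow, integral_map (continuous_base _ _).aemeasurable hm]
  refine setIntegral_congr_fun h.measurableSet_piece fun x hx => ?_
  rw [graph, h.eq_height hx.1 hx.2]

/-- The relative error of the flux through a chart of flatness `ε`. -/
def error (n : ℕ) (ε : ℝ) : ℝ :=
  -- The first summand is the measure distortion times the bound for the flux density; the second is
  -- the cost of dividing by `fderiv ℝ φ x v` in place of the norm of the differential.
  ((1 - ε)⁻¹ ^ n - 1) * ((1 + ε) / (1 - ε)) + 2 * ε / (1 - ε)

lemma tendsto_error (n : ℕ) : Filter.Tendsto (error n) (𝓝[>] 0) (𝓝 0) := by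
  have h1 : ContinuousAt (error n) 0 := by
    unfold error
    have : (1 : ℝ) - 0 ≠ 0 := by norm_num
    fun_prop (disch := assumption)
  have h2 := h1.tendsto
  simp only [error, sub_zero, inv_one, one_pow, sub_self, zero_mul, mul_zero, zero_div,
    add_zero] at h2
  exact h2.mono_left nhdsWithin_le_nhds

/-- The divergence theorem in a nearly flat chart, up to a small relative error. -/
theorem abs_integral_divergence_sub_le (h : FlatChart x₀ v a ε ρ φ) {Ω : Set (E n)}
    (hΩ : IsOpen Ω) (hΩφ : ∀ y ∈ cylinder x₀ v (ρ / 3), (y ∈ Ω ↔ φ y < 0)) {F : E n → E n}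
    (hF : ContDiffOn ℝ 1 F Ω) (hc : HasCompactSupport F)
    (hs : tsupport F ⊆ cylinder x₀ v (ρ / 3))
    (hFc : ContinuousOn F (closure Ω ∩ cylinder x₀ v (ρ / 3)))
    (hdiv : IntegrableOn (divergence F) Ω) :
    |(∫ x in Ω, divergence F x) -
        ∫ x in h.piece, fderiv ℝ φ x (F x) / ‖fderiv ℝ φ x‖ ∂μHE[n]| ≤
      error n ε * ∫ x in h.piece, ‖F x‖ ∂μHE[n] := by
  set C := cylinder x₀ v (ρ / 3) with hC
  have hCo : IsOpen C := isOpen_cylinder _ _ _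
  have hCb : C ⊆ Metric.ball x₀ ρ := h.cylinder_subset_ball
  have hε : 0 < 1 - ε := by linarith [h.ε_lt]
  have hε0 := h.ε_pos
  have ha := h.a_pos
  -- the closed sublevel set belongs to the closure
  have hcl : {x ∈ C | φ x ≤ 0} ⊆ closure Ω ∩ C := by
    rintro x ⟨hxC, hx0⟩
    refine ⟨?_, hxC⟩
    set y := base x₀ v x with hy
    set t := inner ℝ v (x - x₀) with ht
    have hxe : pointAt x₀ v t y = x := pointAt_base h.norm_eq x
    have hlim : Filter.Tendsto (fun s : ℝ => pointAt x₀ v s y) (𝓝[<] t) (𝓝 x) := by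
      have hcn : Continuous fun s : ℝ => pointAt x₀ v s y :=
        (continuous_pointAt x₀ v).comp (by fun_prop : Continuous fun s : ℝ => (s, y))
      have := hcn.tendsto t
      rw [hxe] at this
      exact this.mono_left nhdsWithin_le_nhds
    refine mem_closure_of_tendsto hlim ?_
    have htg : t ≤ h.height y := by
      rw [← h.apply_nonpos_iff hxC.1 hxC.2.le, hxe]; exact hx0
    filter_upwards [hlim.eventually (hCo.mem_nhds hxC), self_mem_nhdsWithin] with s hs hst
    rw [hΩφ _ hs]
    have hs2 := (pointAt_mem_cylinder h.norm_eq).1 hs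
    exact (h.apply_neg_iff hs2.1 hs2.2.le).2 (lt_of_lt_of_le hst htg)
  have hΩC : Ω ∩ C = {x ∈ C | φ x < 0} := by
    ext x
    constructor
    · rintro ⟨h1, h2⟩; exact ⟨h2, (hΩφ x h2).1 h1⟩
    · rintro ⟨h1, h2⟩; exact ⟨(hΩφ x h1).2 h2, h1⟩
  -- a bound for the field
  obtain ⟨M, hM⟩ := (hc.isCompact.inter_right (isClosed_closure (s := Ω))).exists_bound_of_continuousOn
    (hFc.mono fun x hx => ⟨hx.2, hs hx.1⟩)
  have hMall : ∀ x ∈ closure Ω, ‖F x‖ ≤ max M 0 := by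
    intro x hx
    by_cases hxF : x ∈ tsupport F
    · exact (hM x ⟨hxF, hx⟩).trans (le_max_left _ _)
    · rw [image_eq_zero_of_notMem_tsupport hxF, norm_zero]; exact le_max_right _ _
  -- The flux density with respect to Lebesgue measure on the hyperplane rather than surface measure
  -- on the graph.
  set q : E n → ℝ := fun x => fderiv ℝ φ x (F x) / fderiv ℝ φ x v with hq
  have hqc : ContinuousOn q {x ∈ C | φ x ≤ 0} := by
    have hdφ : ContinuousOn (fderiv ℝ φ) {x ∈ C | φ x ≤ 0} :=
      h.continuousOn_fderiv.mono fun x hx => hCb hx.1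
    exact (hdφ.clm_apply (hFc.mono hcl)).div (hdφ.clm_apply continuousOn_const)
      fun x hx => (h.fderiv_pos (hCb hx.1)).ne'
  have hratio : ∀ x ∈ C, ‖fderiv ℝ φ x‖ / fderiv ℝ φ x v ≤ (1 + ε) / (1 - ε) := by
    intro x hx
    rw [div_le_div_iff₀ (h.fderiv_pos (hCb hx)) hε]
    have h1 := h.norm_fderiv_le (hCb hx)
    have h2 := h.le_fderiv (hCb hx)
    nlinarith
  have hqF : ∀ x ∈ C, |q x| ≤ (1 + ε) / (1 - ε) * ‖F x‖ := by
    intro x hx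
    rw [hq, abs_div, abs_of_pos (h.fderiv_pos (hCb hx))]
    calc |fderiv ℝ φ x (F x)| / fderiv ℝ φ x v ≤ ‖fderiv ℝ φ x‖ * ‖F x‖ / fderiv ℝ φ x v :=
          div_le_div_of_nonneg_right ((fderiv ℝ φ x).le_opNorm _) (h.fderiv_pos (hCb hx)).le
      _ = ‖fderiv ℝ φ x‖ / fderiv ℝ φ x v * ‖F x‖ := by ring
      _ ≤ _ := mul_le_mul_of_nonneg_right (hratio x hx) (norm_nonneg _)
  have hqM : ∀ x ∈ C, φ x ≤ 0 → |q x| ≤ (1 + ε) / (1 - ε) * max M 0 := fun x hx hx0 =>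
    (hqF x hx).trans (mul_le_mul_of_nonneg_left (hMall x (hcl ⟨hx, hx0⟩).1) (by positivity))
  -- the exact flux formula
  have hflux : ∫ x in Ω, divergence F x =
      ∫ y in Metric.ball (0 : Hyper v) (ρ / 3), q (h.graph y) := by
    refine tendsto_nhds_unique ?_ (h.tendsto_flux hqc hqM)
    have hlim1 : Filter.Tendsto (fun k => ∫ x in Ω, stepDown k (φ x) * divergence F x)
        Filter.atTop (𝓝 (∫ x in Ω, divergence F x)) := by
      refine tendsto_integral_cutoff_mul hdiv ?_ fun k => ?_
      · refine (ae_restrict_iff' hΩ.measurableSet).2 (Filter.Eventually.of_forall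
          fun x hx hx0 => ?_)
        exact (hΩφ x (hs (support_divergence_subset F hx0))).1 hx
      -- φ is controlled only inside the chart; off the support of F the product is locally zero.
      · have h1 : ContinuousOn (fun x => stepDown k (φ x) * divergence F x) Ω := by
          intro x hx
          by_cases hxC : x ∈ tsupport F
          · refine ContinuousWithinAt.mul ?_ (continuousOn_divergence hΩ hF x hx)
            exact ((contDiff_stepDown k).continuous.continuousAt.comp
              (h.differentiableAt (hCb (hs hxC))).continuousAt).continuousWithinAt
          · have : (fun x => stepDown k (φ x) * divergence F x) =ᶠ[𝓝 x] fun _ => 0 := by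
              filter_upwards [(isClosed_tsupport F).isOpen_compl.mem_nhds hxC] with z hz
              have : divergence F z = 0 := by
                by_contra h0; exact hz (support_divergence_subset F h0)
              rw [this, mul_zero]
            exact (continuousAt_const.congr this.symm).continuousWithinAt
        exact h1.aestronglyMeasurable hΩ.measurableSet
    refine hlim1.congr fun k => ?_
    have hsub : ∫ x in Ω, -deriv (stepDown k) (φ x) * fderiv ℝ φ x (F x) =
        ∫ x in Ω ∩ C, -deriv (stepDown k) (φ x) * fderiv ℝ φ x (F x) := by
      refine setIntegral_eq_of_subset_of_forall_sdiff_eq_zero hΩ.measurableSet inter_subset_left ?_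
      rintro x ⟨hx, hx2⟩
      have : x ∉ tsupport F := fun hh => hx2 ⟨hx, hs hh⟩
      rw [image_eq_zero_of_notMem_tsupport this]; simp
    rw [integral_cutoff_mul_divergence hΩ hCo hF hc hs (h.contDiffOn.mono hCb) hΩφ
      (contDiff_stepDown k) (c := -(1 / (2 * (k + 1)))) (neg_lt_zero.2 (by positivity))
      fun s hs => stepDown_eq_zero hs, hsub, ← hΩC]
    refine setIntegral_congr_fun (hΩ.inter hCo).measurableSet fun x hx => ?_
    have := (h.fderiv_pos (hCb hx.2)).ne'
    simp only [hq]
    field_simp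
  -- comparison with the surface integral
  have hpC : h.piece ⊆ {x ∈ C | φ x ≤ 0} := fun x hx => ⟨hx.1, le_of_eq hx.2⟩
  have := h.isFiniteMeasure_piece
  have hpm := h.measurableSet_piece
  have hqp := hqc.mono hpC
  have hbdd : ∀ {f : E n → ℝ} {B : ℝ}, ContinuousOn f h.piece → (∀ x ∈ h.piece, |f x| ≤ B) →
      IntegrableOn f h.piece μHE[n] := by
    intro f B hf hB
    exact Integrable.mono' (integrable_const B) (hf.aestronglyMeasurable hpm)
      ((ae_restrict_iff' hpm).2 (Filter.Eventually.of_forall hB))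
  have hFp : ContinuousOn F h.piece := hFc.mono (hpC.trans hcl)
  have hFint : IntegrableOn (fun x => ‖F x‖) h.piece μHE[n] :=
    hbdd (B := max M 0) hFp.norm fun x hx => by
      rw [abs_of_nonneg (norm_nonneg _)]; exact hMall x (hcl (hpC hx)).1
  have hqint : IntegrableOn q h.piece μHE[n] :=
    hbdd hqp fun x hx => hqM x (hpC hx).1 (hpC hx).2
  have hN : ∀ x ∈ C, 0 < ‖fderiv ℝ φ x‖ := fun x hx =>
    (h.fderiv_pos (hCb hx)).trans_le (h.fderiv_le_norm x)
  have hbF : ∀ x ∈ C, |fderiv ℝ φ x (F x) / ‖fderiv ℝ φ x‖| ≤ ‖F x‖ := by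
    intro x hx
    rw [abs_div, abs_of_pos (hN x hx), div_le_iff₀ (hN x hx), mul_comm]
    exact (fderiv ℝ φ x).le_opNorm _
  have hbint : IntegrableOn (fun x => fderiv ℝ φ x (F x) / ‖fderiv ℝ φ x‖) h.piece μHE[n] := by
    have hdφ : ContinuousOn (fderiv ℝ φ) h.piece :=
      h.continuousOn_fderiv.mono fun x hx => hCb hx.1
    refine hbdd (B := max M 0) ((hdφ.clm_apply hFp).div hdφ.norm
      fun x hx => (hN x hx.1).ne') fun x hx => ?_
    exact (hbF x hx.1).trans (hMall x (hcl (hpC hx)).1)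
  have hgraphint : Integrable (fun y => q (h.graph y))
      (volume.restrict (Metric.ball (0 : Hyper v) (ρ / 3))) := by
    refine Integrable.mono' (integrableOn_const (C := (1 + ε) / (1 - ε) * max M 0)
      measure_ball_lt_top.ne) ?_ ?_
    · refine (hqp.comp h.lipschitzOnWith_graph.continuousOn
        fun y hy => ?_).aestronglyMeasurable measurableSet_ball
      have hy' : ‖y‖ < ρ / 3 := by simpa using hy
      exact ⟨h.graph_mem hy', h.apply_height hy'⟩
    · refine (ae_restrict_iff' measurableSet_ball).2 (Filter.Eventually.of_forall fun y hy => ?_)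
      have hy' : ‖y‖ < ρ / 3 := by simpa using hy
      exact hqM _ (h.graph_mem hy') (h.apply_height hy').le
  have hone : 1 ≤ (1 - ε)⁻¹ ^ n := one_le_pow₀ (by
    rw [one_le_inv₀ hε]; linarith)
  have : IsFiniteMeasure (volume.restrict (Metric.ball (0 : Hyper v) (ρ / 3))) :=
    ⟨by rw [Measure.restrict_apply_univ]; exact measure_ball_lt_top⟩
  have hcmp := abs_integral_sub_integral_le (κ := (1 - ε)⁻¹ ^ n - 1) (by linarith)
    h.volume_le_shadow (by rw [add_sub_cancel]; exact h.shadow_le_volume) hgraphint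
  have habs : ∫ y in Metric.ball (0 : Hyper v) (ρ / 3), |q (h.graph y)| ≤
      (1 + ε) / (1 - ε) * ∫ x in h.piece, ‖F x‖ ∂μHE[n] := by
    have hshint : Integrable (fun y => |q (h.graph y)|) h.shadow := by
      refine Integrable.mono_measure ?_ h.shadow_le_volume
      exact (hgraphint.abs).smul_measure ENNReal.ofReal_ne_top
    calc ∫ y in Metric.ball (0 : Hyper v) (ρ / 3), |q (h.graph y)|
        ≤ ∫ y, |q (h.graph y)| ∂h.shadow := integral_mono_measure h.volume_le_shadow
          (Filter.Eventually.of_forall fun y => abs_nonneg _) hshint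
      _ = ∫ x in h.piece, |q x| ∂μHE[n] := h.integral_shadow hqp.abs
      _ ≤ ∫ x in h.piece, (1 + ε) / (1 - ε) * ‖F x‖ ∂μHE[n] :=
          setIntegral_mono_on hqint.abs (hFint.const_mul _) hpm fun x hx => hqF x hx.1
      _ = _ := integral_const_mul _ _
  rw [h.integral_shadow hqp] at hcmp
  have hdiff : |∫ x in h.piece, q x ∂μHE[n] -
      ∫ x in h.piece, fderiv ℝ φ x (F x) / ‖fderiv ℝ φ x‖ ∂μHE[n]| ≤
      2 * ε / (1 - ε) * ∫ x in h.piece, ‖F x‖ ∂μHE[n] := by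
    rw [← integral_sub hqint hbint, ← integral_const_mul, ← Real.norm_eq_abs]
    refine norm_integral_le_of_norm_le (hFint.const_mul _)
      ((ae_restrict_iff' hpm).2 (Filter.Eventually.of_forall fun x hx => ?_))
    have hp := h.fderiv_pos (hCb hx.1)
    have hNx := hN x hx.1
    have e1 : q x - fderiv ℝ φ x (F x) / ‖fderiv ℝ φ x‖ =
        (‖fderiv ℝ φ x‖ / fderiv ℝ φ x v - 1) * (fderiv ℝ φ x (F x) / ‖fderiv ℝ φ x‖) := by
      simp only [hq]
      field_simp
    have e2 : 0 ≤ ‖fderiv ℝ φ x‖ / fderiv ℝ φ x v - 1 := by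
      rw [sub_nonneg, one_le_div hp]; exact h.fderiv_le_norm x
    have e3 : ‖fderiv ℝ φ x‖ / fderiv ℝ φ x v - 1 ≤ 2 * ε / (1 - ε) := by
      have := hratio x hx.1
      have e4 : (1 + ε) / (1 - ε) - 1 = 2 * ε / (1 - ε) := by field_simp; ring
      linarith
    rw [e1, Real.norm_eq_abs, abs_mul, abs_of_nonneg e2]
    exact mul_le_mul e3 (hbF x hx.1) (abs_nonneg _) (by positivity)
  rw [hflux, error, add_mul]
  rw [abs_sub_comm] at hcmp
  calc _ ≤ |(∫ y in Metric.ball (0 : Hyper v) (ρ / 3), q (h.graph y)) -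
          ∫ x in h.piece, q x ∂μHE[n]| + |∫ x in h.piece, q x ∂μHE[n] -
          ∫ x in h.piece, fderiv ℝ φ x (F x) / ‖fderiv ℝ φ x‖ ∂μHE[n]| := abs_sub_le _ _ _
    _ ≤ _ := by
        refine add_le_add (hcmp.trans ?_) hdiff
        rw [mul_assoc]
        exact mul_le_mul_of_nonneg_left habs (by linarith)

end FlatChart

/-! ### Defining functions -/

lemma fderiv_eq_inner_gradient (φ : E n → ℝ) (x w : E n) :
    fderiv ℝ φ x w = inner ℝ (gradient φ x) w := by
  rw [gradient, InnerProductSpace.toDual_symm_apply]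

lemma norm_gradient (φ : E n → ℝ) (x : E n) : ‖gradient φ x‖ = ‖fderiv ℝ φ x‖ := by
  rw [gradient, LinearIsometryEquiv.norm_map]

namespace IsDefiningFunction

variable {Ω : Set (E n)} {x : E n} {φ : E n → ℝ}

/-- A defining function at `x` is a defining function at all nearby boundary points, and the
boundary is its zero set near `x`. -/
lemma exists_nhds (hΩ : IsOpen Ω) (h : IsDefiningFunction Ω x φ) :
    ∃ U : Set (E n), IsOpen U ∧ x ∈ U ∧ ContDiffOn ℝ ∞ φ U ∧ (∀ y ∈ U, (y ∈ Ω ↔ φ y < 0)) ∧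
      (∀ y ∈ U, gradient φ y ≠ 0) ∧ (∀ y ∈ U, (y ∈ frontier Ω ↔ φ y = 0)) ∧
      ∀ y ∈ U, y ∈ frontier Ω → IsDefiningFunction Ω y φ := by
  obtain ⟨h0, hg, U, hU, hx, hφ, hΩU⟩ := h
  have hdc : ContinuousOn (fderiv ℝ φ) U := hφ.continuousOn_fderiv_of_isOpen hU (by simp)
  have hV : IsOpen {y ∈ U | fderiv ℝ φ y ≠ 0} :=
    hdc.isOpen_inter_preimage hU isOpen_compl_singleton
  have hgf : ∀ y, gradient φ y ≠ 0 ↔ fderiv ℝ φ y ≠ 0 := fun y => by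
    rw [← norm_ne_zero_iff, norm_gradient, norm_ne_zero_iff]
  have hfr : ∀ y ∈ {y ∈ U | fderiv ℝ φ y ≠ 0}, (y ∈ frontier Ω ↔ φ y = 0) := by
    rintro y ⟨hyU, hyd⟩
    have hcy : ContinuousAt φ y := (hφ.contDiffAt (hU.mem_nhds hyU)).continuousAt
    rw [hΩ.frontier_eq]
    constructor
    · rintro ⟨hy1, hy2⟩
      have h1 : 0 ≤ φ y := not_lt.1 fun hh => hy2 ((hΩU y hyU).2 hh)
      refine le_antisymm ?_ h1
      by_contra! hpos
      obtain ⟨z, hz, hzΩ⟩ := mem_closure_iff_nhds.1 hy1 _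
        (Filter.inter_mem (hcy.eventually (lt_mem_nhds hpos)) (hU.mem_nhds hyU))
      exact absurd ((hΩU z hz.2).1 hzΩ) (not_lt.2 (le_of_lt hz.1))
    · intro hy0
      refine ⟨?_, fun hh => by have := (hΩU y hyU).1 hh; linarith⟩
      set w := gradient φ y with hw
      have hw0 : 0 < ‖w‖ := norm_pos_iff.2 ((hgf y).2 hyd)
      -- Moving from y against the gradient makes φ negative, so y is a limit of points of Ω.
      have hd : HasDerivAt (fun t : ℝ => φ (y - t • w)) (-‖w‖ ^ 2) 0 := by
        have h1 : HasFDerivAt φ (fderiv ℝ φ y) (y - (0 : ℝ) • w) := by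
          simpa using ((hφ.contDiffAt (hU.mem_nhds hyU)).differentiableAt (by simp)).hasFDerivAt
        have h2 : HasDerivAt (fun t : ℝ => y - t • w) (-w) 0 := by
          simpa using ((hasDerivAt_id (0 : ℝ)).smul_const w).const_sub y
        have h3 := h1.comp_hasDerivAt (0 : ℝ) h2
        rwa [fderiv_eq_inner_gradient, inner_neg_right, real_inner_self_eq_norm_sq] at h3
      have hlim : Filter.Tendsto (fun t : ℝ => y - t • w) (𝓝[>] 0) (𝓝 y) := by
        have : ContinuousAt (fun t : ℝ => y - t • w) 0 := by fun_prop
        have h := this.tendsto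
        simp only [zero_smul, sub_zero] at h
        exact h.mono_left nhdsWithin_le_nhds
      have hs := (hasDerivAt_iff_tendsto_slope.1 hd).mono_left
        (nhdsWithin_mono (0 : ℝ) (s := Ioi 0) (t := {0}ᶜ) (fun t ht => (ne_of_gt ht)))
      refine mem_closure_of_tendsto hlim ?_
      filter_upwards [hs.eventually (gt_mem_nhds (by nlinarith : -‖w‖ ^ 2 < 0)),
        hlim.eventually (hU.mem_nhds hyU), self_mem_nhdsWithin] with t ht htU ht0
      rw [hΩU _ htU]
      have ht0 : (0 : ℝ) < t := ht0
      simp only [slope_def_field, zero_smul, sub_zero, hy0] at ht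
      by_contra! hh
      exact absurd ht (not_lt.2 (div_nonneg hh ht0.le))
  refine ⟨_, hV, ⟨hx, (hgf x).1 hg⟩, hφ.mono fun y hy => hy.1, fun y hy => hΩU y hy.1,
    fun y hy => (hgf y).2 hy.2, hfr, fun y hy hyf => ⟨(hfr y hy).1 hyf, (hgf y).2 hy.2, U, hU,
      hy.1, hφ, hΩU⟩⟩

lemma inner_outerNormal (h : IsDefiningFunction Ω x φ) (w : E n) :
    inner ℝ w (outerNormal Ω x) = fderiv ℝ φ x w / ‖fderiv ℝ φ x‖ := by
  rw [outerNormal_eq h, inner_smul_right, real_inner_comm, ← fderiv_eq_inner_gradient,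
    norm_gradient, div_eq_inv_mul]

lemma norm_outerNormal (h : IsDefiningFunction Ω x φ) : ‖outerNormal Ω x‖ = 1 := by
  rw [outerNormal_eq h, norm_smul, norm_inv, norm_norm,
    inv_mul_cancel₀ (norm_ne_zero_iff.2 h.2.1)]

/-- Take v the unit normal at x and a the length of the gradient there; continuity of the
differential gives any flatness ε on a small ball. -/
lemma exists_flatChart (h : IsDefiningFunction Ω x φ) {W : Set (E n)} (hW : W ∈ 𝓝 x) {ε : ℝ}
    (hε : 0 < ε) (hε2 : ε < 1 / 2) : ∃ v a ρ, FlatChart x v a ε ρ φ ∧ Metric.ball x ρ ⊆ W := by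
  obtain ⟨h0, hg, U, hU, hx, hφ, hΩU⟩ := h
  have hg0 : 0 < ‖gradient φ x‖ := norm_pos_iff.2 hg
  have hdc : ContinuousAt (fderiv ℝ φ) x :=
    (hφ.continuousOn_fderiv_of_isOpen hU (by simp)).continuousAt (hU.mem_nhds hx)
  have h1 : ∀ᶠ y in 𝓝 x, ‖fderiv ℝ φ y - fderiv ℝ φ x‖ < ε * ‖gradient φ x‖ := by
    have := hdc.eventually (Metric.ball_mem_nhds _ (mul_pos hε hg0))
    simpa [dist_eq_norm] using this
  obtain ⟨ρ, hρ, hball⟩ := Metric.mem_nhds_iff.1 (Filter.inter_mem (Filter.inter_mem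
    (hU.mem_nhds hx) hW) h1)
  refine ⟨‖gradient φ x‖⁻¹ • gradient φ x, ‖gradient φ x‖, ρ, ?_, fun y hy => (hball hy).1.2⟩
  have hfd : fderiv ℝ φ x = ‖gradient φ x‖ • innerSL ℝ (‖gradient φ x‖⁻¹ • gradient φ x) := by
    ext w
    rw [map_smul, smul_smul, mul_inv_cancel₀ hg0.ne', one_smul, fderiv_eq_inner_gradient]
    rfl
  refine ⟨?_, hg0, hε, hε2, hρ, ?_, h0, fun y hy => ?_⟩
  · rw [norm_smul, norm_inv, norm_norm, inv_mul_cancel₀ hg0.ne']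
  · exact (hφ.of_le (by simp)).mono fun y hy => (hball hy).1.1
  · rw [← hfd]; exact (hball hy).2.le

end IsDefiningFunction

/-! ### Local structure of the boundary -/

/-- The closure of `Ω` without the corner. -/
def regularPart (Ω Sig T : Set (E n)) : Set (E n) := closure Ω \ corner Sig T

namespace IsHalfBallDomain

variable {Ω Sig T : Set (E n)}

lemma isClosed_corner (Sig T : Set (E n)) : IsClosed (corner Sig T) :=
  isClosed_closure.inter isClosed_closure

lemma sig_subset_frontier (h : IsHalfBallDomain Ω Sig T) : Sig ⊆ frontier Ω := by
  rw [h.sig_eq]; exact fun x hx => hx.1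

lemma t_subset_frontier (h : IsHalfBallDomain Ω Sig T) : T ⊆ frontier Ω := by
  rw [h.t_eq]; exact fun x hx => hx.1

lemma notMem_closure_t (h : IsHalfBallDomain Ω Sig T) {x : E n} (hx : x ∈ Sig) :
    x ∉ closure T := by
  rw [h.sig_eq] at hx; exact hx.2

lemma notMem_closure_sig (h : IsHalfBallDomain Ω Sig T) {x : E n} (hx : x ∈ T) :
    x ∉ closure Sig := by
  rw [h.t_eq] at hx; exact hx.2

lemma corner_subset_frontier (h : IsHalfBallDomain Ω Sig T) : corner Sig T ⊆ frontier Ω :=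
  fun _ hx => closure_minimal h.sig_subset_frontier isClosed_frontier hx.1

lemma subset_ball (h : IsHalfBallDomain Ω Sig T) : Ω ⊆ Metric.ball 0 1 :=
  fun _ hx => (h.subset_halfBall hx).1

lemma closure_subset (h : IsHalfBallDomain Ω Sig T) : closure Ω ⊆ Metric.closedBall 0 1 :=
  closure_minimal (h.subset_ball.trans Metric.ball_subset_closedBall) Metric.isClosed_closedBall

lemma isCompact_closure (h : IsHalfBallDomain Ω Sig T) : IsCompact (closure Ω) :=
  (isCompact_closedBall 0 1).of_isClosed_subset isClosed_closure h.closure_subset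

lemma measurableSet_sig (h : IsHalfBallDomain Ω Sig T) : MeasurableSet Sig := by
  rw [h.sig_eq]
  exact isClosed_frontier.measurableSet.diff isClosed_closure.measurableSet

lemma isFiniteMeasure (h : IsHalfBallDomain Ω Sig T) :
    IsFiniteMeasure ((volume : Measure (E n)).restrict Ω) :=
  ⟨by
    rw [Measure.restrict_apply_univ]
    exact (measure_mono h.subset_ball).trans_lt measure_ball_lt_top⟩

lemma isFiniteMeasure_sig (h : IsHalfBallDomain Ω Sig T) :
    IsFiniteMeasure ((μHE[n] : Measure (E n)).restrict Sig) :=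
  ⟨by rw [Measure.restrict_apply_univ]; exact h.sig_area⟩

lemma notMem_corner (h : IsHalfBallDomain Ω Sig T) {x : E n} (hx : x ∈ Ω) :
    x ∉ corner Sig T := fun hc => by
  have := h.corner_subset_frontier hc
  rw [h.isOpen.frontier_eq] at this
  exact this.2 hx

lemma subset_regularPart (h : IsHalfBallDomain Ω Sig T) : Ω ⊆ regularPart Ω Sig T :=
  fun _ hx => ⟨subset_closure hx, h.notMem_corner hx⟩

lemma sig_subset_regularPart (h : IsHalfBallDomain Ω Sig T) : Sig ⊆ regularPart Ω Sig T :=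
  fun _ hx => ⟨frontier_subset_closure (h.sig_subset_frontier hx),
    fun hc => h.notMem_closure_t hx hc.2⟩

lemma t_subset_regularPart (h : IsHalfBallDomain Ω Sig T) : T ⊆ regularPart Ω Sig T :=
  fun _ hx => ⟨frontier_subset_closure (h.t_subset_frontier hx),
    fun hc => h.notMem_closure_sig hx hc.1⟩

lemma mem_regularPart (h : IsHalfBallDomain Ω Sig T) {x : E n} (hx : x ∈ regularPart Ω Sig T) :
    x ∈ Ω ∨ x ∈ Sig ∨ x ∈ T := by
  by_cases hxΩ : x ∈ Ω
  · exact Or.inl hxΩ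
  have hf : x ∈ frontier Ω := by rw [h.isOpen.frontier_eq]; exact ⟨hx.1, hxΩ⟩
  by_cases hT : x ∈ closure T
  · right; right
    rw [h.t_eq]
    exact ⟨hf, fun hS => hx.2 ⟨hS, hT⟩⟩
  · right; left
    rw [h.sig_eq]
    exact ⟨hf, hT⟩

/-- Near a point of `T`, the domain coincides with the unit ball. -/
lemma exists_ball_of_mem_t (h : IsHalfBallDomain Ω Sig T) {x : E n} (hx : x ∈ T) :
    ∃ ρ > 0, (∀ y ∈ Metric.ball x ρ, (y ∈ Ω ↔ ‖y‖ < 1)) ∧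
      Metric.ball x ρ ⊆ (closure Sig)ᶜ := by
  obtain ⟨ρ, hρ, hball⟩ := Metric.mem_nhds_iff.1
    (isClosed_closure.isOpen_compl.mem_nhds (h.notMem_closure_sig hx))
  refine ⟨ρ, hρ, fun y hy => ⟨fun hyΩ => by simpa using h.subset_ball hyΩ, fun hy1 => ?_⟩, hball⟩
  -- The lens is convex and contains points of Ω. If it also contained a point outside Ω, it would
  -- meet ∂Ω; off the closure of Σ this means T, which lies on the sphere, not in the open ball.
  have hconv : IsPreconnected (Metric.ball x ρ ∩ Metric.ball (0 : E n) 1) :=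
    ((convex_ball x ρ).inter (convex_ball 0 1)).isPreconnected
  have hcl : x ∈ closure Ω := frontier_subset_closure (h.t_subset_frontier hx)
  obtain ⟨z, hz, hzΩ⟩ := mem_closure_iff_nhds.1 hcl _ (Metric.ball_mem_nhds x hρ)
  by_contra hyΩ
  obtain ⟨p, hp, hpf⟩ : ∃ p ∈ Metric.ball x ρ ∩ Metric.ball (0 : E n) 1, p ∈ frontier Ω := by
    by_contra! hno
    have hcov : Metric.ball x ρ ∩ Metric.ball (0 : E n) 1 ⊆ Ω ∪ (closure Ω)ᶜ := by
      intro p hp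
      by_contra hp2
      rw [mem_union, not_or, mem_compl_iff, not_not] at hp2
      exact hno p hp (by rw [h.isOpen.frontier_eq]; exact ⟨hp2.2, hp2.1⟩)
    have hy2 : y ∈ Metric.ball x ρ ∩ Metric.ball (0 : E n) 1 := ⟨hy, by simpa using hy1⟩
    obtain ⟨p, -, hp1, hp2⟩ := hconv Ω _ h.isOpen isClosed_closure.isOpen_compl hcov
      ⟨z, ⟨hz, h.subset_ball hzΩ⟩, hzΩ⟩ ⟨y, hy2, (hcov hy2).resolve_left hyΩ⟩
    exact hp2 (subset_closure hp1)
  have hpT : p ∈ T := by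
    rw [h.t_eq]; exact ⟨hpf, hball hp.1⟩
  have h1 := h.t_subset hpT
  have h2 := hp.2
  simp only [mem_sphere_zero_iff_norm] at h1
  simp only [Metric.mem_ball, dist_zero_right] at h2
  linarith

lemma isDefiningFunction_of_mem_t (h : IsHalfBallDomain Ω Sig T) {x : E n} (hx : x ∈ T) :
    IsDefiningFunction Ω x (fun y => (‖y‖ ^ 2 - 1) / 2) ∧
      gradient (fun y : E n => (‖y‖ ^ 2 - 1) / 2) x = x := by
  have hx1 : ‖x‖ = 1 := by simpa using h.t_subset hx
  have hg : gradient (fun y : E n => (‖y‖ ^ 2 - 1) / 2) x = x := by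
    refine ext_inner_right ℝ fun w => ?_
    rw [← fderiv_eq_inner_gradient, (hasFDerivAt_half_norm_sq_sub x).fderiv]
    rfl
  obtain ⟨ρ, hρ, hball, -⟩ := h.exists_ball_of_mem_t hx
  refine ⟨⟨by simp [hx1], ?_, Metric.ball x ρ, Metric.isOpen_ball, Metric.mem_ball_self hρ, ?_,
    fun y hy => ?_⟩, hg⟩
  · rw [hg]; rintro rfl; simp at hx1
  · exact (((contDiff_norm_sq ℝ).sub contDiff_const).div_const 2).contDiffOn
  · rw [hball y hy]
    constructor
    · intro h; nlinarith [norm_nonneg y]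
    · intro h; nlinarith [norm_nonneg y]

lemma outerNormal_of_mem_t (h : IsHalfBallDomain Ω Sig T) {x : E n} (hx : x ∈ T) :
    outerNormal Ω x = x := by
  obtain ⟨h1, h2⟩ := h.isDefiningFunction_of_mem_t hx
  have hx1 : ‖x‖ = 1 := by simpa using h.t_subset hx
  rw [outerNormal_eq h1, h2, hx1, inv_one, one_smul]

/-- A single defining function computes the normal at all nearby boundary points. -/
lemma continuousOn_outerNormal (h : IsHalfBallDomain Ω Sig T) :
    ContinuousOn (outerNormal Ω) Sig := by
  intro x hx
  obtain ⟨φ, hφ⟩ := h.sig_smooth x hx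
  obtain ⟨U, hU, hxU, hφU, -, hgU, -, hdef⟩ := hφ.exists_nhds h.isOpen
  have hgc : ContinuousAt (gradient φ) x := by
    have h1 : ContinuousAt (fderiv ℝ φ) x :=
      (hφU.continuousOn_fderiv_of_isOpen hU (by simp)).continuousAt (hU.mem_nhds hxU)
    exact (InnerProductSpace.toDual ℝ (E n)).symm.continuous.continuousAt.comp h1
  have h2 : ContinuousAt (fun y => ‖gradient φ y‖⁻¹ • gradient φ y) x :=
    (hgc.norm.inv₀ (norm_ne_zero_iff.2 (hgU x hxU))).smul hgc
  refine h2.continuousWithinAt.congr_of_eventuallyEq ?_ (outerNormal_eq hφ)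
  filter_upwards [self_mem_nhdsWithin, mem_nhdsWithin_of_mem_nhds (hU.mem_nhds hxU)] with y hy hyU
  exact outerNormal_eq (hdef y hyU (h.sig_subset_frontier hy))

lemma norm_outerNormal (h : IsHalfBallDomain Ω Sig T) {x : E n} (hx : x ∈ Sig) :
    ‖outerNormal Ω x‖ = 1 := by
  obtain ⟨φ, hφ⟩ := h.sig_smooth x hx
  exact hφ.norm_outerNormal

end IsHalfBallDomain

/-! ### The divergence theorem away from the corner -/

/-- Vector fields that are continuous up to the regular boundary and tangent to the sphere
along `T`. -/
structure IsTangentField (Ω Sig T : Set (E n)) (F : E n → E n) : Prop where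
  contDiffOn : ContDiffOn ℝ 1 F Ω
  continuousOn : ContinuousOn F (regularPart Ω Sig T)
  integrableOn_divergence : IntegrableOn (divergence F) Ω
  inner_eq_zero : ∀ y ∈ T, inner ℝ y (F y) = 0

namespace IsHalfBallDomain

variable {Ω Sig T : Set (E n)}

/-- In the interior and near T the divergence integrates to zero and Σ is not met; near Σ a
sufficiently flat chart is used. The error is measured by the integral of ‖F‖ over Σ so that it
stays small after summing over a partition of unity. -/
lemma exists_local_divergence_theorem (h : IsHalfBallDomain Ω Sig T) {x : E n}
    (hx : x ∈ regularPart Ω Sig T) {ε : ℝ} (hε : 0 < ε) :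
    ∃ U : Set (E n), IsOpen U ∧ x ∈ U ∧ ∀ F : E n → E n, IsTangentField Ω Sig T F →
      HasCompactSupport F → tsupport F ⊆ U →
      |(∫ y in Ω, divergence F y) - ∫ y in Sig, inner ℝ (F y) (outerNormal Ω y) ∂μHE[n]| ≤
        ε * ∫ y in Sig, ‖F y‖ ∂μHE[n] := by
  have hzero : ∀ (U : Set (E n)) (F : E n → E n), (∀ y ∈ U, y ∉ Sig) → tsupport F ⊆ U →
      ∫ y in Ω, divergence F y = 0 →
      |(∫ y in Ω, divergence F y) - ∫ y in Sig, inner ℝ (F y) (outerNormal Ω y) ∂μHE[n]| ≤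
        ε * ∫ y in Sig, ‖F y‖ ∂μHE[n] := by
    intro U F hU hs h0
    have h1 : ∫ y in Sig, inner ℝ (F y) (outerNormal Ω y) ∂μHE[n] = 0 := by
      refine setIntegral_eq_zero_of_forall_eq_zero fun y hy => ?_
      rw [image_eq_zero_of_notMem_tsupport fun hh => hU y (hs hh) hy, inner_zero_left]
    rw [h0, h1, sub_zero, abs_zero]
    exact mul_nonneg hε.le (integral_nonneg fun y => norm_nonneg _)
  rcases h.mem_regularPart hx with hxΩ | hxS | hxT
  · refine ⟨Ω, h.isOpen, hxΩ, fun F hF hc hs => hzero Ω F (fun y hy hyS => ?_) hs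
      (setIntegral_divergence_eq_zero h.isOpen hF.contDiffOn hc hs)⟩
    have := h.sig_subset_frontier hyS
    rw [h.isOpen.frontier_eq] at this
    exact this.2 hy
  · obtain ⟨φ, hφ⟩ := h.sig_smooth x hxS
    obtain ⟨U, hU, hxU, hφU, hΩU, hgU, hfr, hdef⟩ := hφ.exists_nhds h.isOpen
    have hW : U ∩ (closure T)ᶜ ∈ 𝓝 x := Filter.inter_mem (hU.mem_nhds hxU)
      (isClosed_closure.isOpen_compl.mem_nhds (h.notMem_closure_t hxS))
    obtain ⟨ε', hε'1, hε'2⟩ := (((FlatChart.tendsto_error n).eventually (gt_mem_nhds hε)).and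
      (Ioo_mem_nhdsGT (show (0 : ℝ) < 1 / 2 by norm_num))).exists
    obtain ⟨v, a, ρ, hch, hball⟩ := hφ.exists_flatChart hW hε'2.1 hε'2.2
    have hCW := hch.cylinder_subset_ball.trans hball
    refine ⟨cylinder x v (ρ / 3), isOpen_cylinder _ _ _,
      mem_cylinder_self _ _ (by have := hch.ρ_pos; positivity), fun F hF hc hs => ?_⟩
    have hreg : closure Ω ∩ cylinder x v (ρ / 3) ⊆ regularPart Ω Sig T := fun y hy =>
      ⟨hy.1, fun hcor => (hCW hy.2).2 hcor.2⟩
    have hpiece : hch.piece = Sig ∩ cylinder x v (ρ / 3) := by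
      ext y
      constructor
      · rintro ⟨hyC, hy0⟩
        refine ⟨?_, hyC⟩
        rw [h.sig_eq]
        exact ⟨(hfr y (hCW hyC).1).2 hy0, (hCW hyC).2⟩
      · rintro ⟨hyS, hyC⟩
        exact ⟨hyC, (hfr y (hCW hyC).1).1 (h.sig_subset_frontier hyS)⟩
    have hmain := hch.abs_integral_divergence_sub_le h.isOpen (fun y hy => hΩU y (hCW hy).1)
      hF.contDiffOn hc hs (hF.continuousOn.mono hreg) hF.integrableOn_divergence
    have e1 : ∫ y in Sig, inner ℝ (F y) (outerNormal Ω y) ∂μHE[n] =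
        ∫ y in hch.piece, fderiv ℝ φ y (F y) / ‖fderiv ℝ φ y‖ ∂μHE[n] := by
      rw [hpiece, setIntegral_eq_of_subset_of_forall_sdiff_eq_zero h.measurableSet_sig
        (s := Sig ∩ cylinder x v (ρ / 3)) inter_subset_left]
      · refine setIntegral_congr_fun
          (h.measurableSet_sig.inter (isOpen_cylinder _ _ _).measurableSet) fun y hy => ?_
        exact (hdef y (hCW hy.2).1 (h.sig_subset_frontier hy.1)).inner_outerNormal _
      · rintro y ⟨hy, hy2⟩
        rw [image_eq_zero_of_notMem_tsupport fun hh => hy2 ⟨hy, hs hh⟩, inner_zero_left]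
    have e2 : ∫ y in Sig, ‖F y‖ ∂μHE[n] = ∫ y in hch.piece, ‖F y‖ ∂μHE[n] := by
      rw [hpiece, setIntegral_eq_of_subset_of_forall_sdiff_eq_zero h.measurableSet_sig
        (s := Sig ∩ cylinder x v (ρ / 3)) inter_subset_left]
      rintro y ⟨hy, hy2⟩
      rw [image_eq_zero_of_notMem_tsupport fun hh => hy2 ⟨hy, hs hh⟩, norm_zero]
    rw [e1, e2]
    exact hmain.trans (mul_le_mul_of_nonneg_right hε'1.le (integral_nonneg fun y => norm_nonneg _))
  · obtain ⟨ρ, hρ, hball, hSig⟩ := h.exists_ball_of_mem_t hxT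
    refine ⟨Metric.ball x ρ, Metric.isOpen_ball, Metric.mem_ball_self hρ, fun F hF hc hs =>
      hzero _ F (fun y hy hyS => hSig hy (subset_closure hyS)) hs
        (setIntegral_divergence_eq_zero_of_tangent h.isOpen Metric.isOpen_ball hball hF.contDiffOn
          hc hs (hF.continuousOn.mono fun y hy => ⟨hy.1, fun hcor => hSig hy.2 hcor.1⟩)
          hF.integrableOn_divergence fun y hy hy1 => ?_)⟩
    by_cases hyF : y ∈ tsupport F
    swap
    · rw [image_eq_zero_of_notMem_tsupport hyF, inner_zero_right]
    refine hF.inner_eq_zero y ?_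
    rw [h.t_eq]
    refine ⟨?_, hSig hy⟩
    rw [h.isOpen.frontier_eq]
    refine ⟨?_, fun hyΩ => by have := (hball y hy).1 hyΩ; linarith⟩
    have h1 : Filter.Tendsto (fun t : ℝ => t • y) (𝓝[<] 1) (𝓝 y) := by
      have : ContinuousAt (fun t : ℝ => t • y) 1 := by fun_prop
      have h := this.tendsto
      rw [one_smul] at h
      exact h.mono_left nhdsWithin_le_nhds
    refine mem_closure_of_tendsto h1 ?_
    have h2 : ∀ᶠ t : ℝ in 𝓝[<] 1, t ∈ Ioo (0 : ℝ) 1 := Ioo_mem_nhdsLT one_pos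
    filter_upwards [h1.eventually (Metric.isOpen_ball.mem_nhds hy), h2] with t ht ht2
    rw [hball _ ht, norm_smul, Real.norm_eq_abs, abs_of_pos ht2.1, hy1, mul_one]
    exact ht2.2

end IsHalfBallDomain

/-! ### Globalisation by partitions of unity -/

section

variable {Ω Sig T : Set (E n)}

lemma IsTangentField.smul (h : IsHalfBallDomain Ω Sig T) {F : E n → E n}
    (hF : IsTangentField Ω Sig T F) (hFi : IntegrableOn F Ω) {χ : E n → ℝ} (hχ : ContDiff ℝ 1 χ) :
    IsTangentField Ω Sig T (fun y => χ y • F y) ∧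
      IntegrableOn (fun y => fderiv ℝ χ y (F y)) Ω ∧
      IntegrableOn (fun y => χ y * divergence F y) Ω ∧
      ∀ y ∈ Ω, divergence (fun y => χ y • F y) y =
        fderiv ℝ χ y (F y) + χ y * divergence F y := by
  have hd : ∀ y ∈ Ω, divergence (fun y => χ y • F y) y =
      fderiv ℝ χ y (F y) + χ y * divergence F y := fun y hy =>
    divergence_smul (hχ.differentiable one_ne_zero y)
      ((hF.contDiffOn.contDiffAt (h.isOpen.mem_nhds hy)).differentiableAt one_ne_zero)
  have hcf : Continuous (fderiv ℝ χ) := hχ.continuous_fderiv one_ne_zero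
  obtain ⟨C1, hC1⟩ := h.isCompact_closure.exists_bound_of_continuousOn hcf.continuousOn
  obtain ⟨C2, hC2⟩ := h.isCompact_closure.exists_bound_of_continuousOn hχ.continuous.continuousOn
  have i1 : IntegrableOn (fun y => fderiv ℝ χ y (F y)) Ω := by
    refine Integrable.mono' (hFi.norm.const_mul C1) ?_ ?_
    · exact (hcf.continuousOn.clm_apply hF.contDiffOn.continuousOn).aestronglyMeasurable
        h.isOpen.measurableSet
    · refine (ae_restrict_iff' h.isOpen.measurableSet).2 (Filter.Eventually.of_forall fun y hy => ?_)
      exact ((fderiv ℝ χ y).le_opNorm _).trans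
        (mul_le_mul_of_nonneg_right (hC1 y (subset_closure hy)) (norm_nonneg _))
  have i2 : IntegrableOn (fun y => χ y * divergence F y) Ω := by
    refine Integrable.mono' (hF.integrableOn_divergence.norm.const_mul C2) ?_ ?_
    · exact hχ.continuous.aestronglyMeasurable.mul hF.integrableOn_divergence.aestronglyMeasurable
    · refine (ae_restrict_iff' h.isOpen.measurableSet).2 (Filter.Eventually.of_forall fun y hy => ?_)
      rw [norm_mul]
      exact mul_le_mul_of_nonneg_right (hC2 y (subset_closure hy)) (norm_nonneg _)
  refine ⟨⟨hχ.contDiffOn.smul hF.contDiffOn, hχ.continuous.continuousOn.smul hF.continuousOn, ?_,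
    fun y hy => ?_⟩, i1, i2, hd⟩
  · exact (i1.add i2).congr_fun (fun y hy => (hd y hy).symm) h.isOpen.measurableSet
  · rw [inner_smul_right, hF.inner_eq_zero y hy, mul_zero]

namespace IsHalfBallDomain

lemma regularPart_mem_nhdsWithin {x : E n} (hx : x ∈ regularPart Ω Sig T) :
    regularPart Ω Sig T ∈ 𝓝[closure Ω] x :=
  Filter.inter_mem self_mem_nhdsWithin
    (mem_nhdsWithin_of_mem_nhds ((isClosed_corner Sig T).isOpen_compl.mem_nhds hx.2))

/-- The divergence theorem for fields that vanish near the corner. -/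
theorem integral_divergence_of_vanishing (h : IsHalfBallDomain Ω Sig T) {F : E n → E n}
    (hF : IsTangentField Ω Sig T F) {V : Set (E n)} (hV : IsOpen V) (hcV : corner Sig T ⊆ V)
    (hFV : ∀ x ∈ V, F x = 0) :
    ∫ y in Ω, divergence F y = ∫ y in Sig, inner ℝ (F y) (outerNormal Ω y) ∂μHE[n] := by
  -- Vanishing near the corner makes F continuous on a compact set, hence bounded.
  have hFc : ContinuousOn F (closure Ω) := by
    intro x hx
    by_cases hxV : x ∈ V
    · have : F =ᶠ[𝓝 x] fun _ => 0 := by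
        filter_upwards [hV.mem_nhds hxV] with y hy using hFV y hy
      exact (continuousAt_const.congr this.symm).continuousWithinAt
    · have hxr : x ∈ regularPart Ω Sig T := ⟨hx, fun hc => hxV (hcV hc)⟩
      exact (hF.continuousOn x hxr).mono_of_mem_nhdsWithin (regularPart_mem_nhdsWithin hxr)
  obtain ⟨M, hM⟩ := h.isCompact_closure.exists_bound_of_continuousOn hFc
  have := h.isFiniteMeasure
  have := h.isFiniteMeasure_sig
  have hSc : Sig ⊆ closure Ω := h.sig_subset_frontier.trans frontier_subset_closure
  have hFi : IntegrableOn F Ω := by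
    refine Integrable.mono' (integrable_const M)
      ((hFc.mono subset_closure).aestronglyMeasurable h.isOpen.measurableSet) ?_
    exact (ae_restrict_iff' h.isOpen.measurableSet).2
      (Filter.Eventually.of_forall fun y hy => hM y (subset_closure hy))
  have hFS : IntegrableOn F Sig μHE[n] := by
    refine Integrable.mono' (integrable_const M)
      ((hFc.mono hSc).aestronglyMeasurable h.measurableSet_sig) ?_
    exact (ae_restrict_iff' h.measurableSet_sig).2
      (Filter.Eventually.of_forall fun y hy => hM y (hSc hy))
  have hFν : IntegrableOn (fun y => (inner ℝ (F y) (outerNormal Ω y) : ℝ)) Sig μHE[n] := by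
    refine Integrable.mono' hFS.norm (((hFc.mono hSc).inner (𝕜 := ℝ)
      h.continuousOn_outerNormal).aestronglyMeasurable h.measurableSet_sig) ?_
    refine (ae_restrict_iff' h.measurableSet_sig).2 (Filter.Eventually.of_forall fun y hy => ?_)
    refine (norm_inner_le_norm _ _).trans_eq ?_
    rw [h.norm_outerNormal hy, mul_one]
  set K : Set (E n) := closure Ω \ V with hK
  have hKc : IsCompact K := h.isCompact_closure.diff hV
  have hKr : K ⊆ regularPart Ω Sig T := fun x hx => ⟨hx.1, fun hc => hx.2 (hcV hc)⟩
  set I := ∫ y in Sig, ‖F y‖ ∂μHE[n] with hI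
  have hI0 : 0 ≤ I := integral_nonneg fun y => norm_nonneg _
  have key : ∀ ε > 0, |(∫ y in Ω, divergence F y) -
      ∫ y in Sig, inner ℝ (F y) (outerNormal Ω y) ∂μHE[n]| ≤ ε * I := by
    intro ε hε
    -- The sets are kept inside unit balls so that the members of the partition of unity have
    -- compact support.
    have hloc : ∀ x : E n, ∃ U : Set (E n), IsOpen U ∧ x ∈ U ∧ U ⊆ Metric.ball x 1 ∧
        (x ∈ K → ∀ G : E n → E n, IsTangentField Ω Sig T G →
          HasCompactSupport G → tsupport G ⊆ U →
          |(∫ y in Ω, divergence G y) - ∫ y in Sig, inner ℝ (G y) (outerNormal Ω y) ∂μHE[n]| ≤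
            ε * ∫ y in Sig, ‖G y‖ ∂μHE[n]) := by
      intro x
      by_cases hx : x ∈ K
      · obtain ⟨U, hU, hxU, hUG⟩ := h.exists_local_divergence_theorem (hKr hx) hε
        exact ⟨U ∩ Metric.ball x 1, hU.inter Metric.isOpen_ball,
          ⟨hxU, Metric.mem_ball_self one_pos⟩, inter_subset_right,
          fun _ G hG hc hs => hUG G hG hc (hs.trans inter_subset_left)⟩
      · exact ⟨Metric.ball x 1, Metric.isOpen_ball, Metric.mem_ball_self one_pos, subset_rfl,
          fun hh => absurd hh hx⟩
    choose U hUo hxU hUb hUG using hloc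
    obtain ⟨t, htK, hcov⟩ := hKc.elim_nhds_subcover U fun x _ => (hUo x).mem_nhds (hxU x)
    obtain ⟨f, hf⟩ := SmoothPartitionOfUnity.exists_isSubordinate (modelWithCornersSelf ℝ (E n))
      hKc.isClosed (fun i : t => U i) (fun i => hUo i) (by
        intro x hx
        obtain ⟨i, hi, hxi⟩ := mem_iUnion₂.1 (hcov hx)
        exact mem_iUnion.2 ⟨⟨i, hi⟩, hxi⟩)
    have hχ : ∀ i : t, ContDiff ℝ 1 (f i) := fun i => (f i).contMDiff.contDiff.of_le (by simp)
    have hχs : ∀ i : t, tsupport (f i) ⊆ U i := hf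
    have hχc : ∀ i : t, HasCompactSupport (f i) := fun i =>
      Metric.isCompact_of_isClosed_isBounded (isClosed_tsupport _)
        (Metric.isBounded_ball.subset ((hχs i).trans (hUb i)))
    set G : t → E n → E n := fun i y => f i y • F y with hG
    have hGt : ∀ i, IsTangentField Ω Sig T (G i) := fun i => (hF.smul h hFi (hχ i)).1
    have hsum1 : ∀ y ∈ K, ∑ i, f i y = 1 := fun y hy => by
      rw [← finsum_eq_sum_of_fintype]; exact f.sum_eq_one hy
    have hsum : ∀ y ∈ closure Ω, ∑ i, G i y = F y := by
      intro y hy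
      rw [hG, ← Finset.sum_smul]
      by_cases hyV : y ∈ V
      · rw [hFV y hyV, smul_zero]
      · rw [hsum1 y ⟨hy, hyV⟩, one_smul]
    have hdiv : ∫ y in Ω, divergence F y = ∑ i, ∫ y in Ω, divergence (G i) y := by
      rw [← integral_finsetSum _ fun i _ => (hGt i).integrableOn_divergence]
      refine setIntegral_congr_fun h.isOpen.measurableSet fun y hy => ?_
      have e1 : F =ᶠ[𝓝 y] fun z => ∑ i, G i z := by
        filter_upwards [h.isOpen.mem_nhds hy] with z hz using (hsum z (subset_closure hz)).symm
      have e2 : fderiv ℝ (fun z => ∑ i, G i z) y = ∑ i, fderiv ℝ (G i) y :=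
        fderiv_fun_sum fun i _ => ((hGt i).contDiffOn.contDiffAt
          (h.isOpen.mem_nhds hy)).differentiableAt one_ne_zero
      rw [divergence_congr e1]
      simp only [divergence]
      rw [e2, Finset.sum_comm]
      refine Finset.sum_congr rfl fun j _ => ?_
      simp
    have hχ0 : ∀ (i : t) y, 0 ≤ f i y := fun i y => f.nonneg i y
    have hχ1 : ∀ (i : t) y, f i y ≤ 1 := fun i y => f.le_one i y
    have hflux : ∫ y in Sig, inner ℝ (F y) (outerNormal Ω y) ∂μHE[n] =
        ∑ i, ∫ y in Sig, inner ℝ (G i y) (outerNormal Ω y) ∂μHE[n] := by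
      rw [← integral_finsetSum]
      · refine setIntegral_congr_fun h.measurableSet_sig fun y hy => ?_
        rw [← sum_inner, hsum y (hSc hy)]
      · intro i _
        simp only [hG, inner_smul_left, RCLike.conj_to_real]
        refine Integrable.mono' hFν.norm
          ((hχ i).continuous.aestronglyMeasurable.mul hFν.aestronglyMeasurable)
          (Filter.Eventually.of_forall fun y => ?_)
        rw [norm_mul, Real.norm_of_nonneg (hχ0 i y)]
        exact mul_le_of_le_one_left (norm_nonneg _) (hχ1 i y)
    have hGn : ∀ i, IntegrableOn (fun y => ‖G i y‖) Sig μHE[n] := by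
      intro i
      refine Integrable.norm (Integrable.mono' hFS.norm
        ((hχ i).continuous.aestronglyMeasurable.smul hFS.aestronglyMeasurable)
        (Filter.Eventually.of_forall fun y => ?_))
      rw [norm_smul, Real.norm_of_nonneg (hχ0 i y)]
      exact mul_le_of_le_one_left (norm_nonneg _) (hχ1 i y)
    -- No overlap factor appears: the functions f i are nonnegative and add up to 1 wherever F does
    -- not vanish, so the local errors total at most ε I.
    have hIsum : ∑ i, ∫ y in Sig, ‖G i y‖ ∂μHE[n] = I := by
      rw [← integral_finsetSum _ fun i _ => hGn i]
      refine setIntegral_congr_fun h.measurableSet_sig fun y hy => ?_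
      simp only [hG, norm_smul, Real.norm_of_nonneg (hχ0 _ y)]
      rw [← Finset.sum_mul]
      by_cases hyV : y ∈ V
      · rw [hFV y hyV, norm_zero, mul_zero]
      · rw [hsum1 y ⟨hSc hy, hyV⟩, one_mul]
    rw [hdiv, hflux, ← Finset.sum_sub_distrib, ← hIsum, Finset.mul_sum]
    refine (Finset.abs_sum_le_sum_abs _ _).trans (Finset.sum_le_sum fun i _ => ?_)
    refine hUG i (htK i i.2) (G i) (hGt i) ((hχc i).smul_right) ?_
    exact (tsupport_smul_subset_left _ _).trans (hχs i)
  by_contra hne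
  have hpos : 0 < |(∫ y in Ω, divergence F y) -
      ∫ y in Sig, inner ℝ (F y) (outerNormal Ω y) ∂μHE[n]| := abs_pos.2 (sub_ne_zero.2 hne)
  set A := |(∫ y in Ω, divergence F y) -
      ∫ y in Sig, inner ℝ (F y) (outerNormal Ω y) ∂μHE[n]| with hA
  have h1 := key (A / (2 * (I + 1))) (by positivity)
  have h2 : A / (2 * (I + 1)) * I = A * (I / (2 * (I + 1))) := by ring
  have h3 : I / (2 * (I + 1)) < 1 := by
    rw [div_lt_one (by positivity)]; linarith
  nlinarith

end IsHalfBallDomain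

/-! ### Cutoff functions near a set of codimension two -/

/-- There are cutoff functions that vanish near `K`, with gradient of size `k` supported in closed
sets of measure `O(1 / k²)` which shrink to a subset of `L`. -/
def HasCutoffs (L K : Set (E n)) : Prop :=
  ∃ (η : ℕ → E n → ℝ) (A : ℕ → Set (E n)) (C : ℝ), 0 ≤ C ∧
    (∀ k, ContDiff ℝ 1 (η k) ∧ (∀ x, η k x ∈ Icc (0 : ℝ) 1) ∧ IsClosed (A k) ∧
      volume (A k) ≤ ENNReal.ofReal (C / ((k : ℝ) + 1) ^ 2) ∧
      (∀ x, ‖fderiv ℝ (η k) x‖ ≤ C * (k + 1)) ∧ (∀ x ∉ A k, η k x = 1) ∧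
      ∃ V : Set (E n), IsOpen V ∧ K ⊆ V ∧ ∀ x ∈ V, η k x = 0) ∧
    ∀ x ∉ L, ∀ᶠ k in Filter.atTop, x ∉ A k

namespace HasCutoffs

variable {L K K' : Set (E n)}

lemma empty (L : Set (E n)) : HasCutoffs L ∅ := by
  refine ⟨fun _ _ => 1, fun _ => ∅, 0, le_rfl, fun k => ⟨contDiff_const, by simp, isClosed_empty,
    by simp, by simp, by simp, ∅, isOpen_empty, subset_rfl, by simp⟩, by simp⟩

lemma mono (h : HasCutoffs L K') (hK : K ⊆ K') : HasCutoffs L K := by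
  obtain ⟨η, A, C, hC, hk, hL⟩ := h
  refine ⟨η, A, C, hC, fun k => ?_, hL⟩
  obtain ⟨h1, h2, h3, h4, h5, h6, V, hV, hKV, h7⟩ := hk k
  exact ⟨h1, h2, h3, h4, h5, h6, V, hV, hK.trans hKV, h7⟩

/-- Multiply the cutoffs: the product vanishes near both sets, differs from 1 only on the union of
the exceptional sets, and the constants add. -/
lemma union (h : HasCutoffs L K) (h' : HasCutoffs L K') : HasCutoffs L (K ∪ K') := by
  obtain ⟨η, A, C, hC, hk, hL⟩ := h
  obtain ⟨η', A', C', hC', hk', hL'⟩ := h'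
  refine ⟨fun k x => η k x * η' k x, fun k => A k ∪ A' k, C + C', by positivity, fun k => ?_,
    fun x hx => ?_⟩
  · obtain ⟨h1, h2, h3, h4, h5, h6, V, hV, hKV, h7⟩ := hk k
    obtain ⟨h1', h2', h3', h4', h5', h6', V', hV', hKV', h7'⟩ := hk' k
    refine ⟨h1.mul h1', fun x => ⟨mul_nonneg (h2 x).1 (h2' x).1,
      mul_le_one₀ (h2 x).2 (h2' x).1 (h2' x).2⟩, h3.union h3', ?_, fun x => ?_, fun x hx => ?_,
      V ∪ V', hV.union hV', union_subset_union hKV hKV', ?_⟩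
    · refine (measure_union_le _ _).trans ((add_le_add h4 h4').trans_eq ?_)
      rw [← ENNReal.ofReal_add (by positivity) (by positivity), add_div]
    · have e1 : fderiv ℝ (fun x => η k x * η' k x) x =
          η k x • fderiv ℝ (η' k) x + η' k x • fderiv ℝ (η k) x :=
        fderiv_fun_mul (h1.differentiable one_ne_zero x) (h1'.differentiable one_ne_zero x)
      rw [e1]
      refine (norm_add_le _ _).trans ?_
      rw [norm_smul, norm_smul, Real.norm_of_nonneg (h2 x).1, Real.norm_of_nonneg (h2' x).1]
      have a1 := mul_le_of_le_one_left (norm_nonneg (fderiv ℝ (η' k) x)) (h2 x).2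
      have a2 := mul_le_of_le_one_left (norm_nonneg (fderiv ℝ (η k) x)) (h2' x).2
      have := h5 x
      have := h5' x
      linarith
    · simp only [mem_union, not_or] at hx
      change η k x * η' k x = 1
      rw [h6 x hx.1, h6' x hx.2, one_mul]
    · rintro x (hx | hx)
      · change η k x * η' k x = 0
        rw [h7 x hx, zero_mul]
      · change η k x * η' k x = 0
        rw [h7' x hx, mul_zero]
  · filter_upwards [hL x hx, hL' x hx] with k h1 h2
    simp [h1, h2]

end HasCutoffs

/-- The measure of a set with thin slices. -/
lemma volume_le_of_slices (P : Submodule ℝ (E n)) (x₀ : E n) {A : Set (E n)}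
    (hA : MeasurableSet A) {R r : ℝ} (hr : 0 ≤ r) (hAR : A ⊆ Metric.closedBall x₀ R)
    (hslice : ∀ x ∈ A, ∀ y ∈ A, x - y ∈ P → ‖x - y‖ ≤ r) :
    volume A ≤ ENNReal.ofReal (r ^ Module.finrank ℝ P) * volume (Metric.ball (0 : P) 1) *
      volume (Metric.closedBall (0 : Pᗮ) R) := by
  have hmp := P.measurePreserving_measurableEquivProd x₀
  rw [InnerProductSpace.euclideanHausdorffMeasure_eq_volume] at hmp
  rw [← hmp.symm.measure_preimage_equiv, Measure.volume_eq_prod, Measure.prod_apply_symm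
    ((P.measurableEquivProd x₀).symm.measurable hA)]
  have hpt : ∀ (y : P) (z : Pᗮ), (P.measurableEquivProd x₀).symm (y, z) = (y + z : E n) + x₀ :=
    fun y z => by simp
  calc ∫⁻ z : Pᗮ, volume ((fun y : P => (y, z)) ⁻¹' ((P.measurableEquivProd x₀).symm ⁻¹' A))
      ≤ ∫⁻ z : Pᗮ, (Metric.closedBall (0 : Pᗮ) R).indicator (fun _ =>
          ENNReal.ofReal (r ^ Module.finrank ℝ P) * volume (Metric.ball (0 : P) 1)) z := by
        refine lintegral_mono fun z => ?_
        set S := (fun y : P => (y, z)) ⁻¹' ((P.measurableEquivProd x₀).symm ⁻¹' A) with hS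
        rcases S.eq_empty_or_nonempty with he | ⟨y0, hy0⟩
        · simp only
          rw [he, measure_empty]; exact zero_le
        have hmem : ∀ y ∈ S, (y + z : E n) + x₀ ∈ A := by
          intro y hy
          rw [← hpt]; exact hy
        have hz : z ∈ Metric.closedBall (0 : Pᗮ) R := by
          have h1 := hAR (hmem y0 hy0)
          rw [mem_closedBall_iff_norm, add_sub_cancel_right] at h1
          have h2 : inner ℝ (y0 : E n) (z : E n) = 0 := Submodule.inner_right_of_mem_orthogonal
            y0.2 z.2
          have h3 := norm_add_sq_real (y0 : E n) (z : E n)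
          rw [h2] at h3
          rw [mem_closedBall_zero_iff]
          have h4 : ‖(z : E n)‖ ≤ ‖(y0 : E n) + z‖ := by
            refine abs_le_of_sq_le_sq' ?_ (norm_nonneg _) |>.2
            nlinarith [sq_nonneg ‖(y0 : E n)‖]
          exact h4.trans h1
        rw [indicator_of_mem hz]
        -- A nonempty slice lies in the ball of radius r about any of its points; by Pythagoras only
        -- heights z of norm at most R give nonempty slices.
        have hsub : S ⊆ Metric.closedBall y0 r := by
          intro y hy
          have h1 := hslice _ (hmem y hy) _ (hmem y0 hy0)
          have h2 : (y + z : E n) + x₀ - ((y0 + z : E n) + x₀) = ((y - y0 : P) : E n) := by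
            push_cast; abel
          rw [h2] at h1
          rw [mem_closedBall_iff_norm]
          exact h1 (y - y0).2
        refine (measure_mono hsub).trans ?_
        rw [Measure.addHaar_closedBall _ _ hr]
    _ = _ := by
        rw [lintegral_indicator_const measurableSet_closedBall]

end

/-! ### Cutoffs at the corner and the divergence theorem for square integrable fields -/

section

variable {Ω Sig T : Set (E n)}

/-- Use 1 − χ · β((k + 1)Φ) with bumps χ and β, where Φ is the local defining map. Its gradient is
O(k). On the plane P orthogonal to the kernel of dΦ(x₀) the differential is bounded below, so
translates of P cut {‖Φ‖ ≤ 2/(k + 1)} in sets of diameter O(1/k). As dim P = 2, the volume is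
O(1/k²). -/
lemma exists_hasCutoffs_nhds {L : Set (E n)} (hL : IsSubmanifoldOfCodim 2 L) {x₀ : E n}
    (hx₀ : x₀ ∈ L) : ∃ t ∈ 𝓝[L] x₀, HasCutoffs L t := by
  obtain ⟨U, Φ, hU, hxU, hΦ, hsurj, hLΦ⟩ := hL x₀ hx₀
  set f' := fderiv ℝ Φ x₀ with hf'
  set P : Submodule ℝ (E n) := (LinearMap.ker (f' : E n →ₗ[ℝ] EuclideanSpace ℝ (Fin 2)))ᗮ with hP
  have hfin : Module.finrank ℝ P = 2 := by
    have h1 := LinearMap.finrank_range_add_finrank_ker (f' : E n →ₗ[ℝ] EuclideanSpace ℝ (Fin 2))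
    have h2 := Submodule.finrank_add_finrank_orthogonal
      (LinearMap.ker (f' : E n →ₗ[ℝ] EuclideanSpace ℝ (Fin 2)))
    rw [LinearMap.range_eq_top.2 hsurj, finrank_top, finrank_euclideanSpace_fin] at h1
    rw [hP]
    omega
  -- the differential is injective on the normal space
  obtain ⟨c, hc, hcP⟩ : ∃ c > 0, ∀ w ∈ P, c * ‖w‖ ≤ ‖f' w‖ := by
    set g : P →ₗ[ℝ] EuclideanSpace ℝ (Fin 2) :=
      (f' : E n →ₗ[ℝ] EuclideanSpace ℝ (Fin 2)).comp P.subtype with hg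
    have hker : LinearMap.ker g = ⊥ := by
      rw [LinearMap.ker_eq_bot']
      intro w hw
      have h1 : (w : E n) ∈ LinearMap.ker (f' : E n →ₗ[ℝ] EuclideanSpace ℝ (Fin 2)) := hw
      have h2 := Submodule.inner_right_of_mem_orthogonal h1 w.2
      exact Subtype.ext (inner_self_eq_zero.1 h2)
    obtain ⟨K, hK, hanti⟩ := g.exists_antilipschitzWith hker
    refine ⟨(K : ℝ)⁻¹, inv_pos.2 hK, fun w hw => ?_⟩
    have h1 := hanti.le_mul_dist ⟨w, hw⟩ 0
    rw [map_zero, dist_zero_right, dist_zero_right] at h1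
    have hK' : (0 : ℝ) < K := hK
    rw [inv_mul_le_iff₀ hK']
    exact h1
  have hdc : ContinuousAt (fderiv ℝ Φ) x₀ :=
    (hΦ.continuousOn_fderiv_of_isOpen hU le_rfl).continuousAt (hU.mem_nhds hxU)
  have hnear : ∀ᶠ y in 𝓝 x₀, ‖fderiv ℝ Φ y - f'‖ < c / 2 := by
    have := hdc.eventually (Metric.ball_mem_nhds _ (half_pos hc))
    simpa [dist_eq_norm] using this
  obtain ⟨ρ, hρ, hball⟩ := Metric.mem_nhds_iff.1 (Filter.inter_mem (hU.mem_nhds hxU) hnear)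
  have hdiff : ∀ y ∈ Metric.ball x₀ ρ, DifferentiableAt ℝ Φ y := fun y hy =>
    (hΦ.contDiffAt (hU.mem_nhds (hball hy).1)).differentiableAt one_ne_zero
  have hinj : ∀ x ∈ Metric.ball x₀ ρ, ∀ y ∈ Metric.ball x₀ ρ, x - y ∈ P →
      c / 2 * ‖x - y‖ ≤ ‖Φ x - Φ y‖ := by
    intro x hx y hy hxy
    have h1 := (convex_ball x₀ ρ).norm_image_sub_le_of_norm_fderiv_le' (𝕜 := ℝ) hdiff
      (fun z hz => (hball hz).2.le) hy hx
    have h2 := hcP _ hxy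
    have h3 := norm_sub_norm_le (f' (x - y)) (Φ x - Φ y)
    rw [← norm_neg (f' (x - y) - (Φ x - Φ y)), neg_sub] at h3
    linarith
  set L1 := ‖f'‖ + c / 2 with hL1
  have hL10 : 0 ≤ L1 := by positivity
  have hfd : ∀ y ∈ Metric.ball x₀ ρ, ‖fderiv ℝ Φ y‖ ≤ L1 := by
    intro y hy
    have h1 := norm_sub_norm_le (fderiv ℝ Φ y) f'
    have h2 : ‖fderiv ℝ Φ y - f'‖ < c / 2 := (hball hy).2
    linarith
  let χ : ContDiffBump x₀ := ⟨ρ / 4, ρ / 2, by positivity, by linarith⟩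
  let β : ContDiffBump (0 : EuclideanSpace ℝ (Fin 2)) := ⟨1, 2, one_pos, one_lt_two⟩
  have hχd : ContDiff ℝ 1 χ := χ.contDiff
  have hβd : ContDiff ℝ 1 β := β.contDiff
  obtain ⟨Cχ, hCχ⟩ := χ.hasCompactSupport.fderiv (𝕜 := ℝ) |>.exists_bound_of_continuous
    (hχd.continuous_fderiv one_ne_zero)
  obtain ⟨Cβ, hCβ⟩ := β.hasCompactSupport.fderiv (𝕜 := ℝ) |>.exists_bound_of_continuous
    (hβd.continuous_fderiv one_ne_zero)
  have hCχ0 : 0 ≤ Cχ := (norm_nonneg _).trans (hCχ 0)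
  have hCβ0 : 0 ≤ Cβ := (norm_nonneg _).trans (hCβ 0)
  set A : ℕ → Set (E n) := fun k =>
    {x ∈ Metric.closedBall x₀ (ρ / 2) | ‖Φ x‖ ≤ 2 / ((k : ℝ) + 1)} with hA
  set η : ℕ → E n → ℝ := fun k x => 1 - χ x * β (((k : ℝ) + 1) • Φ x) with hη
  have hcb : Metric.closedBall x₀ (ρ / 2) ⊆ Metric.ball x₀ ρ :=
    Metric.closedBall_subset_ball (by linarith)
  have hAclosed : ∀ k, IsClosed (A k) := by
    intro k
    have h1 : ContinuousOn (fun x => ‖Φ x‖) (Metric.closedBall x₀ (ρ / 2)) :=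
      (hΦ.continuousOn.mono fun x hx => (hball (hcb hx)).1).norm
    exact h1.preimage_isClosed_of_isClosed Metric.isClosed_closedBall isClosed_Iic
  have hηA : ∀ k, ∀ x ∉ A k, η k x = 1 := by
    intro k x hx
    have hk : (0 : ℝ) < k + 1 := by positivity
    simp only [hη, sub_eq_self, mul_eq_zero]
    by_cases hxb : x ∈ Metric.closedBall x₀ (ρ / 2)
    · right
      apply β.zero_of_le_dist
      rw [dist_zero_right, norm_smul, Real.norm_of_nonneg hk.le]
      have : 2 / ((k : ℝ) + 1) < ‖Φ x‖ := not_le.1 fun hh => hx ⟨hxb, hh⟩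
      rw [div_lt_iff₀ hk] at this
      change (2 : ℝ) ≤ _
      linarith
    · left
      apply χ.zero_of_le_dist
      exact (not_le.1 hxb).le
  have hvol : ∀ k, volume (A k) ≤ ENNReal.ofReal ((8 / c / (k + 1)) ^ 2) *
      volume (Metric.ball (0 : P) 1) * volume (Metric.closedBall (0 : Pᗮ) (ρ / 2)) := by
    intro k
    have hk : (0 : ℝ) < k + 1 := by positivity
    rw [← hfin]
    refine volume_le_of_slices P x₀ (hAclosed k).measurableSet (by positivity)
      (fun x hx => hx.1) fun x hx y hy hxy => ?_
    have h1 := hinj x (hcb hx.1) y (hcb hy.1) hxy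
    have h2 := norm_sub_le (Φ x) (Φ y)
    have h3 := hx.2
    have h4 := hy.2
    have h5 : c / 2 * ‖x - y‖ ≤ 4 / ((k : ℝ) + 1) := by
      have : (4 : ℝ) / (k + 1) = 2 / (k + 1) + 2 / (k + 1) := by ring
      linarith
    calc ‖x - y‖ = 2 / c * (c / 2 * ‖x - y‖) := by field_simp
      _ ≤ 2 / c * (4 / ((k : ℝ) + 1)) := mul_le_mul_of_nonneg_left h5 (by positivity)
      _ = 8 / c / (k + 1) := by ring
  set m : ℝ := (volume (Metric.ball (0 : P) 1) * volume (Metric.closedBall (0 : Pᗮ) (ρ / 2))).toReal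
    with hm
  have hmfin : volume (Metric.ball (0 : P) 1) * volume (Metric.closedBall (0 : Pᗮ) (ρ / 2)) ≠ ⊤ :=
    ENNReal.mul_ne_top measure_ball_lt_top.ne measure_closedBall_lt_top.ne
  have hηc : ∀ k, ContDiff ℝ 1 (η k) := by
    intro k
    refine contDiff_iff_contDiffAt.2 fun x => ?_
    by_cases hx : x ∈ A k
    · have h1 : ContDiffAt ℝ 1 Φ x := hΦ.contDiffAt (hU.mem_nhds (hball (hcb hx.1)).1)
      exact contDiffAt_const.sub (hχd.contDiffAt.mul
        (ContDiffAt.comp (g := fun z => β z) x hβd.contDiffAt (h1.const_smul ((k : ℝ) + 1))))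
    · refine (contDiffAt_const (c := (1 : ℝ))).congr_of_eventuallyEq ?_
      filter_upwards [(hAclosed k).isOpen_compl.mem_nhds hx] with y hy using hηA k y hy
  -- One constant serves two bounds: (8/c)² m for the volume, Cχ + Cβ L1 for the gradient.
  refine ⟨L ∩ Metric.ball x₀ (ρ / 4), Filter.inter_mem self_mem_nhdsWithin
    (mem_nhdsWithin_of_mem_nhds (Metric.ball_mem_nhds _ (by positivity))), η, A,
    (8 / c) ^ 2 * m + (Cχ + Cβ * L1), by positivity, fun k => ⟨hηc k, fun x => ?_, hAclosed k, ?_,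
    fun x => ?_, hηA k, {x ∈ Metric.ball x₀ (ρ / 4) | ‖((k : ℝ) + 1) • Φ x‖ < 1}, ?_, ?_, ?_⟩, ?_⟩
  · have h1 := χ.nonneg (x := x)
    have h2 := χ.le_one (x := x)
    have h3 := β.nonneg (x := ((k : ℝ) + 1) • Φ x)
    have h4 := β.le_one (x := ((k : ℝ) + 1) • Φ x)
    have h5 := mul_nonneg h1 h3
    have h6 := mul_le_one₀ h2 h3 h4
    simp only [hη]
    constructor <;> linarith
  · refine (hvol k).trans ?_
    rw [mul_assoc, ← ENNReal.ofReal_toReal hmfin, ← ENNReal.ofReal_mul (by positivity)]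
    refine ENNReal.ofReal_le_ofReal ?_
    rw [← hm, div_pow, add_div, div_mul_eq_mul_div]
    have : 0 ≤ (Cχ + Cβ * L1) / ((k : ℝ) + 1) ^ 2 := by positivity
    linarith
  · have hk : (1 : ℝ) ≤ k + 1 := by
      have : (0 : ℝ) ≤ k := by positivity
      linarith
    have hk0 : (0 : ℝ) ≤ k + 1 := by linarith
    have hm0 : 0 ≤ m := ENNReal.toReal_nonneg
    by_cases hx : x ∈ A k
    swap
    · have : η k =ᶠ[𝓝 x] fun _ => 1 := by
        filter_upwards [(hAclosed k).isOpen_compl.mem_nhds hx] with y hy using hηA k y hy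
      rw [this.fderiv_eq]
      simp only [fderiv_fun_const, Pi.zero_apply, norm_zero]
      positivity
    have hxb : x ∈ Metric.ball x₀ ρ := hcb hx.1
    set z := ((k : ℝ) + 1) • Φ x with hz
    have h1 : HasFDerivAt (fun x => β (((k : ℝ) + 1) • Φ x))
        ((fderiv ℝ β z).comp (((k : ℝ) + 1) • fderiv ℝ Φ x)) x :=
      HasFDerivAt.comp (g := fun z => β z) x (hβd.differentiable one_ne_zero z).hasFDerivAt
        ((hdiff x hxb).hasFDerivAt.const_smul ((k : ℝ) + 1))
    have h2 := ((hχd.differentiable one_ne_zero x).hasFDerivAt.mul h1).const_sub 1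
    have h3 : fderiv ℝ (η k) x = -(χ x • (fderiv ℝ β z).comp (((k : ℝ) + 1) • fderiv ℝ Φ x) +
        β z • fderiv ℝ χ x) := h2.fderiv
    rw [h3, norm_neg]
    refine (norm_add_le _ _).trans ?_
    rw [norm_smul, norm_smul, Real.norm_of_nonneg χ.nonneg, Real.norm_of_nonneg β.nonneg]
    have a1 : ‖(fderiv ℝ β z).comp (((k : ℝ) + 1) • fderiv ℝ Φ x)‖ ≤ Cβ * ((k + 1) * L1) := by
      refine (ContinuousLinearMap.opNorm_comp_le _ _).trans ?_
      rw [norm_smul, Real.norm_of_nonneg hk0]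
      exact mul_le_mul (hCβ z) (mul_le_mul_of_nonneg_left (hfd x hxb) hk0) (by positivity) hCβ0
    have a2 : χ x * ‖(fderiv ℝ β z).comp (((k : ℝ) + 1) • fderiv ℝ Φ x)‖ ≤ Cβ * ((k + 1) * L1) :=
      (mul_le_of_le_one_left (norm_nonneg _) χ.le_one).trans a1
    have a3 : β z * ‖fderiv ℝ χ x‖ ≤ Cχ :=
      (mul_le_of_le_one_left (norm_nonneg _) β.le_one).trans (hCχ x)
    have a4 : Cχ ≤ Cχ * (k + 1) := le_mul_of_one_le_right hCχ0 hk
    have a5 : 0 ≤ (8 / c) ^ 2 * m * (k + 1) := by positivity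
    nlinarith
  · have h1 : ContinuousOn (fun x => ‖((k : ℝ) + 1) • Φ x‖) (Metric.ball x₀ (ρ / 4)) :=
      ((hΦ.continuousOn.mono fun x hx => (hball (Metric.ball_subset_ball (by linarith)
        hx)).1).const_smul ((k : ℝ) + 1)).norm
    exact h1.isOpen_inter_preimage Metric.isOpen_ball isOpen_Iio
  · rintro x ⟨hxL, hxb⟩
    refine ⟨hxb, ?_⟩
    rw [(hLΦ x (hball (Metric.ball_subset_ball (by linarith) hxb)).1).1 hxL, smul_zero, norm_zero]
    exact one_pos
  · rintro x ⟨hxb, hx1⟩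
    have e1 : χ x = 1 := χ.one_of_mem_closedBall (Metric.ball_subset_closedBall hxb)
    have e2 : β (((k : ℝ) + 1) • Φ x) = 1 := β.one_of_mem_closedBall (by
      rw [mem_closedBall_zero_iff]; exact hx1.le)
    simp only [hη, e1, e2]
    norm_num
  · intro x hx
    by_cases hxb : x ∈ Metric.closedBall x₀ (ρ / 2)
    · have h0 : 0 < ‖Φ x‖ := norm_pos_iff.2 fun h0 => hx ((hLΦ x (hball (hcb hxb)).1).2 h0)
      have hlim : Filter.Tendsto (fun k : ℕ => 2 / ((k : ℝ) + 1)) Filter.atTop (𝓝 0) := by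
        have := (tendsto_one_div_add_atTop_nhds_zero_nat (𝕜 := ℝ)).const_mul 2
        simpa [div_eq_mul_inv] using this
      filter_upwards [hlim.eventually (gt_mem_nhds h0)] with k hk hxA
      exact absurd hxA.2 (not_le.2 hk)
    · exact Filter.Eventually.of_forall fun k hxA => hxb hxA.1

/-- Compactness passes from local pieces to all of L. Keeping L fixed while the set K grows lets the
shrinking condition survive unions. -/
lemma hasCutoffs_of_isCompact {L : Set (E n)} (hL : IsSubmanifoldOfCodim 2 L) (hc : IsCompact L) :
    HasCutoffs L L :=
  hc.induction_on (p := HasCutoffs L) (HasCutoffs.empty L) (fun _ _ hst ht => ht.mono hst)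
    (fun _ _ hs ht => hs.union ht) fun _ hx => exists_hasCutoffs_nhds hL hx

/-- The divergence theorem for square integrable fields on a domain with a corner of
codimension two. -/
theorem IsHalfBallDomain.integral_divergence (h : IsHalfBallDomain Ω Sig T) {F : E n → E n}
    (hF : IsTangentField Ω Sig T F) (hF2 : MemLp F 2 (volume.restrict Ω))
    (hFν : IntegrableOn (fun y => (inner ℝ (F y) (outerNormal Ω y) : ℝ)) Sig μHE[n]) :
    ∫ y in Ω, divergence F y = ∫ y in Sig, inner ℝ (F y) (outerNormal Ω y) ∂μHE[n] := by
  have := h.isFiniteMeasure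
  have hcor : IsCompact (corner Sig T) := h.isCompact_closure.of_isClosed_subset
    (IsHalfBallDomain.isClosed_corner Sig T)
    (h.corner_subset_frontier.trans frontier_subset_closure)
  obtain ⟨η, A, C, hC, hk, hlim⟩ := hasCutoffs_of_isCompact h.corner_submanifold hcor
  choose hηc hη01 hA hvol hgrad hηA V hV hcV hηV using hk
  have hFi : IntegrableOn F Ω := hF2.integrable (by norm_num)
  have hFsq : IntegrableOn (fun y => ‖F y‖ ^ 2) Ω := (memLp_two_iff_integrable_sq_norm
    hF2.aestronglyMeasurable).1 hF2
  have hη1 : ∀ x ∉ corner Sig T, Filter.Tendsto (fun k => η k x) Filter.atTop (𝓝 1) := by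
    intro x hx
    refine tendsto_const_nhds.congr' ?_
    filter_upwards [hlim x hx] with k hk using (hηA k x hk).symm
  have hsm := fun k => hF.smul h hFi (hηc k)
  have hstage : ∀ k, (∫ y in Ω, fderiv ℝ (η k) y (F y)) + ∫ y in Ω, η k y * divergence F y =
      ∫ y in Sig, η k y * inner ℝ (F y) (outerNormal Ω y) ∂μHE[n] := by
    intro k
    have h1 := h.integral_divergence_of_vanishing (hsm k).1 (hV k) (hcV k) fun x hx => by
      rw [hηV k x hx, zero_smul]
    rw [← integral_add (hsm k).2.1 (hsm k).2.2.1]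
    simp only [inner_smul_left, RCLike.conj_to_real] at h1
    rw [← h1]
    exact setIntegral_congr_fun h.isOpen.measurableSet fun y hy => ((hsm k).2.2.2 y hy).symm
  have hbound : ∀ k x (r : ℝ), ‖η k x * r‖ ≤ ‖r‖ := fun k x r => by
    rw [norm_mul, Real.norm_of_nonneg (hη01 k x).1]
    exact mul_le_of_le_one_left (norm_nonneg _) (hη01 k x).2
  have hl1 : Filter.Tendsto (fun k => ∫ y in Ω, η k y * divergence F y) Filter.atTop
      (𝓝 (∫ y in Ω, divergence F y)) := by
    refine tendsto_integral_of_dominated_convergence (fun y => ‖divergence F y‖)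
      (fun k => (hsm k).2.2.1.aestronglyMeasurable) hF.integrableOn_divergence.norm
      (fun k => Filter.Eventually.of_forall fun y => hbound k y _) ?_
    refine (ae_restrict_iff' h.isOpen.measurableSet).2 (Filter.Eventually.of_forall fun y hy => ?_)
    simpa using (hη1 y (h.notMem_corner hy)).mul_const (divergence F y)
  have hl2 : Filter.Tendsto (fun k => ∫ y in Sig, η k y * inner ℝ (F y) (outerNormal Ω y) ∂μHE[n])
      Filter.atTop (𝓝 (∫ y in Sig, inner ℝ (F y) (outerNormal Ω y) ∂μHE[n])) := by
    refine tendsto_integral_of_dominated_convergence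
      (fun y => ‖(inner ℝ (F y) (outerNormal Ω y) : ℝ)‖)
      (fun k => (hηc k).continuous.aestronglyMeasurable.mul hFν.aestronglyMeasurable) hFν.norm
      (fun k => Filter.Eventually.of_forall fun y => hbound k y _) ?_
    refine (ae_restrict_iff' h.measurableSet_sig).2 (Filter.Eventually.of_forall fun y hy => ?_)
    simpa using (hη1 y (h.sig_subset_regularPart hy).2).mul_const
      (inner ℝ (F y) (outerNormal Ω y) : ℝ)
  have hsmall : Filter.Tendsto (fun k => ∫ y in Ω, (A k).indicator (fun y => ‖F y‖ ^ 2) y)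
      Filter.atTop (𝓝 0) := by
    have := tendsto_integral_of_dominated_convergence (μ := volume.restrict Ω)
      (F := fun k y => (A k).indicator (fun y => ‖F y‖ ^ 2) y) (f := fun _ => 0)
      (fun y => ‖F y‖ ^ 2)
      (fun k => hFsq.aestronglyMeasurable.indicator (hA k).measurableSet) hFsq
      (fun k => Filter.Eventually.of_forall fun y => by
        rw [Real.norm_of_nonneg (indicator_nonneg (fun _ _ => by positivity) y)]
        exact indicator_le_self' (fun _ _ => by positivity) y) ?_
    · simpa using this
    · refine (ae_restrict_iff' h.isOpen.measurableSet).2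
        (Filter.Eventually.of_forall fun y hy => tendsto_const_nhds.congr' ?_)
      filter_upwards [hlim y (h.notMem_corner hy)] with k hk
      rw [indicator_of_notMem hk]
  -- On A k, Young's inequality splits C(k + 1)‖F‖ into Cδ(k + 1)² and (C/δ)‖F‖². The volume bound
  -- turns the first into C²δ; the second tends to zero since the sets A k eventually leave every
  -- point of Ω.
  have hl3 : Filter.Tendsto (fun k => ∫ y in Ω, fderiv ℝ (η k) y (F y)) Filter.atTop (𝓝 0) := by
    have hest : ∀ (δ : ℝ), 0 < δ → ∀ k, |∫ y in Ω, fderiv ℝ (η k) y (F y)| ≤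
        C ^ 2 * δ + C / δ * ∫ y in Ω, (A k).indicator (fun y => ‖F y‖ ^ 2) y := by
      intro δ hδ k
      have hk0 : (0 : ℝ) < k + 1 := by positivity
      have hAfin : volume (A k) ≠ ⊤ := ne_top_of_le_ne_top ENNReal.ofReal_ne_top (hvol k)
      have hi1 : IntegrableOn ((A k).indicator fun _ => C * δ * ((k : ℝ) + 1) ^ 2) Ω :=
        ((integrable_indicator_iff (hA k).measurableSet).2 (integrableOn_const hAfin)).integrableOn
      have hi2 : IntegrableOn (fun y => C / δ * (A k).indicator (fun y => ‖F y‖ ^ 2) y) Ω :=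
        Integrable.const_mul (hFsq.indicator (hA k).measurableSet) _
      have hpt : ∀ y, ‖fderiv ℝ (η k) y (F y)‖ ≤
          (A k).indicator (fun _ => C * δ * ((k : ℝ) + 1) ^ 2) y +
            C / δ * (A k).indicator (fun y => ‖F y‖ ^ 2) y := by
        intro y
        by_cases hy : y ∈ A k
        · rw [indicator_of_mem hy, indicator_of_mem hy]
          refine ((fderiv ℝ (η k) y).le_opNorm _).trans ?_
          refine (mul_le_mul_of_nonneg_right (hgrad k y) (norm_nonneg _)).trans ?_
          have h1 : ((k : ℝ) + 1) * ‖F y‖ ≤ δ * (k + 1) ^ 2 + ‖F y‖ ^ 2 / δ := by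
            rw [← sub_nonneg]
            have : δ * ((k : ℝ) + 1) ^ 2 + ‖F y‖ ^ 2 / δ - (k + 1) * ‖F y‖ =
                ((δ * (k + 1) - ‖F y‖ / 2) ^ 2 + 3 / 4 * ‖F y‖ ^ 2) / δ := by
              field_simp; ring
            rw [this]; positivity
          calc C * (k + 1) * ‖F y‖ = C * ((k + 1) * ‖F y‖) := by ring
            _ ≤ C * (δ * (k + 1) ^ 2 + ‖F y‖ ^ 2 / δ) := mul_le_mul_of_nonneg_left h1 hC
            _ = _ := by ring
        · have : η k =ᶠ[𝓝 y] fun _ => 1 := by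
            filter_upwards [(hA k).isOpen_compl.mem_nhds hy] with z hz using hηA k z hz
          rw [this.fderiv_eq, indicator_of_notMem hy, indicator_of_notMem hy]
          simp
      calc |∫ y in Ω, fderiv ℝ (η k) y (F y)|
          ≤ ∫ y in Ω, ((A k).indicator (fun _ => C * δ * ((k : ℝ) + 1) ^ 2) y +
            C / δ * (A k).indicator (fun y => ‖F y‖ ^ 2) y) :=
            norm_integral_le_of_norm_le (hi1.add hi2) (Filter.Eventually.of_forall hpt)
        _ = (∫ y in Ω, (A k).indicator (fun _ => C * δ * ((k : ℝ) + 1) ^ 2) y) +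
            C / δ * ∫ y in Ω, (A k).indicator (fun y => ‖F y‖ ^ 2) y := by
            rw [integral_add hi1 hi2, integral_const_mul]
        _ ≤ _ := by
            refine add_le_add ?_ le_rfl
            calc ∫ y in Ω, (A k).indicator (fun _ => C * δ * ((k : ℝ) + 1) ^ 2) y
                ≤ ∫ y, (A k).indicator (fun _ => C * δ * ((k : ℝ) + 1) ^ 2) y :=
                  setIntegral_le_integral ((integrable_indicator_iff (hA k).measurableSet).2
                    (integrableOn_const hAfin)) (Filter.Eventually.of_forall fun y =>
                      indicator_nonneg (fun _ _ => by positivity) y)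
              _ = volume.real (A k) * (C * δ * ((k : ℝ) + 1) ^ 2) := by
                  rw [integral_indicator_const _ (hA k).measurableSet, smul_eq_mul]
              _ ≤ C / ((k : ℝ) + 1) ^ 2 * (C * δ * ((k : ℝ) + 1) ^ 2) := by
                  refine mul_le_mul_of_nonneg_right ?_ (by positivity)
                  exact ENNReal.toReal_le_of_le_ofReal (by positivity) (hvol k)
              _ = C ^ 2 * δ := by field_simp
    rw [Metric.tendsto_atTop']
    intro ε hε
    set δ := ε / (2 * (C ^ 2 + 1)) with hδ
    have hδ0 : 0 < δ := by positivity
    have h2 := hsmall.const_mul (C / δ)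
    rw [mul_zero] at h2
    obtain ⟨k0, hk0⟩ := Filter.eventually_atTop.1 (h2.eventually (gt_mem_nhds (half_pos hε)))
    refine ⟨k0, fun k hk => ?_⟩
    rw [dist_zero_right, Real.norm_eq_abs]
    have h3 := hest δ hδ0 k
    have h4 := hk0 k hk.le
    have h5 : C ^ 2 * δ ≤ ε / 2 := by
      rw [hδ, mul_div_assoc', div_le_div_iff₀ (by positivity) two_pos]
      nlinarith [sq_nonneg C]
    linarith
  have hsum := hl3.add hl1
  rw [zero_add] at hsum
  exact tendsto_nhds_unique (hsum.congr hstage) hl2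

end

/-! ### Tangent directions at smooth boundary points -/

namespace IsDefiningFunction

variable {Ω : Set (E n)} {x : E n} {φ : E n → ℝ}

lemma hasDerivAt_line (h : IsDefiningFunction Ω x φ) (v : E n) :
    HasDerivAt (fun t : ℝ => φ (x + t • v)) (fderiv ℝ φ x v) 0 := by
  have h1 : HasFDerivAt φ (fderiv ℝ φ x) (x + (0 : ℝ) • v) := by
    simpa using h.hasGradientAt.differentiableAt.hasFDerivAt
  have h2 : HasDerivAt (fun t : ℝ => x + t • v) v 0 := by
    simpa using ((hasDerivAt_id (0 : ℝ)).smul_const v).const_add x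
  exact h1.comp_hasDerivAt (0 : ℝ) h2

lemma eventually_neg (h : IsDefiningFunction Ω x φ) {v : E n} (hv : fderiv ℝ φ x v < 0) :
    ∀ᶠ t : ℝ in 𝓝[>] 0, φ (x + t • v) < 0 := by
  have hs := (hasDerivAt_iff_tendsto_slope.1 (h.hasDerivAt_line v)).mono_left
    (nhdsWithin_mono (0 : ℝ) (s := Ioi 0) (t := {0}ᶜ) (fun t ht => (ne_of_gt ht)))
  filter_upwards [hs.eventually (gt_mem_nhds hv), self_mem_nhdsWithin] with t ht ht0
  have ht0 : (0 : ℝ) < t := ht0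
  simp only [slope_def_field, zero_smul, sub_zero, add_zero, h.1] at ht
  by_contra! hh
  exact absurd ht (not_lt.2 (div_nonneg hh ht0.le))

lemma eventually_pos (h : IsDefiningFunction Ω x φ) {v : E n} (hv : 0 < fderiv ℝ φ x v) :
    ∀ᶠ t : ℝ in 𝓝[>] 0, 0 < φ (x + t • v) := by
  have hs := (hasDerivAt_iff_tendsto_slope.1 (h.hasDerivAt_line v)).mono_left
    (nhdsWithin_mono (0 : ℝ) (s := Ioi 0) (t := {0}ᶜ) (fun t ht => (ne_of_gt ht)))
  filter_upwards [hs.eventually (lt_mem_nhds hv), self_mem_nhdsWithin] with t ht ht0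
  have ht0 : (0 : ℝ) < t := ht0
  simp only [slope_def_field, zero_smul, sub_zero, add_zero, h.1] at ht
  by_contra! hh
  exact absurd ht (not_lt.2 (div_nonpos_of_nonpos_of_nonneg hh ht0.le))

/-- The tangent cone contains the open half-space of inward directions, which spans. Derivatives
within the closure are therefore determined up to smooth boundary points. -/
lemma uniqueDiffWithinAt (hΩ : IsOpen Ω) (h : IsDefiningFunction Ω x φ) :
    UniqueDiffWithinAt ℝ Ω x := by
  have hsub : {v | fderiv ℝ φ x v < 0} ⊆ tangentConeAt ℝ Ω x := by
    intro v hv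
    obtain ⟨U, hU, hxU, -, hUΩ, -⟩ := h.exists_nhds hΩ
    refine mem_tangentConeAt_of_add_smul_mem (l := 𝓝[>] (0 : ℝ)) (c := fun t => t)
      (Filter.tendsto_id'.mpr (nhdsGT_le_nhdsNE 0)) ?_
    have hc : Filter.Tendsto (fun t : ℝ => x + t • v) (𝓝[>] 0) (𝓝 x) := by
      have : ContinuousAt (fun t : ℝ => x + t • v) 0 := by fun_prop
      have h := this.tendsto
      simp only [zero_smul, add_zero] at h
      exact h.mono_left nhdsWithin_le_nhds
    filter_upwards [h.eventually_neg hv, hc.eventually (hU.mem_nhds hxU)] with t ht htU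
    exact (hUΩ _ htU).2 ht
  have hopen : IsOpen {v | fderiv ℝ φ x v < 0} :=
    isOpen_lt (fderiv ℝ φ x).continuous continuous_const
  have hne : -gradient φ x ∈ {v | fderiv ℝ φ x v < 0} := by
    rw [mem_ofPred_eq, fderiv_eq_inner_gradient, inner_neg_right, real_inner_self_eq_norm_sq]
    have : 0 < ‖gradient φ x‖ := norm_pos_iff.2 h.2.1
    nlinarith
  have hfr : x ∈ frontier Ω := by
    obtain ⟨U, hU, hxU, -, -, -, hfr, -⟩ := h.exists_nhds hΩ
    exact (hfr x hxU).2 h.1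
  refine ⟨?_, frontier_subset_closure hfr⟩
  have htop : Submodule.span ℝ (tangentConeAt ℝ Ω x) = ⊤ :=
    (Submodule.span ℝ (tangentConeAt ℝ Ω x)).eq_top_of_nonempty_interior'
      ⟨_, interior_mono (hsub.trans Submodule.subset_span) (hopen.subset_interior_iff.2
        Subset.rfl hne)⟩
  rw [htop]
  exact dense_univ

/-- A function which vanishes on the boundary has vanishing tangential derivatives there. -/
lemma apply_eq_zero_of_tangent {G : Type*} [NormedAddCommGroup G] [NormedSpace ℝ G]
    (hΩ : IsOpen Ω) (h : IsDefiningFunction Ω x φ) {f : E n → G} {f' : E n →L[ℝ] G} {s W : Set (E n)}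
    (hf : HasFDerivWithinAt f f' s x) (hW : W ∈ 𝓝 x) (hWs : W ∩ frontier Ω ⊆ s)
    (h0 : ∀ y ∈ W ∩ frontier Ω, f y = 0) {v : E n} (hv : fderiv ℝ φ x v = 0) : f' v = 0 := by
  obtain ⟨U, hU, hxU, hφU, -, -, hfr, -⟩ := h.exists_nhds hΩ
  set g := gradient φ x with hg
  have hg0 : 0 < ‖g‖ := norm_pos_iff.2 h.2.1
  have hx0 : f x = 0 := h0 x ⟨mem_of_mem_nhds hW, (hfr x hxU).2 h.1⟩
  -- φ is positive along v + εg and negative along v − εg, so for small t an intermediate direction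
  -- v + a g leads to a boundary point x + t(v + a g). There f vanishes, and differentiability of f
  -- at x bounds f' on that direction.
  have key : ∀ ε > 0, ∃ a : ℝ, |a| ≤ ε ∧ ‖f' (v + a • g)‖ ≤ ε * ‖v + a • g‖ := by
    intro ε hε
    have hval : ∀ b : ℝ, fderiv ℝ φ x (v + b • g) = b * ‖g‖ ^ 2 := fun b => by
      rw [map_add, hv, zero_add, map_smul, fderiv_eq_inner_gradient, real_inner_self_eq_norm_sq,
        smul_eq_mul]
    have e1 := h.eventually_pos (v := v + ε • g) (by rw [hval]; positivity)
    have e2 := h.eventually_neg (v := v + (-ε) • g) (by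
      rw [hval]
      have : 0 < ε * ‖g‖ ^ 2 := by positivity
      linarith)
    have e3 := hf.isLittleO.def hε
    rw [eventually_nhdsWithin_iff] at e3
    obtain ⟨r, hr, hball⟩ := Metric.mem_nhds_iff.1
      (Filter.inter_mem e3 (Filter.inter_mem hW (hU.mem_nhds hxU)))
    have e4 : ∀ᶠ t : ℝ in 𝓝[>] 0, t ∈ Ioo 0 (r / (‖v‖ + ε * ‖g‖ + 1)) :=
      Ioo_mem_nhdsGT (by positivity)
    obtain ⟨t, ht1, ht2, ht0, ht3⟩ := (e1.and (e2.and e4)).exists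
    rw [lt_div_iff₀ (by positivity)] at ht3
    have hin : ∀ b ∈ Icc (-ε) ε, x + t • (v + b • g) ∈ Metric.ball x r := by
      intro b hb
      rw [Metric.mem_ball, dist_eq_norm, add_sub_cancel_left, norm_smul, Real.norm_eq_abs,
        abs_of_pos ht0]
      refine lt_of_le_of_lt (mul_le_mul_of_nonneg_left ?_ ht0.le) ht3
      have h1 : ‖b • g‖ ≤ ε * ‖g‖ := by
        rw [norm_smul, Real.norm_eq_abs]
        exact mul_le_mul_of_nonneg_right (abs_le.2 hb) hg0.le
      linarith [norm_add_le v (b • g)]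
    have hcont : ContinuousOn (fun b : ℝ => φ (x + t • (v + b • g))) (Icc (-ε) ε) :=
      hφU.continuousOn.comp (by fun_prop) fun b hb => (hball (hin b hb)).2.2
    obtain ⟨a, ha, haz⟩ := intermediate_value_Icc (by linarith : -ε ≤ ε) hcont ⟨ht2.le, ht1.le⟩
    refine ⟨a, abs_le.2 ha, ?_⟩
    have hm := hball (hin a ha)
    have hmf : x + t • (v + a • g) ∈ frontier Ω := (hfr _ hm.2.2).2 haz
    have h5 := hm.1 (hWs ⟨hm.2.1, hmf⟩)
    rw [h0 _ ⟨hm.2.1, hmf⟩, hx0, add_sub_cancel_left, map_smul, sub_zero, zero_sub, norm_neg,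
      norm_smul, norm_smul, Real.norm_eq_abs, abs_of_pos ht0] at h5
    have : t * ‖f' (v + a • g)‖ ≤ t * (ε * ‖v + a • g‖) := by linarith
    exact le_of_mul_le_mul_left this ht0
  choose a ha1 ha2 using fun k : ℕ => key (1 / ((k : ℝ) + 1)) (by positivity)
  have hlim := tendsto_one_div_add_atTop_nhds_zero_nat (𝕜 := ℝ)
  have ha : Filter.Tendsto a Filter.atTop (𝓝 0) :=
    squeeze_zero_norm ha1 hlim
  have hd : Filter.Tendsto (fun k => v + a k • g) Filter.atTop (𝓝 v) := by
    simpa using (ha.smul_const g).const_add v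
  have h1 := ((f'.continuous.tendsto v).comp hd).norm
  have h2 := hlim.mul hd.norm
  rw [zero_mul] at h2
  exact norm_le_zero_iff.1 (le_of_tendsto_of_tendsto' h1 h2 ha2)

end IsDefiningFunction

/-! ### Tangential derivatives along the two boundary portions -/

namespace IsHalfBallDomain

variable {Ω Sig T : Set (E n)}

lemma uniqueDiffOn_regularPart (h : IsHalfBallDomain Ω Sig T) :
    UniqueDiffOn ℝ (regularPart Ω Sig T) := by
  intro x hx
  have key : UniqueDiffWithinAt ℝ Ω x := by
    rcases h.mem_regularPart hx with hx | hx | hx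
    · exact h.isOpen.uniqueDiffWithinAt hx
    · obtain ⟨φ, hφ⟩ := h.sig_smooth x hx
      exact hφ.uniqueDiffWithinAt h.isOpen
    · exact (h.isDefiningFunction_of_mem_t hx).1.uniqueDiffWithinAt h.isOpen
  exact key.mono h.subset_regularPart

/-- A function which vanishes on `Sig` has vanishing tangential derivatives there. -/
lemma apply_eq_zero_of_mem_sig (h : IsHalfBallDomain Ω Sig T) {G : Type*} [NormedAddCommGroup G]
    [NormedSpace ℝ G] {f : E n → G} {f' : E n →L[ℝ] G} {x : E n} (hx : x ∈ Sig)
    (hf : HasFDerivWithinAt f f' (regularPart Ω Sig T) x) (h0 : ∀ y ∈ Sig, f y = 0) {v : E n}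
    (hv : inner ℝ v (outerNormal Ω x) = 0) : f' v = 0 := by
  obtain ⟨φ, hφ⟩ := h.sig_smooth x hx
  have hW : (closure T)ᶜ ∩ frontier Ω ⊆ Sig := by
    rw [h.sig_eq]; exact fun y hy => ⟨hy.2, hy.1⟩
  refine hφ.apply_eq_zero_of_tangent h.isOpen hf
    (isClosed_closure.isOpen_compl.mem_nhds (h.notMem_closure_t hx))
    (hW.trans h.sig_subset_regularPart) (fun y hy => h0 y (hW hy)) ?_
  rw [hφ.inner_outerNormal, div_eq_zero_iff] at hv
  refine hv.resolve_right ?_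
  rw [← norm_gradient]
  exact norm_ne_zero_iff.2 hφ.2.1

/-- A function which vanishes on `T` has vanishing tangential derivatives there. -/
lemma apply_eq_zero_of_mem_t (h : IsHalfBallDomain Ω Sig T) {G : Type*} [NormedAddCommGroup G]
    [NormedSpace ℝ G] {f : E n → G} {f' : E n →L[ℝ] G} {x : E n} (hx : x ∈ T)
    (hf : HasFDerivWithinAt f f' (regularPart Ω Sig T) x) (h0 : ∀ y ∈ T, f y = 0) {v : E n}
    (hv : inner ℝ x v = 0) : f' v = 0 := by
  obtain ⟨hφ, hg⟩ := h.isDefiningFunction_of_mem_t hx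
  have hW : (closure Sig)ᶜ ∩ frontier Ω ⊆ T := by
    rw [h.t_eq]; exact fun y hy => ⟨hy.2, hy.1⟩
  refine hφ.apply_eq_zero_of_tangent h.isOpen hf
    (isClosed_closure.isOpen_compl.mem_nhds (h.notMem_closure_sig hx))
    (hW.trans h.t_subset_regularPart) (fun y hy => h0 y (hW hy)) ?_
  rw [fderiv_eq_inner_gradient, hg, hv]

end IsHalfBallDomain

/-! ### Weak derivatives of classically differentiable functions -/

lemma continuousOn_fderiv_apply {Ω : Set (E n)} (hΩ : IsOpen Ω) {f : E n → ℝ}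
    (hf : ContDiffOn ℝ 1 f Ω) (v : E n) : ContinuousOn (fun x => fderiv ℝ f x v) Ω :=
  (hf.continuousOn_fderiv_of_isOpen hΩ le_rfl).clm_apply continuousOn_const

/-- Integration by parts against a test function. -/
lemma setIntegral_fderiv_mul {Ω : Set (E n)} (hΩ : IsOpen Ω) {f φ : E n → ℝ}
    (hf : ContDiffOn ℝ 1 f Ω) (hφ : ContDiff ℝ ∞ φ) (hc : HasCompactSupport φ)
    (hs : tsupport φ ⊆ Ω) (i : Fin (n + 1)) :
    ∫ x in Ω, f x * fderiv ℝ φ x (e i) = - ∫ x in Ω, fderiv ℝ f x (e i) * φ x := by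
  have hφ1 : ContDiff ℝ 1 φ := hφ.of_le (by simp)
  have hsub : tsupport (fun x => (f x * φ x) • (e i : E n)) ⊆ tsupport φ := by
    refine closure_mono fun x hx => ?_
    rw [Function.mem_support] at hx ⊢
    exact fun h0 => hx (by rw [h0, mul_zero, zero_smul])
  have h1 := setIntegral_divergence_eq_zero hΩ (F := fun x => (f x * φ x) • (e i : E n))
    ((hf.mul hφ1.contDiffOn).smul contDiffOn_const)
    (hc.of_isClosed_subset (isClosed_tsupport _) hsub) (hsub.trans hs)
  have h2 : ∀ x ∈ Ω, divergence (fun x => (f x * φ x) • (e i : E n)) x =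
      f x * fderiv ℝ φ x (e i) + fderiv ℝ f x (e i) * φ x := by
    intro x hx
    have hfx : DifferentiableAt ℝ f x := (hf.contDiffAt (hΩ.mem_nhds hx)).differentiableAt (by simp)
    have hφx : DifferentiableAt ℝ φ x := hφ1.contDiffAt.differentiableAt (by simp)
    rw [divergence_smul (f := fun x => f x * φ x) (hfx.mul hφx) (differentiableAt_const _)]
    have h0 : divergence (fun _ : E n => (e i : E n)) x = 0 := by simp [divergence]
    rw [h0, mul_zero, add_zero, fderiv_fun_mul hfx hφx]
    simp only [add_apply, smul_apply, smul_eq_mul]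
    ring
  rw [setIntegral_congr_fun hΩ.measurableSet h2] at h1
  have i1 : IntegrableOn (fun x => f x * fderiv ℝ φ x (e i)) Ω := by
    have hk : IntegrableOn (fun x => f x * fderiv ℝ φ x (e i)) (tsupport φ) :=
      ((hf.continuousOn.mono hs).mul
        ((hφ1.continuous_fderiv (by simp)).clm_apply continuous_const).continuousOn).integrableOn_compact
        hc
    refine hk.of_forall_sdiff_eq_zero hΩ.measurableSet fun x hx => ?_
    have : φ =ᶠ[𝓝 x] 0 := notMem_tsupport_iff_eventuallyEq.1 hx.2
    rw [this.fderiv_eq]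
    simp [show (0 : E n → ℝ) = fun _ => 0 from rfl]
  have i2 : IntegrableOn (fun x => fderiv ℝ f x (e i) * φ x) Ω := by
    have hk : IntegrableOn (fun x => fderiv ℝ f x (e i) * φ x) (tsupport φ) :=
      (((continuousOn_fderiv_apply hΩ hf _).mono hs).mul
        hφ1.continuous.continuousOn).integrableOn_compact hc
    refine hk.of_forall_sdiff_eq_zero hΩ.measurableSet fun x hx => ?_
    rw [image_eq_zero_of_notMem_tsupport hx.2, mul_zero]
  rw [integral_add i1 i2] at h1
  linarith

/-- The weak derivative of a continuously differentiable function is the classical one. -/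
lemma HasWeakPartialDeriv.ae_eq {Ω : Set (E n)} (hΩ : IsOpen Ω) {i : Fin (n + 1)} {f f₀ g : E n → ℝ}
    (h : HasWeakPartialDeriv Ω i f g) (hff : f =ᵐ[volume.restrict Ω] f₀)
    (hf : ContDiffOn ℝ 1 f₀ Ω) : g =ᵐ[volume.restrict Ω] fun x => fderiv ℝ f₀ x (e i) := by
  obtain ⟨-, hg, hw⟩ := h
  have hcf := continuousOn_fderiv_apply hΩ hf (e i)
  have hcl : LocallyIntegrableOn (fun x => fderiv ℝ f₀ x (e i)) Ω :=
    hcf.locallyIntegrableOn hΩ.measurableSet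
  have key := hΩ.ae_eq_zero_of_integral_contDiff_smul_eq_zero (hg.sub hcl) fun φ hφ hc hs => by
    have h1 := hw φ hφ hc hs
    have h2 : ∫ x in Ω, f x * fderiv ℝ φ x (e i) = ∫ x in Ω, f₀ x * fderiv ℝ φ x (e i) := by
      refine integral_congr_ae ?_
      filter_upwards [hff] with x hx
      rw [hx]
    rw [h2, setIntegral_fderiv_mul hΩ hf hφ hc hs i] at h1
    have i1 : IntegrableOn (fun x => g x * φ x) Ω := by
      have hk : IntegrableOn (fun x => g x * φ x) (tsupport φ) :=
        (hg.integrableOn_compact_subset hs hc).mul_continuousOn hφ.continuous.continuousOn hc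
      refine hk.of_forall_sdiff_eq_zero hΩ.measurableSet fun x hx => ?_
      rw [image_eq_zero_of_notMem_tsupport hx.2, mul_zero]
    have i2 : IntegrableOn (fun x => fderiv ℝ f₀ x (e i) * φ x) Ω := by
      have hk : IntegrableOn (fun x => fderiv ℝ f₀ x (e i) * φ x) (tsupport φ) :=
        ((hcf.mono hs).mul hφ.continuous.continuousOn).integrableOn_compact hc
      refine hk.of_forall_sdiff_eq_zero hΩ.measurableSet fun x hx => ?_
      rw [image_eq_zero_of_notMem_tsupport hx.2, mul_zero]
    have h3 : ∫ x, φ x • (g - fun x => fderiv ℝ f₀ x (e i)) x =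
        ∫ x in Ω, φ x • (g - fun x => fderiv ℝ f₀ x (e i)) x := by
      refine (setIntegral_eq_integral_of_forall_compl_eq_zero fun x hx => ?_).symm
      rw [image_eq_zero_of_notMem_tsupport fun hh => hx (hs hh), zero_smul]
    have h4 : ∀ x, φ x • (g - fun x => fderiv ℝ f₀ x (e i)) x =
        g x * φ x - fderiv ℝ f₀ x (e i) * φ x := fun x => by
      simp only [Pi.sub_apply, smul_eq_mul]; ring
    rw [h3]
    simp only [h4]
    rw [integral_sub i1 i2]
    linarith
  rw [Filter.EventuallyEq, ae_restrict_iff' hΩ.measurableSet]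
  filter_upwards [key] with x hx hxΩ
  have := hx hxΩ
  simp only [Pi.sub_apply] at this
  linarith

/-- The set where a continuous function exceeds its essential bound is open and null, hence empty.
-/
lemma exists_bound_of_memLp_top {Ω : Set (E n)} (hΩ : IsOpen Ω) {f : E n → ℝ}
    (hf : ContinuousOn f Ω) (h : MemLp f ⊤ (volume.restrict Ω)) : ∃ C, ∀ x ∈ Ω, |f x| ≤ C := by
  obtain ⟨C, hC⟩ : ∃ C : ℝ, ∀ᵐ x ∂volume.restrict Ω, ‖f x‖ ≤ C := by
    refine ⟨(eLpNorm f ⊤ (volume.restrict Ω)).toReal, ?_⟩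
    have h1 := h.eLpNorm_ne_top
    rw [eLpNorm_exponent_top] at h1 ⊢
    filter_upwards [enorm_ae_le_eLpNormEssSup f (volume.restrict Ω)] with x hx
    have := ENNReal.toReal_mono h1 hx
    rwa [toReal_enorm] at this
  refine ⟨C, fun x hx => ?_⟩
  have hopen : IsOpen (Ω ∩ f ⁻¹' {y | C < ‖y‖}) :=
    hf.isOpen_inter_preimage hΩ (isOpen_lt continuous_const continuous_norm)
  have hz : volume (Ω ∩ f ⁻¹' {y | C < ‖y‖}) = 0 := by
    rw [ae_restrict_iff' hΩ.measurableSet] at hC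
    refine measure_mono_null (fun y hy => ?_) hC
    intro hh
    exact absurd (hh hy.1) (not_le.2 hy.2)
  have he := hopen.eq_empty_of_measure_zero hz
  by_contra! hlt
  have : x ∈ Ω ∩ f ⁻¹' {y | C < ‖y‖} := ⟨hx, hlt⟩
  rw [he] at this
  exact this

/-- A continuously differentiable function of class `W^{1,∞}` is bounded with bounded gradient. -/
lemma exists_bound_of_memSobolev {Ω : Set (E n)} (hΩ : IsOpen Ω) {u : E n → ℝ}
    (hu : ContDiffOn ℝ 1 u Ω) (h : MemSobolev Ω 1 ⊤ u) :
    ∃ C, ∀ x ∈ Ω, |u x| ≤ C ∧ ∀ i, |fderiv ℝ u x (e i)| ≤ C := by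
  obtain ⟨h0, h1⟩ := h
  obtain ⟨C, hC⟩ := exists_bound_of_memLp_top hΩ hu.continuousOn h0
  have h2 : ∀ i : Fin (n + 1), ∃ D, ∀ x ∈ Ω, |fderiv ℝ u x (e i)| ≤ D := by
    intro i
    obtain ⟨g, hg, hg2⟩ := h1 i
    have hg3 : MemLp g ⊤ (volume.restrict Ω) := hg2
    exact exists_bound_of_memLp_top hΩ (continuousOn_fderiv_apply hΩ hu _)
      (hg3.ae_eq (hg.ae_eq hΩ Filter.EventuallyEq.rfl hu))
  choose D hD using h2
  refine ⟨max C (∑ i, |D i|), fun x hx => ⟨(hC x hx).trans (le_max_left _ _), fun i => ?_⟩⟩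
  exact ((hD i x hx).trans ((le_abs_self _).trans
    (Finset.single_le_sum (f := fun i => |D i|) (fun _ _ => abs_nonneg _) (Finset.mem_univ i)))).trans
    (le_max_right _ _)

/-- The second derivatives of a function of class `W^{2,2}` are square integrable. -/
lemma memLp_fderiv_fderiv_of_memSobolev {Ω : Set (E n)} (hΩ : IsOpen Ω) {u : E n → ℝ}
    (hu : ContDiffOn ℝ 2 u Ω) (h : MemSobolev Ω 2 2 u) (i j : Fin (n + 1)) :
    MemLp (fun x => fderiv ℝ (fun y => fderiv ℝ u y (e i)) x (e j)) 2 (volume.restrict Ω) := by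
  obtain ⟨g, hg, -, hg2⟩ := h.2 i
  obtain ⟨k, hk, hk2⟩ := hg2 j
  have hk3 : MemLp k 2 (volume.restrict Ω) := hk2
  have hdu : ContDiffOn ℝ 1 (fun y => fderiv ℝ u y (e i)) Ω :=
    (hu.fderiv_of_isOpen hΩ (m := 1) (by norm_num)).clm_apply contDiffOn_const
  exact hk3.ae_eq (hk.ae_eq hΩ (hg.ae_eq hΩ Filter.EventuallyEq.rfl (hu.of_le (by norm_num))) hdu)

/-! ### Gradient and Hessian up to the boundary -/

/-- The gradient within `s`. -/
def gradWithin (s : Set (E n)) (u : E n → ℝ) (x : E n) : E n :=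
  (InnerProductSpace.toDual ℝ (E n)).symm (fderivWithin ℝ u s x)

/-- The Hessian within `s`, as an endomorphism. -/
def hessWithin (s : Set (E n)) (u : E n → ℝ) (x : E n) : E n →L[ℝ] E n :=
  fderivWithin ℝ (gradWithin s u) s x

lemma inner_gradWithin (s : Set (E n)) (u : E n → ℝ) (x w : E n) :
    inner ℝ (gradWithin s u x) w = fderivWithin ℝ u s x w := by
  rw [gradWithin, InnerProductSpace.toDual_symm_apply]

lemma inner_e (v : E n) (i : Fin (n + 1)) : inner ℝ v (e i) = v i := by
  simp [e, EuclideanSpace.inner_single_right]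

section

variable {s : Set (E n)} {u : E n → ℝ} {x : E n}

lemma contDiffOn_gradWithin (hs : UniqueDiffOn ℝ s) (hu : ContDiffOn ℝ ∞ u s) :
    ContDiffOn ℝ ∞ (gradWithin s u) s :=
  (InnerProductSpace.toDual ℝ (E n)).symm.toContinuousLinearEquiv.contDiff.comp_contDiffOn
    (hu.fderivWithin hs (m := ∞) (by simp))

lemma contDiffOn_hessWithin (hs : UniqueDiffOn ℝ s) (hu : ContDiffOn ℝ ∞ u s) :
    ContDiffOn ℝ ∞ (hessWithin s u) s :=
  (contDiffOn_gradWithin hs hu).fderivWithin hs (m := ∞) (by simp)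

lemma hasFDerivWithinAt_innerSL_gradWithin (hu : ContDiffOn ℝ ∞ u s) (hx : x ∈ s) :
    HasFDerivWithinAt u (innerSL ℝ (gradWithin s u x)) s x := by
  have h1 := ((hu.contDiffWithinAt hx).differentiableWithinAt (by simp)).hasFDerivWithinAt
  have h2 : innerSL ℝ (gradWithin s u x) = fderivWithin ℝ u s x :=
    ContinuousLinearMap.ext fun w => inner_gradWithin s u x w
  rwa [h2]

lemma hasFDerivWithinAt_gradWithin (hs : UniqueDiffOn ℝ s) (hu : ContDiffOn ℝ ∞ u s)
    (hx : x ∈ s) : HasFDerivWithinAt (gradWithin s u) (hessWithin s u x) s x :=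
  (((contDiffOn_gradWithin hs hu).contDiffWithinAt hx).differentiableWithinAt
    (by simp)).hasFDerivWithinAt

lemma inner_hessWithin_of_mem_nhds (hs : UniqueDiffOn ℝ s) (hu : ContDiffOn ℝ ∞ u s)
    (hx : s ∈ 𝓝 x) (a b : E n) :
    inner ℝ (hessWithin s u x a) b = fderiv ℝ (fderiv ℝ u) x a b := by
  have hxs := mem_of_mem_nhds hx
  have h1 := (hasFDerivWithinAt_gradWithin hs hu hxs).hasFDerivAt hx
  have h2 : HasFDerivAt (fderiv ℝ u) (fderiv ℝ (fderiv ℝ u) x) x := by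
    have : ContDiffAt ℝ ∞ (fderiv ℝ u) x := (hu.contDiffAt hx).fderiv_right (by simp)
    exact (this.differentiableAt (by simp)).hasFDerivAt
  have h3 := ((InnerProductSpace.toDual ℝ (E n)).symm.toContinuousLinearEquiv.hasFDerivAt
    (x := fderiv ℝ u x)).comp x h2
  have heq : gradWithin s u =ᶠ[𝓝 x]
      (InnerProductSpace.toDual ℝ (E n)).symm.toContinuousLinearEquiv ∘ fderiv ℝ u := by
    filter_upwards [eventually_mem_nhds_iff.2 hx] with y hy
    simp only [Function.comp_apply, gradWithin, fderivWithin_of_mem_nhds hy]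
    rfl
  have h4 := h1.unique (h3.congr_of_eventuallyEq heq)
  rw [h4]
  exact InnerProductSpace.toDual_symm_apply ..

lemma iteratedFDeriv_two_eq_inner (hs : UniqueDiffOn ℝ s) (hu : ContDiffOn ℝ ∞ u s)
    (hx : s ∈ 𝓝 x) (i j : Fin (n + 1)) :
    iteratedFDeriv ℝ 2 u x ![e i, e j] = hessWithin s u x (e i) j := by
  rw [iteratedFDeriv_two_apply, ← inner_e, inner_hessWithin_of_mem_nhds hs hu hx]
  rfl

lemma hessianNormSq_eq (hs : UniqueDiffOn ℝ s) (hu : ContDiffOn ℝ ∞ u s) (hx : s ∈ 𝓝 x) :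
    hessianNormSq u x = ∑ i, ‖hessWithin s u x (e i)‖ ^ 2 := by
  refine Finset.sum_congr rfl fun i _ => ?_
  rw [EuclideanSpace.norm_sq_eq]
  refine Finset.sum_congr rfl fun j _ => ?_
  rw [iteratedFDeriv_two_eq_inner hs hu hx, Real.norm_eq_abs, sq_abs]

lemma laplacian_eq_sum (hs : UniqueDiffOn ℝ s) (hu : ContDiffOn ℝ ∞ u s) (hx : s ∈ 𝓝 x) :
    Laplacian.laplacian u x = ∑ i, hessWithin s u x (e i) i := by
  rw [InnerProductSpace.laplacian_eq_iteratedFDeriv_orthonormalBasis u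
    (EuclideanSpace.basisFun (Fin (n + 1)) ℝ)]
  refine Finset.sum_congr rfl fun i _ => ?_
  rw [← iteratedFDeriv_two_eq_inner hs hu hx]
  simp only [EuclideanSpace.basisFun_apply]
  rfl

lemma inner_hessWithin_comm_of_mem_nhds (hs : UniqueDiffOn ℝ s) (hu : ContDiffOn ℝ ∞ u s)
    (hx : s ∈ 𝓝 x) (a b : E n) :
    inner ℝ (hessWithin s u x a) b = inner ℝ a (hessWithin s u x b) := by
  rw [real_inner_comm (hessWithin s u x b) a, inner_hessWithin_of_mem_nhds hs hu hx,
    inner_hessWithin_of_mem_nhds hs hu hx]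
  exact ((hu.contDiffAt hx).isSymmSndFDerivAt
    (by rw [minSmoothness_of_isRCLikeNormedField]; exact ENat.LEInfty.out)) a b

/-- The divergence of the columns of the Hessian is the gradient of the Laplacian. -/
lemma sum_fderiv_hessWithin_eq_zero (hs : UniqueDiffOn ℝ s) (hu : ContDiffOn ℝ ∞ u s)
    {U : Set (E n)} (hU : IsOpen U) (hUs : U ⊆ s) {c : ℝ}
    (hc : ∀ y ∈ U, Laplacian.laplacian u y = c) (hx : x ∈ U) (a : E n) :
    ∑ i, fderiv ℝ (hessWithin s u) x (e i) a i = 0 := by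
  have hsx : s ∈ 𝓝 x := Filter.mem_of_superset (hU.mem_nhds hx) hUs
  have hV : ContDiffAt ℝ ∞ (gradWithin s u) x := (contDiffOn_gradWithin hs hu).contDiffAt hsx
  have heq : hessWithin s u =ᶠ[𝓝 x] fderiv ℝ (gradWithin s u) := by
    filter_upwards [eventually_mem_nhds_iff.2 hsx] with y hy
    rw [hessWithin, fderivWithin_of_mem_nhds hy]
  have hsymm : ∀ v w, fderiv ℝ (hessWithin s u) x v w = fderiv ℝ (hessWithin s u) x w v := by
    intro v w
    rw [heq.fderiv_eq]
    exact (hV.isSymmSndFDerivAt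
    (by rw [minSmoothness_of_isRCLikeNormedField]; exact ENat.LEInfty.out)) v w
  have hH : HasFDerivAt (hessWithin s u) (fderiv ℝ (hessWithin s u) x) x :=
    (((contDiffOn_hessWithin hs hu).contDiffAt hsx).differentiableAt (by simp)).hasFDerivAt
  -- The trace as a continuous functional. The trace of the Hessian is the Laplacian, constant on U,
  -- so its derivative is zero; symmetry of third derivatives rewrites that derivative as the
  -- desired sum.
  let L : (E n →L[ℝ] E n) →L[ℝ] ℝ := ∑ i : Fin (n + 1),
    (EuclideanSpace.proj (𝕜 := ℝ) i).comp (ContinuousLinearMap.apply ℝ (E n) (e i : E n))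
  have hL : ∀ A : E n →L[ℝ] E n, L A = ∑ i, A (e i) i := fun A => by
    simp [L]
  have h1 : HasFDerivAt (fun y => L (hessWithin s u y)) (L.comp (fderiv ℝ (hessWithin s u) x)) x :=
    L.hasFDerivAt.comp x hH
  have h2 : HasFDerivAt (fun y => L (hessWithin s u y)) (0 : E n →L[ℝ] ℝ) x := by
    refine (hasFDerivAt_const c x).congr_of_eventuallyEq ?_
    filter_upwards [hU.mem_nhds hx] with y hy
    rw [hL, ← laplacian_eq_sum hs hu (Filter.mem_of_superset (hU.mem_nhds hy) hUs), hc y hy]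
  have h3 := congrArg (fun A : E n →L[ℝ] ℝ => A a) (h1.unique h2)
  simp only [ContinuousLinearMap.comp_apply, hL, zero_apply] at h3
  simpa only [hsymm a] using h3

end

/-! ### Gradient and Hessian of the solution on the boundary -/

namespace IsHalfBallDomain

variable {Ω Sig T : Set (E n)} {u : E n → ℝ}

lemma regularPart_mem_nhds (h : IsHalfBallDomain Ω Sig T) {x : E n} (hx : x ∈ Ω) :
    regularPart Ω Sig T ∈ 𝓝 x :=
  Filter.mem_of_superset (h.isOpen.mem_nhds hx) h.subset_regularPart

lemma normalDeriv_eq {x : E n} (hx : x ∈ regularPart Ω Sig T) :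
    normalDeriv Ω u x = inner ℝ (gradWithin (regularPart Ω Sig T) u x) (outerNormal Ω x) := by
  rw [inner_gradWithin, normalDeriv]
  congr 1
  have h1 : regularPart Ω Sig T = closure Ω ∩ (corner Sig T)ᶜ := rfl
  rw [h1, fderivWithin_inter ((isClosed_corner Sig T).isOpen_compl.mem_nhds hx.2)]

/-- A closed condition on the values of a continuous function passes from `Ω` to the regular part
of its closure. -/
lemma mem_of_isClosed (h : IsHalfBallDomain Ω Sig T) {f : E n → ℝ}
    (hf : ContinuousOn f (regularPart Ω Sig T)) {K : Set ℝ} (hK : IsClosed K)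
    (h0 : ∀ x ∈ Ω, f x ∈ K) {x : E n} (hx : x ∈ regularPart Ω Sig T) : f x ∈ K := by
  have h1 : x ∈ closure Ω := hx.1
  have h2 : ContinuousWithinAt f Ω x := (hf x hx).mono h.subset_regularPart
  exact hK.closure_subset (h2.mem_closure h1 h0)

lemma gradWithin_apply_of_mem (h : IsHalfBallDomain Ω Sig T) {x : E n} (hx : x ∈ Ω) (i : Fin (n + 1)) :
    gradWithin (regularPart Ω Sig T) u x i = fderiv ℝ u x (e i) := by
  rw [← inner_e, inner_gradWithin, fderivWithin_of_mem_nhds (h.regularPart_mem_nhds hx)]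

variable (h : IsHalfBallDomain Ω Sig T) (hu : IsSolution Ω Sig T u)
include h hu

lemma contDiffOn_grad : ContDiffOn ℝ ∞ (gradWithin (regularPart Ω Sig T) u)
    (regularPart Ω Sig T) := contDiffOn_gradWithin h.uniqueDiffOn_regularPart hu.smooth

lemma contDiffOn_hess : ContDiffOn ℝ ∞ (hessWithin (regularPart Ω Sig T) u)
    (regularPart Ω Sig T) := contDiffOn_hessWithin h.uniqueDiffOn_regularPart hu.smooth

/-- Symmetry holds in Ω and extends to the regular boundary by continuity of the Hessian. -/
lemma inner_hess_comm {x : E n} (hx : x ∈ regularPart Ω Sig T) (a b : E n) :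
    inner ℝ (hessWithin (regularPart Ω Sig T) u x a) b =
      inner ℝ a (hessWithin (regularPart Ω Sig T) u x b) := by
  have hH : ∀ a, ContinuousOn (fun y => hessWithin (regularPart Ω Sig T) u y a)
      (regularPart Ω Sig T) := fun a =>
    (h.contDiffOn_hess hu).continuousOn.clm_apply continuousOn_const
  have := h.mem_of_isClosed (f := fun y => inner ℝ (hessWithin (regularPart Ω Sig T) u y a) b -
      inner ℝ a (hessWithin (regularPart Ω Sig T) u y b)) (((hH a).inner continuousOn_const).sub
      (continuousOn_const.inner (hH b))) (isClosed_singleton (x := (0 : ℝ))) (fun y hy => by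
      rw [mem_singleton_iff, sub_eq_zero]
      exact inner_hessWithin_comm_of_mem_nhds h.uniqueDiffOn_regularPart hu.smooth
        (h.regularPart_mem_nhds hy) a b) hx
  rwa [mem_singleton_iff, sub_eq_zero] at this

/-- Since u vanishes on Σ, its tangential derivatives do too, so the gradient equals its normal
component. -/
lemma grad_eq_of_mem_sig {x : E n} (hx : x ∈ Sig) :
    gradWithin (regularPart Ω Sig T) u x = normalDeriv Ω u x • outerNormal Ω x := by
  set V := gradWithin (regularPart Ω Sig T) u x with hV
  set ν := outerNormal Ω x with hν
  have hxs := h.sig_subset_regularPart hx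
  have hm : normalDeriv Ω u x = inner ℝ V ν := normalDeriv_eq hxs
  have hν1 : ‖ν‖ = 1 := h.norm_outerNormal hx
  have h1 : inner ℝ (V - inner ℝ V ν • ν) ν = 0 := by
    rw [inner_sub_left, inner_smul_left, real_inner_self_eq_norm_sq, hν1]
    simp
  have h2 := h.apply_eq_zero_of_mem_sig hx (hasFDerivWithinAt_innerSL_gradWithin hu.smooth hxs)
    hu.dirichlet h1
  rw [innerSL_apply_apply] at h2
  have h3 : inner ℝ (V - inner ℝ V ν • ν) (V - inner ℝ V ν • ν) = 0 := by
    rw [inner_sub_right, inner_smul_right, h1, mul_zero, sub_zero, real_inner_comm]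
    exact h2
  rw [hm]
  exact sub_eq_zero.1 (inner_self_eq_zero.1 h3)

lemma inner_grad_of_mem_t {x : E n} (hx : x ∈ T) :
    inner ℝ x (gradWithin (regularPart Ω Sig T) u x) = u x := by
  rw [← hu.steklov x hx, normalDeriv_eq (h.t_subset_regularPart hx),
    h.outerNormal_of_mem_t hx, real_inner_comm]

/-- Differentiate ⟨x, ∇u⟩ − u = 0 along a tangent vector v of the sphere: ⟨v, ∇u⟩ and the derivative
of u cancel, leaving ⟨x, ∇²u v⟩ = 0. By symmetry ∇²u x is orthogonal to every such v. -/
lemma hess_apply_self_of_mem_t {x : E n} (hx : x ∈ T) :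
    hessWithin (regularPart Ω Sig T) u x x =
      inner ℝ x (hessWithin (regularPart Ω Sig T) u x x) • x := by
  have hxs := h.t_subset_regularPart hx
  have hx1 : ‖x‖ = 1 := by simpa using h.t_subset hx
  have hud := hasFDerivWithinAt_innerSL_gradWithin (s := regularPart Ω Sig T) hu.smooth hxs
  have hVd := hasFDerivWithinAt_gradWithin h.uniqueDiffOn_regularPart hu.smooth hxs
  have hd := (((hasFDerivWithinAt_id (𝕜 := ℝ) x (regularPart Ω Sig T)).inner ℝ hVd).sub hud)
  have hz : ∀ v : E n, inner ℝ x v = 0 →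
      inner ℝ x (hessWithin (regularPart Ω Sig T) u x v) = 0 := by
    intro v hv
    have h1 := h.apply_eq_zero_of_mem_t hx hd (fun y hy => by
      simp only [Pi.sub_apply, id_eq]
      rw [h.inner_grad_of_mem_t hu hy, sub_self]) hv
    simp only [sub_apply, ContinuousLinearMap.comp_apply,
      ContinuousLinearMap.prod_apply, fderivInnerCLM_apply, innerSL_apply_apply, id_eq,
      ContinuousLinearMap.id_apply] at h1
    rw [real_inner_comm _ v] at h1
    linarith
  set A := hessWithin (regularPart Ω Sig T) u x x with hA
  have h1 : inner ℝ x (A - inner ℝ x A • x) = 0 := by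
    rw [inner_sub_right, inner_smul_right, real_inner_self_eq_norm_sq, hx1]
    simp
  have h2 := hz _ h1
  rw [← h.inner_hess_comm hu hxs, ← hA] at h2
  have h3 : inner ℝ (A - inner ℝ x A • x) (A - inner ℝ x A • x) = 0 := by
    rw [inner_sub_left, inner_smul_left, h1, mul_zero, sub_zero]
    exact h2
  exact sub_eq_zero.1 (inner_self_eq_zero.1 h3)

/-- `u` and its gradient are bounded. -/
lemma exists_bound (hu₁ : MemSobolev Ω 1 ⊤ u) : ∃ C, 0 ≤ C ∧ ∀ x ∈ regularPart Ω Sig T,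
    |u x| ≤ C ∧ ‖gradWithin (regularPart Ω Sig T) u x‖ ≤ C := by
  have hu1 : ContDiffOn ℝ 1 u Ω := (hu.smooth.mono h.subset_regularPart).of_le (by simp)
  obtain ⟨C, hC⟩ := exists_bound_of_memSobolev h.isOpen hu1 hu₁
  have hC0 : 0 ≤ C := by
    obtain ⟨x, hx⟩ := h.isConnected.nonempty
    exact (abs_nonneg _).trans (hC x hx).1
  have hC2 : C ≤ C + (n + 1) * C := by
    have : 0 ≤ (n + 1) * C := by positivity
    linarith
  refine ⟨C + (n + 1) * C, by positivity, fun x hx => ⟨?_, ?_⟩⟩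
  · exact (h.mem_of_isClosed (f := fun x => |u x|) hu.smooth.continuousOn.abs
      (isClosed_Iic (a := C)) (fun y hy => (hC y hy).1) hx : |u x| ≤ C).trans hC2
  · refine h.mem_of_isClosed (f := fun x => ‖gradWithin (regularPart Ω Sig T) u x‖)
      (h.contDiffOn_grad hu).continuousOn.norm (isClosed_Iic (a := C + (n + 1) * C))
      (fun y hy => ?_) hx
    have h1 : ‖gradWithin (regularPart Ω Sig T) u y‖ ≤
        ∑ i, |gradWithin (regularPart Ω Sig T) u y i| := by
      conv_lhs => rw [← sum_smul_e (gradWithin (regularPart Ω Sig T) u y)]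
      refine (norm_sum_le _ _).trans (Finset.sum_le_sum fun i _ => ?_)
      rw [norm_smul, Real.norm_eq_abs, show ‖(e i : E n)‖ = 1 by simp [e], mul_one]
    have h2 : ∑ i, |gradWithin (regularPart Ω Sig T) u y i| ≤ ∑ _i : Fin (n + 1), C :=
      Finset.sum_le_sum fun i _ => by
        rw [h.gradWithin_apply_of_mem hy]
        exact (hC y hy).2 i
    simp only [Finset.sum_const, Finset.card_univ, Fintype.card_fin, nsmul_eq_mul] at h2
    push_cast at h2
    exact mem_Iic.2 (by linarith)

lemma memLp_hess_apply (hu₂ : MemSobolev Ω 2 2 u) (i : Fin (n + 1)) :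
    MemLp (fun x => hessWithin (regularPart Ω Sig T) u x (e i)) 2 (volume.restrict Ω) := by
  have hu2 : ContDiffOn ℝ 2 u Ω :=
    (hu.smooth.mono h.subset_regularPart).of_le ENat.LEInfty.out
  refine MemLp.of_eval_piLp fun j => ?_
  refine (memLp_fderiv_fderiv_of_memSobolev h.isOpen hu2 hu₂ j i).ae_eq ?_
  filter_upwards [ae_restrict_mem h.isOpen.measurableSet] with x hx
  rw [← inner_e, inner_hessWithin_of_mem_nhds h.uniqueDiffOn_regularPart hu.smooth
    (h.regularPart_mem_nhds hx)]
  have h1 : HasFDerivAt (fderiv ℝ u) (fderiv ℝ (fderiv ℝ u) x) x :=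
    (((hu2.contDiffAt (h.isOpen.mem_nhds hx)).fderiv_right (m := 1)
      (by norm_num)).differentiableAt (by simp)).hasFDerivAt
  have h2 : HasFDerivAt (fun y => fderiv ℝ u y (e j))
      ((ContinuousLinearMap.apply ℝ ℝ (e j : E n)).comp (fderiv ℝ (fderiv ℝ u) x)) x :=
    (ContinuousLinearMap.apply ℝ ℝ (e j : E n)).hasFDerivAt.comp x h1
  rw [h2.fderiv]
  rfl

end IsHalfBallDomain

/-! ### The vector field of the fundamental identity -/

/-- Coefficient of `∇u` in `mainVec`; `w = x_N`, `S = |∇u|²`, `R = ⟨x, ∇u⟩`, `p = ∂_N u`,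
`r = |x|²`. -/
def coefGrad (N c w u S R p r : ℝ) : ℝ :=
  -- The terms w u and (S − 2u)w/2 belong to the P-function part, the next bracket is ⟨X^q, ∇u⟩, and
  -- the last term is the c² part; all terms in between carry a factor u.
  w * u + 1 / 2 * ((S - 2 * u) * w) - (w * R - 1 / 2 * ((r + 1) * p)) - (N - 1) * (w * u)
    - 2 * (u * p) + u * u * w + 2 * (w * u * R) - (1 - N) * (w * (u * u)) - c ^ 2 / 2 * w

/-- Coefficient of `x` in `mainVec`. -/
def coefPos (N c w u S _R p _r : ℝ) : ℝ :=
  1 / 2 * (S * w) + N * (u * w) - (u * u * p + 2 * (w * u * S)) - N * (w * (u * u)) - u * p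
    + 3 * (u * u * p) + c ^ 2 / 2 * w

/-- Coefficient of `e_N` in `mainVec`. -/
def coefVert (N c _w u S R _p r : ℝ) : ℝ :=
  1 / 2 * ((S - 2 * u) * u) - 1 / 2 * ((r + 1) * (1 / 2 * S + N * u)) + u * S
    + (3 * N + 1) / 2 * (u * u) + u * R - (1 - N) / 2 * (u * u) - 3 * (u * u * R)
    + (1 - N) * (u * u * u) + c ^ 2 / 2 * u - c ^ 2 / 4 * (r + 1)

/-- The value of the vector field of the fundamental identity at the point `x`, as a function of
`x`, of the values `u`, `V` of the function and of its gradient, and of its Hessian `A`. -/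
def mainVec (N c : ℝ) (x : E n) (u : ℝ) (V : E n) (A : E n →L[ℝ] E n) : E n :=
  coefGrad N c (inner ℝ x (e (Fin.last n))) u (inner ℝ V V) (inner ℝ x V)
      (inner ℝ V (e (Fin.last n))) (inner ℝ x x) • V
    + coefPos N c (inner ℝ x (e (Fin.last n))) u (inner ℝ V V) (inner ℝ x V)
      (inner ℝ V (e (Fin.last n))) (inner ℝ x x) • x
    + coefVert N c (inner ℝ x (e (Fin.last n))) u (inner ℝ V V) (inner ℝ x V)
      (inner ℝ V (e (Fin.last n))) (inner ℝ x x) • e (Fin.last n)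
    + (-(inner ℝ x (e (Fin.last n)) * u)) • A V
    -- Compensates the flux of the preceding term through T; both vanish on Σ with u.
    + (inner ℝ x (e (Fin.last n)) * (u * u)) • A x

lemma contDiffOn_mainVec (N c : ℝ) {G : Type*} [NormedAddCommGroup G] [NormedSpace ℝ G]
    {s : Set G} {f V : G → E n} {u : G → ℝ} {A : G → E n →L[ℝ] E n} {k : ℕ∞ω}
    (hf : ContDiffOn ℝ k f s) (hu : ContDiffOn ℝ k u s) (hV : ContDiffOn ℝ k V s)
    (hA : ContDiffOn ℝ k A s) : ContDiffOn ℝ k (fun z => mainVec N c (f z) (u z) (V z) (A z)) s := by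
  have h1 := hA.clm_apply hV
  have h2 := hA.clm_apply hf
  have h3 := hf.inner ℝ (contDiffOn_const (c := (e (Fin.last n) : E n)))
  have h4 := hV.inner ℝ (contDiffOn_const (c := (e (Fin.last n) : E n)))
  have h5 := hV.inner ℝ hV
  have h6 := hf.inner ℝ hV
  have h7 := hf.inner ℝ hf
  unfold mainVec coefGrad coefPos coefVert
  generalize hB : (fun z => A z (V z)) = B at h1
  generalize hD : (fun z => A z (f z)) = D at h2
  simp only [fun z => congrFun hB z, fun z => congrFun hD z]
  fun_prop

lemma divergence_add {F G : E n → E n} {x : E n} (hF : DifferentiableAt ℝ F x)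
    (hG : DifferentiableAt ℝ G x) :
    divergence (fun y => F y + G y) x = divergence F x + divergence G x := by
  simp only [divergence, fderiv_fun_add hF hG, add_apply, PiLp.add_apply, Finset.sum_add_distrib]

/-! ### Differentials of the coefficients -/

section

variable {w u S R p r : E n → ℝ} {w' u' S' R' p' r' : E n →L[ℝ] ℝ} {x : E n}

/-- The scalar arguments are treated as independent variables and the differential is sorted by
them, so that the divergence computation reduces to polynomial algebra. The same holds for the next
two lemmas. -/
lemma exists_hasFDerivAt_coefGrad (N c : ℝ) (hw : HasFDerivAt w w' x) (hu : HasFDerivAt u u' x)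
    (hS : HasFDerivAt S S' x) (hR : HasFDerivAt R R' x) (hp : HasFDerivAt p p' x)
    (hr : HasFDerivAt r r' x) :
    ∃ L : E n →L[ℝ] ℝ, HasFDerivAt
      (fun y => coefGrad N c (w y) (u y) (S y) (R y) (p y) (r y)) L x ∧ ∀ Y, L Y =
      (u x + 1 / 2 * (S x - 2 * u x) - R x - (N - 1) * u x + u x ^ 2 + 2 * u x * R x
        - (1 - N) * u x ^ 2 - c ^ 2 / 2) * w' Y
      -- The two cancelling terms come from w u and from the −2u in (S − 2u)w/2.
      + (w x - w x - (N - 1) * w x - 2 * p x + 2 * u x * w x + 2 * w x * R x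
        - 2 * (1 - N) * w x * u x) * u' Y
      + (1 / 2 * w x) * S' Y + (2 * w x * u x - w x) * R' Y
      + (1 / 2 * (r x + 1) - 2 * u x) * p' Y + 1 / 2 * p x * r' Y := by
  refine ⟨_, (((((((((hw.fun_mul hu).fun_add (((hS.fun_sub (hu.const_mul 2)).fun_mul hw).const_mul
    (1 / 2))).fun_sub ((hw.fun_mul hR).fun_sub (((hr.add_const 1).fun_mul hp).const_mul
    (1 / 2)))).fun_sub ((hw.fun_mul hu).const_mul (N - 1))).fun_sub
    ((hu.fun_mul hp).const_mul 2)).fun_add ((hu.fun_mul hu).fun_mul hw)).fun_add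
    (((hw.fun_mul hu).fun_mul hR).const_mul 2)).fun_sub
    ((hw.fun_mul (hu.fun_mul hu)).const_mul (1 - N))).fun_sub (hw.const_mul (c ^ 2 / 2))),
    fun Y => ?_⟩
  simp only [add_apply, sub_apply, smul_apply, smul_eq_mul]
  ring

lemma exists_hasFDerivAt_coefPos (N c : ℝ) (hw : HasFDerivAt w w' x) (hu : HasFDerivAt u u' x)
    (hS : HasFDerivAt S S' x) (hp : HasFDerivAt p p' x) :
    ∃ L : E n →L[ℝ] ℝ, HasFDerivAt
      (fun y => coefPos N c (w y) (u y) (S y) (R y) (p y) (r y)) L x ∧ ∀ Y, L Y =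
      (1 / 2 * S x + N * u x - 2 * u x * S x - N * u x ^ 2 + c ^ 2 / 2) * w' Y
      + (N * w x - 2 * u x * p x - 2 * w x * S x - 2 * N * w x * u x - p x + 6 * u x * p x) * u' Y
      + (1 / 2 * w x - 2 * w x * u x) * S' Y + (2 * u x ^ 2 - u x) * p' Y := by
  refine ⟨_, (((((((hS.fun_mul hw).const_mul (1 / 2)).fun_add ((hu.fun_mul hw).const_mul N)).fun_sub
    (((hu.fun_mul hu).fun_mul hp).fun_add (((hw.fun_mul hu).fun_mul hS).const_mul 2))).fun_sub
    ((hw.fun_mul (hu.fun_mul hu)).const_mul N)).fun_sub (hu.fun_mul hp)).fun_add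
    (((hu.fun_mul hu).fun_mul hp).const_mul 3)).fun_add (hw.const_mul (c ^ 2 / 2)), fun Y => ?_⟩
  simp only [add_apply, sub_apply, smul_apply, smul_eq_mul]
  ring

lemma exists_hasFDerivAt_coefVert (N c : ℝ) (hu : HasFDerivAt u u' x) (hS : HasFDerivAt S S' x)
    (hR : HasFDerivAt R R' x) (hr : HasFDerivAt r r' x) :
    ∃ L : E n →L[ℝ] ℝ, HasFDerivAt
      (fun y => coefVert N c (w y) (u y) (S y) (R y) (p y) (r y)) L x ∧ ∀ Y, L Y =
      (1 / 2 * S x - 2 * u x - 1 / 2 * ((r x + 1) * N) + S x + (3 * N + 1) * u x + R x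
        - (1 - N) * u x - 6 * u x * R x + 3 * (1 - N) * u x ^ 2 + c ^ 2 / 2) * u' Y
      + (3 / 2 * u x - 1 / 4 * (r x + 1)) * S' Y + (u x - 3 * u x ^ 2) * R' Y
      - (1 / 2 * (1 / 2 * S x + N * u x) + c ^ 2 / 4) * r' Y := by
  refine ⟨_, ((((((((((hS.fun_sub (hu.const_mul 2)).fun_mul hu).const_mul (1 / 2)).fun_sub
    (((hr.add_const 1).fun_mul ((hS.const_mul (1 / 2)).fun_add (hu.const_mul N))).const_mul
    (1 / 2))).fun_add (hu.fun_mul hS)).fun_add ((hu.fun_mul hu).const_mul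
    ((3 * N + 1) / 2))).fun_add (hu.fun_mul hR)).fun_sub
    ((hu.fun_mul hu).const_mul ((1 - N) / 2))).fun_sub
    (((hu.fun_mul hu).fun_mul hR).const_mul 3)).fun_add
    (((hu.fun_mul hu).fun_mul hu).const_mul (1 - N))).fun_add (hu.const_mul (c ^ 2 / 2)) |>.fun_sub
    ((hr.add_const 1).const_mul (c ^ 2 / 4)), fun Y => ?_⟩
  simp only [add_apply, sub_apply, smul_apply, smul_eq_mul]
  ring

end

lemma divergence_smul_of_hasFDerivAt {f : E n → ℝ} {F : E n → E n} {f' : E n →L[ℝ] ℝ}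
    {F' : E n →L[ℝ] E n} {x : E n} (hf : HasFDerivAt f f' x) (hF : HasFDerivAt F F' x) :
    divergence (fun y => f y • F y) x = f' (F x) + f x * ∑ i, F' (e i) i := by
  rw [divergence_smul hf.differentiableAt hF.differentiableAt, hf.fderiv, divergence, hF.fderiv]

lemma hasFDerivAt_inner {F G : E n → E n} {F' G' : E n →L[ℝ] E n} {x : E n}
    (hF : HasFDerivAt F F' x) (hG : HasFDerivAt G G' x) :
    ∃ L : E n →L[ℝ] ℝ, HasFDerivAt (fun y => (inner ℝ (F y) (G y) : ℝ)) L x ∧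
      ∀ Y, L Y = inner ℝ (F x) (G' Y) + inner ℝ (F' Y) (G x) :=
  ⟨_, hF.inner ℝ hG, fun Y => by simp⟩

/-- The divergence of the vector field of the fundamental identity. -/
lemma divergence_mainVec {N : ℝ} (hN : N = (n : ℝ) + 1) (c : ℝ) {u : E n → ℝ} {V : E n → E n}
    {H : E n → E n →L[ℝ] E n} {H' : E n →L[ℝ] E n →L[ℝ] E n} {x : E n}
    (hu : HasFDerivAt u (innerSL ℝ (V x)) x) (hV : HasFDerivAt V (H x) x)
    (hH : HasFDerivAt H H' x) (hsymm : ∀ a b, inner ℝ (H x a) b = inner ℝ a (H x b))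
    (htr : ∑ i, H x (e i) i = N) (htr' : ∀ a, ∑ i, H' (e i) a i = 0) :
    divergence (fun y => mainVec N c y (u y) (V y) (H y)) x =
      -(x (Fin.last n) * u x) * (∑ i, ‖H x (e i)‖ ^ 2 - N) := by
  set ee : E n := e (Fin.last n) with hee
  have hid : HasFDerivAt (fun y : E n => y) (ContinuousLinearMap.id ℝ (E n)) x := hasFDerivAt_id x
  have hce : HasFDerivAt (fun _ : E n => ee) (0 : E n →L[ℝ] E n) x := hasFDerivAt_const _ _
  obtain ⟨w', hw, hw2⟩ := hasFDerivAt_inner hid hce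
  obtain ⟨S', hS, hS2⟩ := hasFDerivAt_inner hV hV
  obtain ⟨R', hR, hR2⟩ := hasFDerivAt_inner hid hV
  obtain ⟨p', hp, hp2⟩ := hasFDerivAt_inner hV hce
  obtain ⟨r', hr, hr2⟩ := hasFDerivAt_inner hid hid
  obtain ⟨L1, h1, h1v⟩ := exists_hasFDerivAt_coefGrad N c hw hu hS hR hp hr
  obtain ⟨L2, h2, h2v⟩ := exists_hasFDerivAt_coefPos (R := fun y => inner ℝ y (V y))
    (r := fun y => inner ℝ y y) N c hw hu hS hp
  obtain ⟨L3, h3, h3v⟩ := exists_hasFDerivAt_coefVert (w := fun y => inner ℝ y ee)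
    (p := fun y => inner ℝ (V y) ee) N c hu hS hR hr
  have h4 := (hw.fun_mul hu).fun_neg
  have h5 := hw.fun_mul (hu.fun_mul hu)
  have hHV := hH.clm_apply hV
  have hHx := hH.clm_apply hid
  have t2 : ∑ i, (ContinuousLinearMap.id ℝ (E n)) (e i) i = N := by
    rw [hN]; simp [e]
  -- The divergence of ∇²u ∇u: the trace of the squared Hessian is its Frobenius norm by symmetry,
  -- and the third-order term vanishes because Δu is constant.
  have t4 : ∑ i, (H x ∘SL H x + H'.flip (V x)) (e i) i = ∑ i, ‖H x (e i)‖ ^ 2 := by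
    simp only [add_apply, ContinuousLinearMap.comp_apply, ContinuousLinearMap.flip_apply,
      PiLp.add_apply, Finset.sum_add_distrib, htr', add_zero]
    refine Finset.sum_congr rfl fun i _ => ?_
    rw [← inner_e, hsymm, real_inner_self_eq_norm_sq]
  have t5 : ∑ i, (H x ∘SL ContinuousLinearMap.id ℝ (E n) + H'.flip x) (e i) i = N := by
    simp only [add_apply, ContinuousLinearMap.comp_apply, ContinuousLinearMap.flip_apply,
      PiLp.add_apply, Finset.sum_add_distrib, htr', add_zero, ContinuousLinearMap.id_apply, htr]
  unfold mainVec
  rw [divergence_add ((((h1.fun_smul hV).fun_add (h2.fun_smul hid)).fun_add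
      (h3.fun_smul hce)).fun_add (h4.fun_smul hHV)).differentiableAt
      (h5.fun_smul hHx).differentiableAt,
    divergence_add (((h1.fun_smul hV).fun_add (h2.fun_smul hid)).fun_add
      (h3.fun_smul hce)).differentiableAt (h4.fun_smul hHV).differentiableAt,
    divergence_add ((h1.fun_smul hV).fun_add (h2.fun_smul hid)).differentiableAt
      (h3.fun_smul hce).differentiableAt,
    divergence_add (h1.fun_smul hV).differentiableAt (h2.fun_smul hid).differentiableAt,
    divergence_smul_of_hasFDerivAt h1 hV, divergence_smul_of_hasFDerivAt h2 hid,
    divergence_smul_of_hasFDerivAt h3 hce, divergence_smul_of_hasFDerivAt h4 hHV,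
    divergence_smul_of_hasFDerivAt h5 hHx, htr, t2, t4, t5, h1v, h2v, h3v]
  simp only [hw2, hS2, hR2, hp2, hr2, add_apply, smul_apply, neg_apply, smul_eq_mul,
    ContinuousLinearMap.id_apply, zero_apply, inner_zero_right, zero_add, add_zero,
    innerSL_apply_apply, PiLp.zero_apply, Finset.sum_const_zero, mul_zero]
  -- All inner products are brought to one representative each, after which the identity is
  -- polynomial.
  have hxl : x (Fin.last n) = inner ℝ x ee := (inner_e _ _).symm
  have s1 : inner ℝ (H x (V x)) (V x) = (inner ℝ (V x) (H x (V x)) : ℝ) := hsymm _ _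
  have s2 : inner ℝ x (H x (V x)) = (inner ℝ (V x) (H x x) : ℝ) := by
    rw [← hsymm, real_inner_comm]
  have s3 : inner ℝ (H x x) (V x) = (inner ℝ (V x) (H x x) : ℝ) := real_inner_comm _ _
  have s4 : inner ℝ (H x (V x)) ee = (inner ℝ (V x) (H x ee) : ℝ) := hsymm _ _
  have s5 : inner ℝ (H x ee) (V x) = (inner ℝ (V x) (H x ee) : ℝ) := real_inner_comm _ _
  have s6 : inner ℝ (H x x) ee = (inner ℝ x (H x ee) : ℝ) := hsymm _ _
  have s7 : inner ℝ (V x) x = (inner ℝ x (V x) : ℝ) := real_inner_comm _ _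
  have s8 : inner ℝ ee (V x) = (inner ℝ (V x) ee : ℝ) := real_inner_comm _ _
  have s9 : inner ℝ ee x = (inner ℝ x ee : ℝ) := real_inner_comm _ _
  rw [hxl]
  simp only [s1, s2, s3, s4, s5, s6, s7, s8, s9, coefGrad, coefPos]
  ring

/-- The normal component of the vector field where `u = 0` and the gradient is normal. -/
lemma inner_mainVec_of_normal (N c m : ℝ) (x ν : E n) (hν : ‖ν‖ = 1) (A : E n →L[ℝ] E n) :
    inner ℝ (mainVec N c x 0 (m • ν) A) ν =
      1 / 2 * ((m ^ 2 - c ^ 2) * (x (Fin.last n) * m - inner ℝ (killingField x) ν)) := by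
  have h1 : inner ℝ ν ν = (1 : ℝ) := by rw [real_inner_self_eq_norm_sq, hν, one_pow]
  have h2 : inner ℝ (e (Fin.last n)) ν = (inner ℝ ν (e (Fin.last n)) : ℝ) := real_inner_comm _ _
  simp only [mainVec, killingField, coefGrad, coefPos, coefVert, inner_add_left, inner_sub_left,
    real_inner_smul_left, real_inner_smul_right, h1, h2, ← inner_e x,
    ← real_inner_self_eq_norm_sq]
  ring

/-- The vector field is tangent to the unit sphere where the Robin condition holds. -/
lemma inner_mainVec_of_robin (N c : ℝ) {x V : E n} {u g : ℝ} {A : E n →L[ℝ] E n} (hx : ‖x‖ = 1)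
    (hV : inner ℝ x V = u) (hsymm : inner ℝ x (A V) = inner ℝ (A x) V) (hA : A x = g • x) :
    inner ℝ x (mainVec N c x u V A) = 0 := by
  have h1 : inner ℝ x x = (1 : ℝ) := by rw [real_inner_self_eq_norm_sq, hx, one_pow]
  -- With A x = g x the two Hessian terms contribute −w u² g and w u² g.
  simp only [mainVec, coefGrad, coefPos, coefVert, inner_add_right, hsymm, hA,
    real_inner_smul_left, real_inner_smul_right, h1, hV]
  ring

lemma opNorm_le_sum (A : E n →L[ℝ] E n) : ‖A‖ ≤ ∑ i, ‖A (e i)‖ := by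
  refine A.opNorm_le_bound (Finset.sum_nonneg fun _ _ => norm_nonneg _) fun v => ?_
  conv_lhs => rw [← sum_smul_e v, map_sum]
  refine (norm_sum_le _ _).trans ?_
  rw [Finset.sum_mul]
  refine Finset.sum_le_sum fun i _ => ?_
  rw [map_smul, norm_smul, mul_comm]
  exact mul_le_mul_of_nonneg_left (PiLp.norm_apply_le v i) (norm_nonneg _)

/-- The vector field grows linearly in the Hessian, with a coefficient that vanishes with `u`. -/
lemma exists_norm_mainVec_le (N c C : ℝ) : ∃ K, 0 ≤ K ∧ ∀ (x : E n) (u : ℝ) (V : E n)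
    (A : E n →L[ℝ] E n), ‖x‖ ≤ C → |u| ≤ C → ‖V‖ ≤ C →
      ‖mainVec N c x u V A‖ ≤ K * (1 + |u| * ‖A‖) := by
  have hcont : ContinuousOn (fun z : E n × ℝ × E n => mainVec N c z.1 z.2.1 z.2.2 0)
      (Metric.closedBall 0 C) :=
    (contDiffOn_mainVec (k := 0) N c contDiffOn_fst contDiff_snd.fst.contDiffOn
      contDiff_snd.snd.contDiffOn contDiffOn_const).continuousOn
  obtain ⟨K, hK⟩ := (isCompact_closedBall _ C).exists_bound_of_continuousOn hcont
  refine ⟨|K| + 2 * (|C| ^ 2 + |C| ^ 3), by positivity, fun x u V A hx hu hV => ?_⟩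
  have hC : 0 ≤ C := (norm_nonneg x).trans hx
  rw [abs_of_nonneg hC]
  have h1 := hK (x, u, V) (by
    rw [mem_closedBall_zero_iff]
    exact max_le hx (max_le hu hV))
  have hw : |inner ℝ x (e (Fin.last n))| ≤ C := by
    rw [inner_e]
    exact (PiLp.norm_apply_le x _).trans hx
  -- The part without Hessian is continuous in (x, u, V) and hence bounded on a compact set; both
  -- Hessian terms carry a factor u.
  have h2 : mainVec N c x u V A = mainVec N c x u V 0 +
      ((-(inner ℝ x (e (Fin.last n)) * u)) • A V +
        (inner ℝ x (e (Fin.last n)) * (u * u)) • A x) := by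
    simp only [mainVec, zero_apply, smul_zero, add_zero, add_assoc]
  have hA := norm_nonneg A
  have hu0 := abs_nonneg u
  have h3 : ‖(-(inner ℝ x (e (Fin.last n)) * u)) • A V‖ ≤ C ^ 2 * (|u| * ‖A‖) := by
    rw [norm_smul, Real.norm_eq_abs, abs_neg, abs_mul]
    calc |inner ℝ x (e (Fin.last n))| * |u| * ‖A V‖ ≤ C * |u| * (‖A‖ * C) := by
          refine mul_le_mul (mul_le_mul_of_nonneg_right hw hu0) ?_ (norm_nonneg _) (by positivity)
          exact (A.le_opNorm V).trans (mul_le_mul_of_nonneg_left hV hA)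
      _ = C ^ 2 * (|u| * ‖A‖) := by ring
  have h4 : ‖(inner ℝ x (e (Fin.last n)) * (u * u)) • A x‖ ≤ C ^ 3 * (|u| * ‖A‖) := by
    rw [norm_smul, Real.norm_eq_abs, abs_mul, abs_mul]
    calc |inner ℝ x (e (Fin.last n))| * (|u| * |u|) * ‖A x‖ ≤ C * (|u| * C) * (‖A‖ * C) := by
          refine mul_le_mul (mul_le_mul hw (mul_le_mul_of_nonneg_left hu hu0) (by positivity) hC)
            ?_ (norm_nonneg _) (by positivity)
          exact (A.le_opNorm x).trans (mul_le_mul_of_nonneg_left hx hA)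
      _ = C ^ 3 * (|u| * ‖A‖) := by ring
  rw [h2]
  refine (norm_add_le _ _).trans ?_
  have h5 := norm_add_le ((-(inner ℝ x (e (Fin.last n)) * u)) • A V)
    ((inner ℝ x (e (Fin.last n)) * (u * u)) • A x)
  have h6 : 0 ≤ |u| * ‖A‖ := by positivity
  have h7 : 0 ≤ |K| * (|u| * ‖A‖) := by positivity
  have h8 : 0 ≤ (C ^ 2 + C ^ 3) * (|u| * ‖A‖) := by positivity
  have h9 : 0 ≤ C ^ 2 + C ^ 3 := by positivity
  have h10 : ‖mainVec N c x u V 0‖ ≤ |K| := h1.trans (le_abs_self K)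
  nlinarith

/-! ### The field attached to the solution -/

namespace IsHalfBallDomain

variable {Ω Sig T : Set (E n)} {u : E n → ℝ}

/-- The vector field of the fundamental identity. -/
def mainField (Ω Sig T : Set (E n)) (u : E n → ℝ) (c : ℝ) (x : E n) : E n :=
  mainVec ((n : ℝ) + 1) c x (u x) (gradWithin (regularPart Ω Sig T) u x)
    (hessWithin (regularPart Ω Sig T) u x)

variable (h : IsHalfBallDomain Ω Sig T) (hu : IsSolution Ω Sig T u) (c : ℝ)
include h hu

lemma contDiffOn_mainField : ContDiffOn ℝ ∞ (mainField Ω Sig T u c) (regularPart Ω Sig T) :=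
  contDiffOn_mainVec ((n : ℝ) + 1) c contDiffOn_id hu.smooth (h.contDiffOn_grad hu)
    (h.contDiffOn_hess hu)

lemma divergence_mainField {x : E n} (hx : x ∈ Ω) : divergence (mainField Ω Sig T u c) x =
    x (Fin.last n) * (-u x) *
      (hessianNormSq u x - (Laplacian.laplacian u x) ^ 2 / ((n : ℝ) + 1)) := by
  have hs := h.uniqueDiffOn_regularPart
  have hn := h.regularPart_mem_nhds hx
  have hxs := h.subset_regularPart hx
  have hN : (n : ℝ) + 1 ≠ 0 := by positivity
  have hH : HasFDerivAt (hessWithin (regularPart Ω Sig T) u)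
      (fderiv ℝ (hessWithin (regularPart Ω Sig T) u) x) x :=
    (((h.contDiffOn_hess hu).contDiffAt hn).differentiableAt (by simp)).hasFDerivAt
  have key := divergence_mainVec (N := (n : ℝ) + 1) rfl c
    ((hasFDerivWithinAt_innerSL_gradWithin (s := regularPart Ω Sig T) hu.smooth hxs).hasFDerivAt hn)
    ((hasFDerivWithinAt_gradWithin hs hu.smooth hxs).hasFDerivAt hn) hH
    (fun a b => h.inner_hess_comm hu hxs a b)
    ((laplacian_eq_sum hs hu.smooth hn).symm.trans (hu.laplacian_eq x hx))
    (sum_fderiv_hessWithin_eq_zero hs hu.smooth h.isOpen h.subset_regularPart hu.laplacian_eq hx)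
  rw [hessianNormSq_eq hs hu.smooth hn, hu.laplacian_eq x hx, pow_two, mul_div_assoc, div_self hN,
    mul_one, mul_neg]
  exact key

lemma inner_mainField_of_mem_sig {x : E n} (hx : x ∈ Sig) :
    inner ℝ (mainField Ω Sig T u c x) (outerNormal Ω x) =
      1 / 2 * ((normalDeriv Ω u x ^ 2 - c ^ 2) * (x (Fin.last n) * normalDeriv Ω u x -
        inner ℝ (killingField x) (outerNormal Ω x))) := by
  rw [mainField, hu.dirichlet x hx, h.grad_eq_of_mem_sig hu hx]
  exact inner_mainVec_of_normal _ _ _ _ _ (h.norm_outerNormal hx) _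

lemma inner_mainField_of_mem_t {x : E n} (hx : x ∈ T) :
    inner ℝ x (mainField Ω Sig T u c x) = 0 :=
  inner_mainVec_of_robin _ _ (by simpa using h.t_subset hx) (h.inner_grad_of_mem_t hu hx)
    (h.inner_hess_comm hu (h.t_subset_regularPart hx) _ _).symm (h.hess_apply_self_of_mem_t hu hx)

/-- The volume integrand is integrable. -/
lemma integrableOn_volume (hu₁ : MemSobolev Ω 1 ⊤ u) (hu₂ : MemSobolev Ω 2 2 u) :
    IntegrableOn (fun x => x (Fin.last n) * (-u x) *
      (hessianNormSq u x - (Laplacian.laplacian u x) ^ 2 / ((n : ℝ) + 1))) Ω := by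
  have := h.isFiniteMeasure
  obtain ⟨C, hC0, hC⟩ := h.exists_bound hu hu₁
  have hint : IntegrableOn (fun x => ∑ i, ‖hessWithin (regularPart Ω Sig T) u x (e i)‖ ^ 2 -
      ((n : ℝ) + 1) ^ 2 / ((n : ℝ) + 1)) Ω :=
    (integrable_finsetSum _ fun i _ =>
      (h.memLp_hess_apply hu hu₂ i).integrable_norm_pow (by simp)).sub (integrable_const _)
  have hint2 : IntegrableOn (fun x => hessianNormSq u x -
      (Laplacian.laplacian u x) ^ 2 / ((n : ℝ) + 1)) Ω := by
    refine hint.congr_fun (fun x hx => ?_) h.isOpen.measurableSet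
    simp only [hessianNormSq_eq h.uniqueDiffOn_regularPart hu.smooth (h.regularPart_mem_nhds hx),
      hu.laplacian_eq x hx]
  have hcont : ContinuousOn (fun x : E n => x (Fin.last n) * (-u x)) Ω :=
    ContinuousOn.mul (by fun_prop) (hu.smooth.continuousOn.mono h.subset_regularPart).neg
  refine hint2.bdd_mul (c := 1 * C) (hcont.aestronglyMeasurable h.isOpen.measurableSet) ?_
  filter_upwards [ae_restrict_mem h.isOpen.measurableSet] with x hx
  rw [norm_mul, norm_neg]
  refine mul_le_mul ?_ (hC x (h.subset_regularPart hx)).1 (norm_nonneg _) zero_le_one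
  have h1 : ‖x‖ < 1 := by simpa using h.subset_ball hx
  exact (PiLp.norm_apply_le x _).trans h1.le

lemma memLp_mainField (hu₁ : MemSobolev Ω 1 ⊤ u) (hu₂ : MemSobolev Ω 2 2 u) :
    MemLp (mainField Ω Sig T u c) 2 (volume.restrict Ω) := by
  have := h.isFiniteMeasure
  obtain ⟨C, hC0, hC⟩ := h.exists_bound hu hu₁
  -- The radius C + 1 also covers ‖x‖ < 1.
  obtain ⟨K, hK0, hK⟩ := exists_norm_mainVec_le (n := n) ((n : ℝ) + 1) c (C + 1)
  have hg : MemLp (fun x => 1 + ∑ i, ‖hessWithin (regularPart Ω Sig T) u x (e i)‖) 2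
      (volume.restrict Ω) := by
    have h1 : MemLp (fun x => ∑ i, ‖hessWithin (regularPart Ω Sig T) u x (e i)‖) 2
        (volume.restrict Ω) :=
      memLp_finsetSum Finset.univ fun i _ => (h.memLp_hess_apply hu hu₂ i).norm
    have h0 : MemLp (fun _ : E n => (1 : ℝ)) 2 (volume.restrict Ω) := memLp_const 1
    exact h0.add h1
  refine hg.of_le_mul (c := K * (1 + C))
    (((h.contDiffOn_mainField hu c).continuousOn.mono
      h.subset_regularPart).aestronglyMeasurable h.isOpen.measurableSet) ?_
  filter_upwards [ae_restrict_mem h.isOpen.measurableSet] with x hx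
  obtain ⟨b1, b2⟩ := hC x (h.subset_regularPart hx)
  have b3 : ‖x‖ < 1 := by simpa using h.subset_ball hx
  have b7 : ‖mainField Ω Sig T u c x‖ ≤ K * (1 + |u x| * ‖hessWithin (regularPart Ω Sig T) u x‖) :=
    hK x (u x) (gradWithin (regularPart Ω Sig T) u x) (hessWithin (regularPart Ω Sig T) u x)
      (by linarith) (by linarith) (by linarith)
  refine b7.trans ?_
  have b4 := opNorm_le_sum (hessWithin (regularPart Ω Sig T) u x)
  have b5 : 0 ≤ ‖hessWithin (regularPart Ω Sig T) u x‖ := norm_nonneg _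
  rw [Real.norm_eq_abs, mul_assoc]
  refine mul_le_mul_of_nonneg_left ((?_ : _ ≤ (1 + C) * _).trans
    (mul_le_mul_of_nonneg_left (le_abs_self _) (by positivity))) hK0
  have b6 := mul_le_mul b1 b4 b5 hC0
  have b8 := b5.trans b4
  linarith

/-- The normal component of the vector field is integrable on `Sig`. -/
lemma integrableOn_inner_mainField (hu₁ : MemSobolev Ω 1 ⊤ u) :
    IntegrableOn (fun x => inner ℝ (mainField Ω Sig T u c x) (outerNormal Ω x)) Sig μHE[n] := by
  obtain ⟨C, hC0, hC⟩ := h.exists_bound hu hu₁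
  obtain ⟨K, hK0, hK⟩ := exists_norm_mainVec_le (n := n) ((n : ℝ) + 1) c (C + 1)
  refine IntegrableOn.of_bound h.sig_area
    ((((h.contDiffOn_mainField hu c).continuousOn.mono h.sig_subset_regularPart).inner
      h.continuousOn_outerNormal).aestronglyMeasurable h.measurableSet_sig) K ?_
  filter_upwards [ae_restrict_mem h.measurableSet_sig] with x hx
  obtain ⟨b1, b2⟩ := hC x (h.sig_subset_regularPart hx)
  have b3 : ‖x‖ < 1 := by simpa using h.sig_subset hx
  have b4 : ‖mainField Ω Sig T u c x‖ ≤ K * (1 + |u x| * ‖hessWithin (regularPart Ω Sig T) u x‖) :=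
    hK x (u x) (gradWithin (regularPart Ω Sig T) u x) (hessWithin (regularPart Ω Sig T) u x)
      (by linarith) (by linarith) (by linarith)
  -- No bound on the Hessian is available up to the corner; u = 0 on Σ removes it from the estimate.
  rw [hu.dirichlet x hx, abs_zero, zero_mul, add_zero, mul_one] at b4
  refine (norm_inner_le_norm _ _).trans ?_
  rw [h.norm_outerNormal hx, mul_one]
  exact b4

end IsHalfBallDomain

end HalfBall

end

/-- Fundamental identity in dimension `N = n + 1 ≥ 2`. Both integrals converge. -/
theorem theorem2p3 (n : ℕ) (hn : 1 ≤ n) (Ω Sig T : Set (HalfBall.E n))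
    (hΩ : IsHalfBallDomain Ω Sig T) (u : HalfBall.E n → ℝ) (hu : IsSolution Ω Sig T u)
    (hu₁ : MemSobolev Ω 1 ⊤ u) (hu₂ : MemSobolev Ω 2 2 u) (c : ℝ) :
    IntegrableOn (fun x => x (Fin.last n) * (-u x) *
      (hessianNormSq u x - (Laplacian.laplacian u x) ^ 2 / ((n : ℝ) + 1))) Ω ∧
    IntegrableOn (fun x => ((normalDeriv Ω u x) ^ 2 - c ^ 2) *
      (x (Fin.last n) * normalDeriv Ω u x - inner ℝ (killingField x) (outerNormal Ω x)))
      Sig μHE[n] ∧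
    ∫ x in Ω, x (Fin.last n) * (-u x) *
      (hessianNormSq u x - (Laplacian.laplacian u x) ^ 2 / ((n : ℝ) + 1)) =
    (1 / 2) * ∫ x in Sig, ((normalDeriv Ω u x) ^ 2 - c ^ 2) *
      (x (Fin.last n) * normalDeriv Ω u x - inner ℝ (killingField x) (outerNormal Ω x))
      ∂μHE[n] := by
  have hvol := hΩ.integrableOn_volume hu hu₁ hu₂
  have hdiv : EqOn (divergence (IsHalfBallDomain.mainField Ω Sig T u c)) _ Ω :=
    fun x hx => hΩ.divergence_mainField hu c hx
  have hsig : EqOn (fun x => inner ℝ (IsHalfBallDomain.mainField Ω Sig T u c x) (outerNormal Ω x))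
      _ Sig := fun x hx => hΩ.inner_mainField_of_mem_sig hu c hx
  have hbd := hΩ.integrableOn_inner_mainField hu c hu₁
  have hF : IsTangentField Ω Sig T (IsHalfBallDomain.mainField Ω Sig T u c) :=
    ⟨((hΩ.contDiffOn_mainField hu c).mono hΩ.subset_regularPart).of_le (by simp),
      (hΩ.contDiffOn_mainField hu c).continuousOn,
      hvol.congr_fun hdiv.symm hΩ.isOpen.measurableSet,
      fun y hy => hΩ.inner_mainField_of_mem_t hu c hy⟩
  refine ⟨hvol, ?_, ?_⟩
  · have h1 := (hbd.congr_fun hsig hΩ.measurableSet_sig).const_mul 2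
    refine h1.congr (Filter.Eventually.of_forall fun x => ?_)
    ring
  · rw [← integral_const_mul, ← setIntegral_congr_fun hΩ.isOpen.measurableSet hdiv,
      ← setIntegral_congr_fun hΩ.measurableSet_sig hsig]
    exact hΩ.integral_divergence hF (hΩ.memLp_mainField hu c hu₁ hu₂) hbd
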